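/- For real parameters $a,b,c,d$ consider the one-dimensional $(abcd)$-Boussinesq system for real-valued $\eta(t,x),u(t,x)$, $$(1-b\partial_x^2)\partial_t\eta+\partial_x\bigl(a\partial_x^2u+u+u\eta\bigr)=0,\qquad (1-d\partial_x^2)\partial_tu+\partial_x\bigl(c\partial_x^2\eta+\eta+\tfrac12u^2\bigr)=0,\qquad x\in\mathbb R .$$ Let $H^\infty(\mathbb R)=\bigcap_{k\ge 0}H^k(\mathbb R)$. A smooth solution on $[0,T]$ is a curve $v=(\eta,u):[0,T]\to H^\infty(\mathbb R)\times H^\infty(\mathbb R)$ that is differentiable in time (in every $H^k$, with time derivative in $H^\infty\times H^\infty$) and satisfies the system. **Theorem.** Suppose that either 1. $a,c<0$, $b,d>0$ (generic regime) and $s<-\tfrac12$; or 2. $a=c=\tfrac16$, $b=d=0$ (KdV-KdV regime) and $s<-\tfrac32$. Then the system is ill-posed in $H^s(\mathbb R)\times H^s(\mathbb R)$, in the sense that the flow map from initial data to solutions is discontinuous at the origin. Precisely: a smooth solution is uniquely determined by its initial data, so that the flow map $v_0\mapsto v[v_0]$ on $H^\infty\times H^\infty$ is well defined for as long as the solution exists;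 and for every $T>0$ it is not continuous at $0$ from the $H^s\times H^s$ norm to the norm of $C([0,T];H^s\times H^s)$: there is $\varepsilon>0$ such that for every $\delta>0$ there are $v_0\in H^\infty\times H^\infty$ with $\|v_0\|_{H^s\times H^s}<\delta$ and $t\in[0,T]$ such that the smooth solution $v[v_0]$ exists on $[0,t]$ and $\|v[v_0](t)\|_{H^s\times H^s}\ge\varepsilon$. -/

import Mathlib

open MeasureTheory Filter Topology Set
open scoped ENNReal ContDiff

noncomputable section

namespace Boussinesq

/-- The Sobolev norm `‖f‖_{H^s(ℝ)} = ‖(1 + |ξ|²)^{s/2} f̂‖_{L²}` of a real function `f ∈ L²(ℝ)`, for any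
real `s`, where `f̂` is the Fourier transform on `L²`.  Mathlib's Fourier transform has the kernel
`e^{-2πixξ}`, hence the weight `(1 + (2πξ)²)^s`.  It is only used for functions in `L²(ℝ)`. -/
def sobolevNorm (s : ℝ) (f : ℝ → ℝ) : ℝ≥0∞ :=
  open scoped Classical in
  if hf : MemLp (fun x => (f x : ℂ)) 2 (volume : Measure ℝ) then
    (∫⁻ ξ : ℝ, ENNReal.ofReal ((1 + (2 * Real.pi * ξ) ^ 2) ^ s) *
      ‖(Lp.fourierTransformₗᵢ ℝ ℂ (hf.toLp (fun x => (f x : ℂ))) : ℝ → ℂ) ξ‖ₑ ^ 2) ^ (1 / 2 : ℝ)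
  else ⊤

/-- A state `(η, u)` of the system at a given time. -/
abbrev State : Type := (ℝ → ℝ) × (ℝ → ℝ)

/-- The norm of `(η, u)` in `H^s(ℝ) × H^s(ℝ)`. -/
def stateNorm (s : ℝ) (v : State) : ℝ≥0∞ := sobolevNorm s v.1 + sobolevNorm s v.2

/-- `f ∈ H^∞(ℝ) = ⋂ₖ Hᵏ(ℝ)`: `f` is smooth and all its derivatives are in `L²(ℝ)`. -/
def IsHInf (f : ℝ → ℝ) : Prop :=
  ContDiff ℝ ∞ f ∧ ∀ k : ℕ, MemLp (iteratedDeriv k f) 2 (volume : Measure ℝ)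

/-- The curve `τ ↦ f τ` in `H^∞(ℝ)` has the derivative `g` at the time `t`, relative to the set `S` of
times: the difference quotients converge to `g` in `Hᵏ(ℝ)` for every `k`. -/
def HasTimeDerivWithin (f : ℝ → ℝ → ℝ) (g : ℝ → ℝ) (S : Set ℝ) (t : ℝ) : Prop :=
  ∀ k : ℕ, Tendsto
    (fun τ => eLpNorm (iteratedDeriv k (fun x => (f τ x - f t x) / (τ - t) - g x)) 2
      (volume : Measure ℝ))
    (𝓝[S \ {t}] t) (𝓝 0)

/-- `t ↦ v t = (η(t), u(t))` is a smooth solution on the time interval `[0, T]` of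
`(1 - b ∂ₓ²) ∂ₜ η + ∂ₓ (a ∂ₓ² u + u + u η) = 0`,
`(1 - d ∂ₓ²) ∂ₜ u + ∂ₓ (c ∂ₓ² η + η + u² / 2) = 0`:
it is a differentiable curve in `H^∞(ℝ) × H^∞(ℝ)`, and the equations hold pointwise.
Here `p` and `q` are the time derivatives of `η` and `u`. -/
def IsSolution (a b c d T : ℝ) (v : ℝ → State) : Prop :=
  ∃ p q : ℝ → ℝ → ℝ, ∀ t ∈ Icc 0 T,
    IsHInf (v t).1 ∧ IsHInf (v t).2 ∧ IsHInf (p t) ∧ IsHInf (q t) ∧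
    HasTimeDerivWithin (fun τ => (v τ).1) (p t) (Icc 0 T) t ∧
    HasTimeDerivWithin (fun τ => (v τ).2) (q t) (Icc 0 T) t ∧
    ∀ x : ℝ,
      (p t x - b * iteratedDeriv 2 (p t) x) +
        deriv (fun y => a * iteratedDeriv 2 (v t).2 y + (v t).2 y + (v t).2 y * (v t).1 y) x = 0 ∧
      (q t x - d * iteratedDeriv 2 (q t) x) +
        deriv (fun y => c * iteratedDeriv 2 (v t).1 y + (v t).1 y + (1 / 2) * (v t).2 y ^ 2) x = 0

/-- The data `v₀` has a smooth solution on `[0, t]`; in other words, `(v₀, t)` is in the domain of the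
flow. -/
def SolvableUpTo (a b c d : ℝ) (v₀ : State) (t : ℝ) : Prop :=
  ∃ v : ℝ → State, IsSolution a b c d t v ∧ v 0 = v₀

/-- Solutions are determined by their initial data, so that the flow map is well defined. -/
def UniqueSolutions (a b c d : ℝ) : Prop :=
  ∀ (T : ℝ) (v w : ℝ → State), IsSolution a b c d T v → IsSolution a b c d T w → v 0 = w 0 →
    ∀ t ∈ Icc 0 T, v t = w t

/-- The flow map: `flowMap a b c d v₀ t` is the value at time `t` of the smooth solution with initial
data `v₀` (a dummy value if there is no smooth solution on `[0, t]`). -/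
def flowMap (a b c d : ℝ) (v₀ : State) (t : ℝ) : State :=
  open scoped Classical in
  if h : SolvableUpTo a b c d v₀ t then h.choose t else 0

/-- Continuity of the flow map at the origin, from initial data with the norm of `H^s × H^s` to
solutions with the norm `sup_{0 ≤ t ≤ T} ‖v(t)‖_{H^s × H^s}`: for data `v₀ ∈ H^∞ × H^∞` that are small
in `H^s × H^s`, the solution is uniformly small in `H^s × H^s` at all times `t ∈ [0, T]` up to which
it exists. -/
def FlowContinuousAtOrigin (a b c d s T : ℝ) : Prop :=
  ∀ ε : ℝ≥0∞, 0 < ε → ∃ δ : ℝ≥0∞, 0 < δ ∧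
    ∀ v₀ : State, IsHInf v₀.1 → IsHInf v₀.2 → stateNorm s v₀ < δ →
      ∀ t ∈ Icc 0 T, SolvableUpTo a b c d v₀ t → stateNorm s (flowMap a b c d v₀ t) < ε

end Boussinesq

end

/-! The mechanism of ill-posedness is a high × high → low interaction. Write `η̂ = H` and `û = iU`
with `H` even, `U` odd, both real. The system becomes a real one for `(H, U)`, in which `U` is
forced by half of `b₂ (U ⋆ U)`. Take `H = 0` and let `U` be an odd bump of height about `A` on `N ≤
|ξ| ≤ 2N`. For `|ξ| ≤ 1` the two factors in `U ⋆ U` sit at nearly opposite frequencies, where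
oddness gives them opposite signs; nothing cancels, and `U ⋆ U` is at most a negative multiple of
`A²N` (`rconv_pulse_le`). At the time `τ = 1/(A²N)` the values of `U` on `[1/2, 1]` have dropped
below a fixed `-c`, which bounds the `H^s` norm from below, whereas the data have `H^s` norm at most
of order `A N^(s+1/2)`.

Everything else has to stay small up to time `τ` (`exists_inflation`). Let `N^m` bound the nonlinear
symbols at frequency `N`, so `m = 0` in the generic and `m = 1` in the KdV-KdV regime. The relative
nonlinear change of the solution is of order `N^m · N · A · τ = N^m / A`, and the linear phase on
the bump is of order `N^(2m+1) τ = (N^m / A)²`. Both are small for `A = N^(m+e)` with `e > 0` and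
`N` large. The data then have size `N^(s+1/2+m+e)`, which tends to zero for small `e` exactly when
`s < -1/2 - m`.

Existence up to time `τ` comes from a Cauchy–Kovalevskaya argument on the Fourier side, with no
dispersive theory. Profiles of the linear group are measured against `exp(-ρ(1 + |ξ|/N)) / (1 +
(ξ/N)²)`, where `ρ` falls linearly from `1` to `1/2`. The rational factor gives a convolution
estimate (`abs_rconv_le`), and the falling `ρ` pays for the growth `1 + |ξ|/N` of the nonlinear
symbols when integrated in time (`norm_integral_clamp_le`). The Duhamel map is then a contraction
(`exists_fixedPoint`), and its fixed point is turned into a smooth solution by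
`IsSpectralSolution.isSolution`.

Uniqueness is an energy estimate for the difference `(h, w)` of two solutions. In the generic regime
a quadratic form equivalent to the `H²` norm is conserved by the linear flow, and Grönwall applies.
In the KdV-KdV regime the nonlinearity costs a derivative; the energy is the quadratic form of the
Hamiltonian with coefficients given by the mean of the two solutions, with its sign reversed and a
multiple of the `L²` norm added to make it coercive in `H¹`. -/

noncomputable section

namespace Boussinesq

open FourierTransform ComplexConjugate

/-! ### Real functions synthesized from rapidly decaying Fourier transforms. -/

/-- `F` decays faster than any power. -/
def RapidDecay (F : ℝ → ℂ) : Prop := ∀ k : ℕ, ∃ C : ℝ, ∀ ξ, (1 + |ξ|) ^ k * ‖F ξ‖ ≤ C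

theorem RapidDecay.mul_of_growth {F g : ℝ → ℂ} (hF : RapidDecay F) (m : ℕ) (C : ℝ)
    (hg : ∀ ξ, ‖g ξ‖ ≤ C * (1 + |ξ|) ^ m) : RapidDecay (fun ξ => g ξ * F ξ) := by
  intro k
  obtain ⟨D, hD⟩ := hF (m + k)
  have hC : 0 ≤ C := by
    have := (norm_nonneg _).trans (hg 0)
    simpa using this
  refine ⟨C * D, fun ξ => ?_⟩
  rw [norm_mul]
  calc (1 + |ξ|) ^ k * (‖g ξ‖ * ‖F ξ‖) ≤ (1 + |ξ|) ^ k * ((C * (1 + |ξ|) ^ m) * ‖F ξ‖) := by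
        gcongr; exact hg ξ
    _ = C * ((1 + |ξ|) ^ (m + k) * ‖F ξ‖) := by ring
    _ ≤ C * D := by gcongr; exact hD ξ

theorem RapidDecay.add {F G : ℝ → ℂ} (hF : RapidDecay F) (hG : RapidDecay G) :
    RapidDecay (fun ξ => F ξ + G ξ) := by
  intro k
  obtain ⟨C, hC⟩ := hF k
  obtain ⟨D, hD⟩ := hG k
  refine ⟨C + D, fun ξ => ?_⟩
  calc (1 + |ξ|) ^ k * ‖F ξ + G ξ‖ ≤ (1 + |ξ|) ^ k * (‖F ξ‖ + ‖G ξ‖) := by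
        gcongr; exact norm_add_le _ _
    _ ≤ C + D := by rw [mul_add]; exact add_le_add (hC ξ) (hD ξ)

theorem integrable_decay : Integrable (fun x : ℝ => ((1 + |x|) ^ 2)⁻¹) := by
  have := integrable_one_add_norm (E := ℝ) (μ := volume) (r := 2) (by simp)
  refine this.congr (Eventually.of_forall fun x => ?_)
  simp only [Real.norm_eq_abs]
  rw [Real.rpow_neg (by positivity)]
  norm_cast

theorem RapidDecay.integrable {F : ℝ → ℂ} (hF : RapidDecay F) (hc : Continuous F) :
    Integrable F := by
  obtain ⟨C, hC⟩ := hF 2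
  refine (integrable_decay.const_mul C).mono' hc.aestronglyMeasurable
    (Eventually.of_forall fun ξ => ?_)
  rw [← div_eq_mul_inv, le_div_iff₀ (by positivity), mul_comm]
  exact hC ξ

theorem RapidDecay.bounded {F : ℝ → ℂ} (hF : RapidDecay F) : ∃ C, 0 ≤ C ∧ ∀ ξ, ‖F ξ‖ ≤ C := by
  obtain ⟨C, hC⟩ := hF 0
  simp only [pow_zero, one_mul] at hC
  exact ⟨C, (norm_nonneg _).trans (hC 0), hC⟩

theorem RapidDecay.memLp_two {F : ℝ → ℂ} (hF : RapidDecay F) (hc : Continuous F) :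
    MemLp F 2 := by
  obtain ⟨C, hC0, hC⟩ := hF.bounded
  rw [memLp_two_iff_integrable_sq_norm hc.aestronglyMeasurable]
  refine ((hF.integrable hc).norm.const_mul C).mono' (by fun_prop)
    (Eventually.of_forall fun ξ => ?_)
  rw [Real.norm_of_nonneg (by positivity), sq]
  gcongr
  exact hC ξ

/-- Fourier transforms of the functions in `H^∞` which we construct. -/
structure IsSpectral (F : ℝ → ℂ) : Prop where
  cont : Continuous F
  decay : RapidDecay F
  herm : ∀ ξ, F (-ξ) = conj (F ξ)

/-- The real function with the Fourier transform `F`. -/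
def synth (F : ℝ → ℂ) : ℝ → ℝ := fun x => (𝓕⁻ F x).re

theorem IsSpectral.integrable {F : ℝ → ℂ} (hF : IsSpectral F) : Integrable F :=
  hF.decay.integrable hF.cont

theorem fourierInv_real_eq (F : ℝ → ℂ) (x : ℝ) :
    𝓕⁻ F x = ∫ ξ : ℝ, Complex.exp (2 * Real.pi * Complex.I * x * ξ) * F ξ := by
  rw [Real.fourierInv_eq']
  congr 1
  ext ξ
  simp only [smul_eq_mul, RCLike.inner_apply, conj_trivial]
  congr 2
  push_cast
  ring

/-- Hermitian symmetry makes the inverse transform real, so the real part taken in `synth` loses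
nothing. -/
theorem IsSpectral.coe_synth {F : ℝ → ℂ} (hF : IsSpectral F) (x : ℝ) :
    ((synth F x : ℝ) : ℂ) = 𝓕⁻ F x := by
  unfold synth
  rw [← Complex.conj_eq_iff_re, fourierInv_real_eq, ← integral_conj,
    ← integral_neg_eq_self]
  congr 1
  ext ξ
  rw [map_mul, ← hF.herm, neg_neg, ← Complex.exp_conj]
  congr 2
  simp [Complex.conj_ofNat]

theorem IsSpectral.mul {F g : ℝ → ℂ} (hF : IsSpectral F) (m : ℕ) (C : ℝ)
    (hg : ∀ ξ, ‖g ξ‖ ≤ C * (1 + |ξ|) ^ m) (hgc : Continuous g)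
    (hgh : ∀ ξ, g (-ξ) = conj (g ξ)) : IsSpectral (fun ξ => g ξ * F ξ) where
  cont := hgc.mul hF.cont
  decay := hF.decay.mul_of_growth m C hg
  herm ξ := by rw [hgh, hF.herm, map_mul]

theorem IsSpectral.add {F G : ℝ → ℂ} (hF : IsSpectral F) (hG : IsSpectral G) :
    IsSpectral (fun ξ => F ξ + G ξ) where
  cont := hF.cont.add hG.cont
  decay := hF.decay.add hG.decay
  herm ξ := by rw [hF.herm, hG.herm, map_add]

theorem IsSpectral.smul {F : ℝ → ℂ} (hF : IsSpectral F) (r : ℝ) :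
    IsSpectral (fun ξ => (r : ℂ) * F ξ) :=
  hF.mul 0 |r| (by simp) continuous_const (by simp)

/-- The Fourier multiplier of the derivative. -/
def dsym (ξ : ℝ) : ℂ := 2 * Real.pi * Complex.I * ξ

theorem norm_dsym_le (ξ : ℝ) : ‖dsym ξ‖ ≤ 2 * Real.pi * (1 + |ξ|) := by
  simp only [dsym, norm_mul, Complex.norm_ofNat, Complex.norm_real, Complex.norm_I, mul_one,
    Real.norm_eq_abs, abs_of_pos Real.pi_pos]
  gcongr
  linarith

theorem IsSpectral.dsym_pow {F : ℝ → ℂ} (hF : IsSpectral F) (k : ℕ) :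
    IsSpectral (fun ξ => dsym ξ ^ k * F ξ) := by
  refine hF.mul k ((2 * Real.pi) ^ k) (fun ξ => ?_) ?_ (fun ξ => ?_)
  · rw [norm_pow, ← mul_pow]
    gcongr
    exact norm_dsym_le ξ
  · unfold dsym; fun_prop
  · simp [dsym, Complex.conj_ofNat]

theorem IsSpectral.dsym {F : ℝ → ℂ} (hF : IsSpectral F) :
    IsSpectral (fun ξ => Boussinesq.dsym ξ * F ξ) := by
  simpa using hF.dsym_pow 1

theorem IsSpectral.hasDerivAt_synth {F : ℝ → ℂ} (hF : IsSpectral F) (x : ℝ) :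
    HasDerivAt (synth F) (synth (fun ξ => Boussinesq.dsym ξ * F ξ) x) x := by
  have h1 : Integrable (fun ξ : ℝ => F (-ξ)) := hF.integrable.comp_neg
  have h2 : Integrable (fun ξ : ℝ => ξ • F (-ξ)) := by
    have : RapidDecay (fun ξ : ℝ => (ξ : ℂ) * F ξ) :=
      hF.decay.mul_of_growth 1 1 (fun ξ => by simp)
    have h := (this.integrable (by have := hF.cont; fun_prop)).comp_neg.neg
    refine h.congr (Eventually.of_forall fun ξ => ?_)
    simp
  have h := Real.hasDerivAt_fourier h1 h2 x
  have e1 : 𝓕 (fun ξ : ℝ => F (-ξ)) = 𝓕⁻ F := (Real.fourierInv_eq_fourier_comp_neg F).symm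
  have e2 : 𝓕 (fun ξ : ℝ => (-2 * Real.pi * Complex.I * ξ) • F (-ξ))
      = 𝓕⁻ (fun ξ => Boussinesq.dsym ξ * F ξ) := by
    rw [Real.fourierInv_eq_fourier_comp_neg]
    congr 1
    ext ξ
    simp [Boussinesq.dsym]
  rw [e1, e2] at h
  exact Complex.reCLM.hasFDerivAt.comp_hasDerivAt x h

theorem IsSpectral.deriv_synth {F : ℝ → ℂ} (hF : IsSpectral F) :
    deriv (synth F) = synth (fun ξ => Boussinesq.dsym ξ * F ξ) :=
  funext fun x => (hF.hasDerivAt_synth x).deriv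

theorem IsSpectral.iteratedDeriv_synth {F : ℝ → ℂ} (hF : IsSpectral F) (k : ℕ) :
    iteratedDeriv k (synth F) = synth (fun ξ => Boussinesq.dsym ξ ^ k * F ξ) := by
  induction k with
  | zero => simp
  | succ k ih =>
    rw [iteratedDeriv_succ, ih, (hF.dsym_pow k).deriv_synth]
    congr 1
    ext ξ
    ring

theorem IsSpectral.contDiff_synth {F : ℝ → ℂ} (hF : IsSpectral F) : ContDiff ℝ ∞ (synth F) := by
  refine contDiff_of_differentiable_iteratedDeriv fun m _ => ?_
  rw [hF.iteratedDeriv_synth]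
  exact fun x => ((hF.dsym_pow m).hasDerivAt_synth x).differentiableAt

/-- Both sides agree when tested against smooth compactly supported functions: the `L²` transform is
compatible with the one on tempered distributions, and Fubini moves the integral transform onto the
test function. -/
theorem fourierInv_toLp_ae_eq {F : ℝ → ℂ} (hF : Integrable F) (hF2 : MemLp F 2) :
    ((Lp.fourierTransformₗᵢ ℝ ℂ).symm (hF2.toLp F) : ℝ → ℂ) =ᵐ[volume] 𝓕⁻ F := by
  have hcont : Continuous (𝓕⁻ F) := by
    rw [Real.fourierInv_eq_fourier_comp_neg]
    exact VectorFourier.fourierIntegral_continuous Real.continuous_fourierChar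
      (by exact continuous_inner) hF.comp_neg
  refine ae_eq_of_integral_contDiff_smul_eq
    ((Lp.memLp _).locallyIntegrable (by norm_num)) hcont.locallyIntegrable ?_
  intro g hg hgs
  have hg₁ : HasCompactSupport (Complex.ofRealCLM ∘ g) := hgs.comp_left rfl
  have hg₂ : ContDiff ℝ ∞ (Complex.ofRealCLM ∘ g) := by fun_prop
  set φ : SchwartzMap ℝ ℂ := hg₁.toSchwartzMap hg₂ with hφ
  have hφx : ∀ x, φ x = (g x : ℂ) := fun x => rfl
  have key := congrArg (fun T => T φ)
    (Lp.fourierInv_toTemperedDistribution_eq (hF2.toLp F))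
  simp only [TemperedDistribution.fourierInv_apply, Lp.toTemperedDistribution_apply] at key
  have k1 : ∫ x, g x • ((Lp.fourierTransformₗᵢ ℝ ℂ).symm (hF2.toLp F) : ℝ → ℂ) x
      = ∫ x, (𝓕⁻ φ) x • F x := by
    refine Eq.trans ?_ (key.symm.trans ?_)
    · exact integral_congr_ae (Eventually.of_forall fun x => by
        simp only [hφx]; rfl)
    · refine integral_congr_ae ?_
      filter_upwards [hF2.coeFn_toLp] with x hx
      rw [hx]
  rw [k1]
  have := VectorFourier.integral_fourierIntegral_smul_eq_flip (μ := volume) (ν := volume)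
    (L := -(innerₗ ℝ : ℝ →ₗ[ℝ] ℝ →ₗ[ℝ] ℝ)) (e := Real.fourierChar) (f := φ) (g := F)
    Real.continuous_fourierChar
    (by simp only [LinearMap.neg_apply, innerₗ_apply_apply]; fun_prop)
    φ.integrable hF
  have e1 : ∀ x, VectorFourier.fourierIntegral Real.fourierChar volume
      (-(innerₗ ℝ : ℝ →ₗ[ℝ] ℝ →ₗ[ℝ] ℝ)) (φ : ℝ → ℂ) x = 𝓕⁻ φ x := by
    intro x
    rw [SchwartzMap.fourierInv_coe]
    simp [VectorFourier.fourierIntegral, Real.fourierInv_eq]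
  have e2 : ∀ x, VectorFourier.fourierIntegral Real.fourierChar volume
      (-(innerₗ ℝ : ℝ →ₗ[ℝ] ℝ →ₗ[ℝ] ℝ)).flip F x = 𝓕⁻ F x := by
    intro x
    simp [VectorFourier.fourierIntegral, Real.fourierInv_eq, mul_comm]
  simp only [e1, e2] at this
  rw [this]
  exact integral_congr_ae (Eventually.of_forall fun x => by simp [hφx])

theorem IsSpectral.memLp_coe_synth {F : ℝ → ℂ} (hF : IsSpectral F) :
    MemLp (fun x => (synth F x : ℂ)) 2 (volume : Measure ℝ) := by
  have h := fourierInv_toLp_ae_eq hF.integrable (hF.decay.memLp_two hF.cont)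
  refine (memLp_congr_ae ?_).1 (Lp.memLp ((Lp.fourierTransformₗᵢ ℝ ℂ).symm
    ((hF.decay.memLp_two hF.cont).toLp F)))
  exact h.trans (Eventually.of_forall fun x => (hF.coe_synth x).symm)

theorem IsSpectral.fourierTransform_synth {F : ℝ → ℂ} (hF : IsSpectral F)
    (h : MemLp (fun x => (synth F x : ℂ)) 2 (volume : Measure ℝ)) :
    (Lp.fourierTransformₗᵢ ℝ ℂ (h.toLp (fun x => (synth F x : ℂ))) : ℝ → ℂ) =ᵐ[volume] F := by
  have h2 := hF.decay.memLp_two hF.cont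
  have h1 := fourierInv_toLp_ae_eq hF.integrable h2
  have : h.toLp (fun x => (synth F x : ℂ)) = (Lp.fourierTransformₗᵢ ℝ ℂ).symm (h2.toLp F) := by
    rw [← Lp.toLp_coeFn ((Lp.fourierTransformₗᵢ ℝ ℂ).symm (h2.toLp F)) (Lp.memLp _),
      MemLp.toLp_eq_toLp_iff]
    exact (h1.trans (Eventually.of_forall fun x => (hF.coe_synth x).symm)).symm
  rw [this, LinearIsometryEquiv.apply_symm_apply]
  exact h2.coeFn_toLp

/-- Plancherel; it moves all `Hᵏ` convergence questions to the Fourier side. -/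
theorem IsSpectral.eLpNorm_synth {F : ℝ → ℂ} (hF : IsSpectral F) :
    eLpNorm (synth F) 2 volume = eLpNorm F 2 volume := by
  have h := hF.memLp_coe_synth
  have h1 : eLpNorm (synth F) 2 volume = eLpNorm (fun x => (synth F x : ℂ)) 2 volume :=
    eLpNorm_congr_norm_ae (Eventually.of_forall fun x => by simp)
  rw [h1, ← eLpNorm_congr_ae (hF.fourierTransform_synth h), ← Lp.enorm_toLp (hf := h),
    ← Lp.enorm_def, ← ofReal_norm, ← ofReal_norm, LinearIsometryEquiv.norm_map]

theorem IsSpectral.memLp_synth {F : ℝ → ℂ} (hF : IsSpectral F) :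
    MemLp (synth F) 2 (volume : Measure ℝ) := by
  refine ⟨hF.contDiff_synth.continuous.aestronglyMeasurable, ?_⟩
  rw [hF.eLpNorm_synth]
  exact (hF.decay.memLp_two hF.cont).2

theorem IsSpectral.isHInf_synth {F : ℝ → ℂ} (hF : IsSpectral F) : IsHInf (synth F) := by
  refine ⟨hF.contDiff_synth, fun k => ?_⟩
  rw [hF.iteratedDeriv_synth]
  exact (hF.dsym_pow k).memLp_synth

theorem IsSpectral.sobolevNorm_synth {F : ℝ → ℂ} (hF : IsSpectral F) (s : ℝ) :
    sobolevNorm s (synth F) = (∫⁻ ξ : ℝ, ENNReal.ofReal ((1 + (2 * Real.pi * ξ) ^ 2) ^ s) *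
      ‖F ξ‖ₑ ^ 2) ^ (1 / 2 : ℝ) := by
  rw [sobolevNorm, dif_pos hF.memLp_coe_synth]
  congr 1
  refine lintegral_congr_ae ?_
  filter_upwards [hF.fourierTransform_synth hF.memLp_coe_synth] with ξ hξ
  rw [hξ]

theorem IsSpectral.synth_add {F G : ℝ → ℂ} (hF : IsSpectral F) (hG : IsSpectral G) (x : ℝ) :
    synth (fun ξ => F ξ + G ξ) x = synth F x + synth G x := by
  apply Complex.ofReal_injective
  push_cast
  rw [hF.coe_synth, hG.coe_synth, (hF.add hG).coe_synth]
  simp only [Real.fourierInv_eq, smul_add]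
  rw [integral_add]
  · have := (Real.fourierIntegral_convergent_iff (f := F) (μ := volume) (-x)).2 hF.integrable
    simpa using this
  · have := (Real.fourierIntegral_convergent_iff (f := G) (μ := volume) (-x)).2 hG.integrable
    simpa using this

theorem IsSpectral.synth_smul {F : ℝ → ℂ} (hF : IsSpectral F) (r x : ℝ) :
    synth (fun ξ => (r : ℂ) * F ξ) x = r * synth F x := by
  apply Complex.ofReal_injective
  push_cast
  rw [hF.coe_synth, (hF.smul r).coe_synth, fourierInv_real_eq, fourierInv_real_eq,
    ← integral_const_mul]
  congr 1
  ext ξ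
  ring

/-- The convolution of two functions on the line. -/
def conv (F G : ℝ → ℂ) (ξ : ℝ) : ℂ := ∫ ζ, F ζ * G (ξ - ζ)

theorem IsSpectral.synth_mul {F G : ℝ → ℂ} (hF : IsSpectral F) (hG : IsSpectral G)
    (hFG : IsSpectral (conv F G)) (x : ℝ) :
    synth (conv F G) x = synth F x * synth G x := by
  apply Complex.ofReal_injective
  push_cast
  rw [hF.coe_synth, hG.coe_synth, hFG.coe_synth]
  simp only [Real.fourierInv_eq_fourier_neg]
  rw [← Real.fourier_mul_convolution_eq hF.integrable hG.integrable]
  rfl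

/-- Polynomial weights are submultiplicative, `1 + |ξ| ≤ (1 + |ζ|)(1 + |ξ - ζ|)`; two extra powers
on `F` make the integrand integrable. -/
theorem RapidDecay.conv {F G : ℝ → ℂ} (hF : RapidDecay F) (hG : RapidDecay G) : RapidDecay (conv F G) := by
  intro k
  obtain ⟨D, hD⟩ := hG k
  obtain ⟨E, hE⟩ := hF (k + 2)
  have hE0 : 0 ≤ E := le_trans (by positivity) (hE 0)
  refine ⟨∫ ζ, (E * D) * ((1 + |ζ|) ^ 2)⁻¹, fun ξ => ?_⟩
  have : (1 + |ξ|) ^ k * ‖Boussinesq.conv F G ξ‖ = ‖∫ ζ, ((1 + |ξ|) ^ k : ℝ) • (F ζ * G (ξ - ζ))‖ := by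
    rw [integral_smul, norm_smul, Real.norm_of_nonneg (by positivity)]
    rfl
  rw [this]
  refine norm_integral_le_of_norm_le (integrable_decay.const_mul _)
    (Eventually.of_forall fun ζ => ?_)
  rw [norm_smul, Real.norm_of_nonneg (by positivity), norm_mul, ← div_eq_mul_inv,
    le_div_iff₀ (by positivity)]
  have h1 : (1 + |ξ|) ≤ (1 + |ζ|) * (1 + |ξ - ζ|) := by
    have : |ξ| ≤ |ζ| + |ξ - ζ| := by
      calc |ξ| = |ζ + (ξ - ζ)| := by ring_nf
        _ ≤ _ := abs_add_le _ _
    nlinarith [abs_nonneg ζ, abs_nonneg (ξ - ζ)]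
  calc (1 + |ξ|) ^ k * (‖F ζ‖ * ‖G (ξ - ζ)‖) * (1 + |ζ|) ^ 2
      ≤ ((1 + |ζ|) * (1 + |ξ - ζ|)) ^ k * (‖F ζ‖ * ‖G (ξ - ζ)‖) * (1 + |ζ|) ^ 2 := by
        gcongr
    _ = ((1 + |ζ|) ^ (k + 2) * ‖F ζ‖) * ((1 + |ξ - ζ|) ^ k * ‖G (ξ - ζ)‖) := by
        rw [mul_pow]; ring
    _ ≤ E * D := mul_le_mul (hE ζ) (hD _) (by positivity) hE0

theorem continuous_conv {F G : ℝ → ℂ} (hF : RapidDecay F) (hG : RapidDecay G)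
    (hFc : Continuous F) (hGc : Continuous G) : Continuous (conv F G) := by
  obtain ⟨C, hC0, hC⟩ := hG.bounded
  refine continuous_of_dominated (bound := fun ζ => ‖F ζ‖ * C) ?_ ?_ ?_ ?_
  · intro ξ
    exact (by fun_prop : Continuous fun ζ => F ζ * G (ξ - ζ)).aestronglyMeasurable
  · intro ξ
    refine Eventually.of_forall fun ζ => ?_
    rw [norm_mul]
    gcongr
    exact hC _
  · exact (hF.integrable hFc).norm.mul_const C
  · exact Eventually.of_forall fun ζ => by fun_prop

theorem IsSpectral.conv {F G : ℝ → ℂ} (hF : IsSpectral F) (hG : IsSpectral G) :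
    IsSpectral (conv F G) where
  cont := continuous_conv hF.decay hG.decay hF.cont hG.cont
  decay := hF.decay.conv hG.decay
  herm ξ := by
    unfold Boussinesq.conv
    rw [← integral_conj, ← integral_neg_eq_self]
    congr 1
    ext ζ
    rw [map_mul, ← hF.herm, ← hG.herm]
    congr 2
    ring

theorem tendsto_eLpNorm_two_zero {ι : Type*} {l : Filter ι} [l.IsCountablyGenerated]
    {f : ι → ℝ → ℂ} (hf : ∀ᶠ i in l, Continuous (f i)) (C : ℝ)
    (hb : ∀ᶠ i in l, ∀ ξ, ‖f i ξ‖ ≤ C * (1 + |ξ|)⁻¹) (h : ∀ ξ, Tendsto (fun i => f i ξ) l (𝓝 0)) :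
    Tendsto (fun i => eLpNorm (f i) 2 volume) l (𝓝 0) := by
  have h1 : ∀ i, eLpNorm (f i) 2 volume = (∫⁻ ξ, ‖f i ξ‖ₑ ^ 2) ^ (1 / 2 : ℝ) := by
    intro i
    rw [eLpNorm_eq_lintegral_rpow_enorm_toReal (by norm_num) (by norm_num)]
    simp
  simp only [h1]
  have h2 : Tendsto (fun i => ∫⁻ ξ, ‖f i ξ‖ₑ ^ 2) l (𝓝 (∫⁻ _ : ℝ, 0)) := by
    refine tendsto_lintegral_filter_of_dominated_convergence
      (fun ξ => ENNReal.ofReal (C ^ 2 * ((1 + |ξ|) ^ 2)⁻¹)) ?_ ?_ ?_ ?_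
    · filter_upwards [hf] with i hi
      exact (hi.enorm.measurable).pow_const 2
    · filter_upwards [hb] with i hi
      refine Eventually.of_forall fun ξ => ?_
      rw [← ofReal_norm, ← ENNReal.ofReal_pow (norm_nonneg _)]
      refine ENNReal.ofReal_le_ofReal ?_
      rw [← inv_pow, ← mul_pow]
      exact pow_le_pow_left₀ (norm_nonneg _) (hi ξ) 2
    · exact ((integrable_decay.const_mul (C ^ 2)).lintegral_lt_top).ne
    · refine Eventually.of_forall fun ξ => ?_
      have := ((continuous_enorm.tendsto _).comp (h ξ))
      have h3 := ((ENNReal.continuous_pow 2).tendsto _).comp this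
      simpa [Function.comp_def] using h3
  have h4 := (ENNReal.continuous_rpow_const (y := (1 / 2 : ℝ))).tendsto (∫⁻ _ : ℝ, 0)
  have h5 := h4.comp h2
  simpa [Function.comp_def] using h5

/-- By Plancherel this is dominated convergence for the difference quotients. The mean value
inequality bounds them by `C (1 + |ξ|)^(-k-1)` uniformly in time, so after multiplication by the
symbol of `∂ₓᵏ` there remains `(1 + |ξ|)⁻¹`, which is square integrable. -/
theorem hasTimeDerivWithin_synth {F F' : ℝ → ℝ → ℂ} {T : ℝ}
    (hF : ∀ t ∈ Icc 0 T, IsSpectral (F t)) (hF' : ∀ t ∈ Icc 0 T, IsSpectral (F' t))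
    (hd : ∀ t ∈ Icc 0 T, ∀ ξ, HasDerivWithinAt (fun τ => F τ ξ) (F' t ξ) (Icc 0 T) t)
    (hb : ∀ k : ℕ, ∃ C : ℝ, ∀ t ∈ Icc 0 T, ∀ ξ, (1 + |ξ|) ^ k * ‖F' t ξ‖ ≤ C)
    {t : ℝ} (ht : t ∈ Icc 0 T) :
    HasTimeDerivWithin (fun τ => synth (F τ)) (synth (F' t)) (Icc 0 T) t := by
  intro k
  set Φ : ℝ → ℝ → ℂ := fun τ ξ => ((τ - t)⁻¹ : ℝ) * (F τ ξ + ((-1 : ℝ) : ℂ) * F t ξ) +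
    ((-1 : ℝ) : ℂ) * F' t ξ with hΦ
  have hsp : ∀ τ ∈ Icc 0 T, IsSpectral (Φ τ) := fun τ hτ =>
    (((hF τ hτ).add ((hF t ht).smul (-1))).smul _).add ((hF' t ht).smul (-1))
  have hmem : ∀ᶠ τ in 𝓝[Icc 0 T \ {t}] t, τ ∈ Icc 0 T \ {t} := self_mem_nhdsWithin
  have heq : ∀ᶠ τ in 𝓝[Icc 0 T \ {t}] t,
      eLpNorm (fun ξ => dsym ξ ^ k * Φ τ ξ) 2 volume = eLpNorm (iteratedDeriv k
        (fun x => (synth (F τ) x - synth (F t) x) / (τ - t) - synth (F' t) x)) 2 volume := by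
    filter_upwards [hmem] with τ hτ
    have h1 : (fun x => (synth (F τ) x - synth (F t) x) / (τ - t) - synth (F' t) x)
        = synth (Φ τ) := by
      ext x
      rw [hΦ, (((hF τ hτ.1).add ((hF t ht).smul (-1))).smul _).synth_add ((hF' t ht).smul (-1)),
        ((hF τ hτ.1).add ((hF t ht).smul (-1))).synth_smul,
        (hF τ hτ.1).synth_add ((hF t ht).smul (-1)), (hF t ht).synth_smul,
        (hF' t ht).synth_smul]
      ring
    rw [h1, (hsp τ hτ.1).iteratedDeriv_synth, ((hsp τ hτ.1).dsym_pow k).eLpNorm_synth]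
  refine Tendsto.congr' heq ?_
  obtain ⟨C, hC⟩ := hb (k + 1)
  have hC0 : 0 ≤ C := le_trans (by positivity) (hC t ht 0)
  refine tendsto_eLpNorm_two_zero ?_ ((2 * Real.pi) ^ k * (2 * C)) ?_ ?_
  · filter_upwards [hmem] with τ hτ
    exact ((hsp τ hτ.1).dsym_pow k).cont
  · filter_upwards [hmem] with τ hτ ξ
    have hne : τ - t ≠ 0 := sub_ne_zero.2 hτ.2
    have hCξ : ∀ σ ∈ Icc 0 T, ‖F' σ ξ‖ ≤ C / (1 + |ξ|) ^ (k + 1) := fun σ hσ => by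
      rw [le_div_iff₀ (by positivity), mul_comm]; exact hC σ hσ ξ
    have h1 := (convex_Icc 0 T).norm_image_sub_le_of_norm_hasDerivWithin_le
      (fun σ hσ => hd σ hσ ξ) hCξ ht hτ.1
    have h2 : ‖Φ τ ξ‖ ≤ 2 * (C / (1 + |ξ|) ^ (k + 1)) := by
      have e : Φ τ ξ = ((τ - t)⁻¹ : ℝ) * (F τ ξ - F t ξ) - F' t ξ := by
        simp only [hΦ]; push_cast; ring
      rw [e]
      calc ‖(((τ - t)⁻¹ : ℝ) : ℂ) * (F τ ξ - F t ξ) - F' t ξ‖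
          ≤ ‖(((τ - t)⁻¹ : ℝ) : ℂ) * (F τ ξ - F t ξ)‖ + ‖F' t ξ‖ := norm_sub_le _ _
        _ ≤ C / (1 + |ξ|) ^ (k + 1) + C / (1 + |ξ|) ^ (k + 1) := by
            gcongr
            · rw [norm_mul, Complex.norm_real, norm_inv, inv_mul_le_iff₀ (norm_pos_iff.2 hne),
                mul_comm]
              exact h1
            · exact hCξ t ht
        _ = _ := by ring
    calc ‖dsym ξ ^ k * Φ τ ξ‖ ≤ (2 * Real.pi * (1 + |ξ|)) ^ k *
          (2 * (C / (1 + |ξ|) ^ (k + 1))) := by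
          rw [norm_mul, norm_pow]
          gcongr
          exact norm_dsym_le ξ
      _ = (2 * Real.pi) ^ k * (2 * C) * (1 + |ξ|)⁻¹ := by
          have : (1 + |ξ|) ≠ 0 := by positivity
          rw [mul_pow]
          field_simp
          ring
  · intro ξ
    have h1 := hasDerivWithinAt_iff_tendsto_slope.1 (hd t ht ξ)
    have h2 : Tendsto (fun τ => dsym ξ ^ k * (slope (fun τ => F τ ξ) t τ - F' t ξ))
        (𝓝[Icc 0 T \ {t}] t) (𝓝 (dsym ξ ^ k * (F' t ξ - F' t ξ))) :=
      (h1.sub_const _).const_mul _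
    rw [sub_self, mul_zero] at h2
    refine h2.congr fun τ => ?_
    simp only [hΦ, slope_def_module, Complex.real_smul]
    push_cast
    ring

/-! ### The algebra `H^∞` and its `L²` pairing. -/

theorem IsHInf.memLp {f : ℝ → ℝ} (hf : IsHInf f) : MemLp f 2 volume := by
  simpa using hf.2 0

theorem IsHInf.differentiable {f : ℝ → ℝ} (hf : IsHInf f) : Differentiable ℝ f :=
  hf.1.differentiable (by simp)

theorem IsHInf.deriv {f : ℝ → ℝ} (hf : IsHInf f) : IsHInf (deriv f) :=
  ⟨(contDiff_infty_iff_deriv.1 hf.1).2, fun k => by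
    rw [← iteratedDeriv_succ']; exact hf.2 (k + 1)⟩

theorem IsHInf.contDiffAt {f : ℝ → ℝ} (hf : IsHInf f) (k : ℕ) (x : ℝ) : ContDiffAt ℝ k f x :=
  (hf.1.of_le (by exact_mod_cast le_top)).contDiffAt

theorem IsHInf.add {f g : ℝ → ℝ} (hf : IsHInf f) (hg : IsHInf g) : IsHInf (f + g) := by
  refine ⟨hf.1.add hg.1, fun k => ?_⟩
  have : iteratedDeriv k (f + g) = iteratedDeriv k f + iteratedDeriv k g := by
    ext x
    exact iteratedDeriv_add (hf.contDiffAt k x) (hg.contDiffAt k x)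
  rw [this]
  exact (hf.2 k).add (hg.2 k)

theorem IsHInf.const_smul {f : ℝ → ℝ} (hf : IsHInf f) (r : ℝ) : IsHInf (r • f) := by
  refine ⟨hf.1.const_smul r, fun k => ?_⟩
  have : iteratedDeriv k (r • f) = r • iteratedDeriv k f := by
    ext x
    exact iteratedDeriv_const_smul (hf.contDiffAt k x) r
  rw [this]
  exact (hf.2 k).const_smul r

theorem isHInf_zero : IsHInf 0 := by
  refine ⟨contDiff_const, fun k => ?_⟩
  have : iteratedDeriv k (0 : ℝ → ℝ) = 0 := by
    ext x
    simp
  rw [this]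
  exact MemLp.zero

theorem IsHInf.integrable_mul {f g : ℝ → ℝ} (hf : IsHInf f) (hg : IsHInf g) :
    Integrable (fun x => f x * g x) :=
  hf.memLp.integrable_mul hg.memLp

/-- The Sobolev embedding `H¹ ⊂ L^∞`: integrate `(f²)' = 2 f f' ≤ f² + f'²` from `-∞`. -/
theorem IsHInf.sq_le {f : ℝ → ℝ} (hf : IsHInf f) (x : ℝ) :
    f x ^ 2 ≤ (∫ y, f y * f y) + ∫ y, _root_.deriv f y * _root_.deriv f y := by
  have h1 := hf.integrable_mul hf
  have h2 := hf.deriv.integrable_mul hf.deriv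
  have h3 : Integrable (fun y => _root_.deriv f y * f y + f y * _root_.deriv f y) :=
    (hf.deriv.integrable_mul hf).add (hf.integrable_mul hf.deriv)
  have hd : ∀ y, HasDerivAt (fun y => f y * f y)
      (_root_.deriv f y * f y + f y * _root_.deriv f y) y := fun y =>
    (hf.differentiable y).hasDerivAt.mul (hf.differentiable y).hasDerivAt
  have hlim := tendsto_zero_of_hasDerivAt_of_integrableOn_Iic (a := x) (fun y _ => hd y)
    h3.integrableOn h1.integrableOn
  have := integral_Iic_of_hasDerivAt_of_tendsto' (a := x) (fun y _ => hd y) h3.integrableOn hlim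
  rw [sub_zero] at this
  rw [sq, ← this, ← integral_add h1 h2]
  calc ∫ y in Iic x, (_root_.deriv f y * f y + f y * _root_.deriv f y)
      ≤ ∫ y in Iic x, (f y * f y + _root_.deriv f y * _root_.deriv f y) := by
        refine setIntegral_mono h3.integrableOn (h1.add h2).integrableOn fun y => ?_
        nlinarith [sq_nonneg (f y - _root_.deriv f y)]
    _ ≤ _ := setIntegral_le_integral (h1.add h2)
        (Eventually.of_forall fun y => add_nonneg (mul_self_nonneg _) (mul_self_nonneg _))

theorem IsHInf.bounded {f : ℝ → ℝ} (hf : IsHInf f) : ∃ C, ∀ x, |f x| ≤ C :=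
  ⟨_, fun x => Real.abs_le_sqrt (hf.sq_le x)⟩

theorem memLp_mul_of_bounded {f g : ℝ → ℝ} {C : ℝ} (hf : ∀ x, |f x| ≤ C) (hfc : Continuous f)
    (hg : MemLp g 2 volume) : MemLp (f * g) 2 volume := by
  refine (hg.const_mul C).mono (hfc.aestronglyMeasurable.mul hg.1)
    (Eventually.of_forall fun x => ?_)
  have hC : 0 ≤ C := (abs_nonneg _).trans (hf x)
  simp only [Pi.mul_apply, norm_mul, Real.norm_eq_abs, abs_of_nonneg hC]
  gcongr
  exact hf x

theorem IsHInf.mul {f g : ℝ → ℝ} (hf : IsHInf f) (hg : IsHInf g) : IsHInf (f * g) := by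
  refine ⟨hf.1.mul hg.1, fun k => ?_⟩
  induction k generalizing f g with
  | zero =>
    obtain ⟨C, hC⟩ := hf.bounded
    simpa using memLp_mul_of_bounded hC hf.1.continuous hg.memLp
  | succ k ih =>
    have e : _root_.deriv (f * g) = _root_.deriv f * g + f * _root_.deriv g := by
      ext x
      exact deriv_mul (hf.differentiable x) (hg.differentiable x)
    have e2 : iteratedDeriv k (_root_.deriv f * g + f * _root_.deriv g) =
        iteratedDeriv k (_root_.deriv f * g) + iteratedDeriv k (f * _root_.deriv g) := by
      ext x
      exact iteratedDeriv_add
        ((hf.deriv.contDiffAt k x).mul (hg.contDiffAt k x))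
        ((hf.contDiffAt k x).mul (hg.deriv.contDiffAt k x))
    rw [iteratedDeriv_succ', e, e2]
    exact (ih hf.deriv hg).add (ih hf hg.deriv)

theorem IsHInf.integral_mul_deriv {f g : ℝ → ℝ} (hf : IsHInf f) (hg : IsHInf g) :
    ∫ x, f x * _root_.deriv g x = -∫ x, _root_.deriv f x * g x :=
  integral_mul_deriv_eq_deriv_mul_of_integrable
    (fun x _ => (hf.differentiable x).hasDerivAt) (fun x _ => (hg.differentiable x).hasDerivAt)
    (hf.integrable_mul hg.deriv) (hf.deriv.integrable_mul hg) (hf.integrable_mul hg)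

/-- The algebra `H^∞(ℝ)`. -/
def HInf : NonUnitalSubalgebra ℝ (ℝ → ℝ) where
  carrier := {f | IsHInf f}
  add_mem' := IsHInf.add
  zero_mem' := isHInf_zero
  mul_mem' := IsHInf.mul
  smul_mem' r _ hf := IsHInf.const_smul hf r

namespace HInf

theorem isHInf (f : HInf) : IsHInf (f : ℝ → ℝ) := f.2

/-- The derivative on `H^∞(ℝ)`. -/
def D : HInf →ₗ[ℝ] HInf where
  toFun f := ⟨deriv f, (isHInf f).deriv⟩
  map_add' f g := by
    ext x
    exact deriv_add ((isHInf f).differentiable x) ((isHInf g).differentiable x)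
  map_smul' r f := by
    ext x
    exact deriv_const_smul r ((isHInf f).differentiable x)

@[simp] theorem coe_D (f : HInf) : (D f : ℝ → ℝ) = deriv f := rfl

theorem coe_D_pow (k : ℕ) (f : HInf) : ((D ^ k) f : ℝ → ℝ) = iteratedDeriv k f := by
  induction k with
  | zero => simp
  | succ k ih => rw [pow_succ', Module.End.mul_apply, coe_D, ih, iteratedDeriv_succ]

theorem D_mul (f g : HInf) : D (f * g) = D f * g + f * D g := by
  ext x
  exact deriv_mul ((isHInf f).differentiable x) ((isHInf g).differentiable x)

/-- The embedding of `H^∞(ℝ)` into `L²(ℝ)`. -/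
def J : HInf →ₗ[ℝ] Lp ℝ 2 (volume : Measure ℝ) where
  toFun f := (isHInf f).memLp.toLp f
  map_add' _ _ := rfl
  map_smul' _ _ := rfl

/-- The `L²` inner product on `H^∞(ℝ)`. -/
def B (f g : HInf) : ℝ := inner ℝ (J f) (J g)

theorem B_eq (f g : HInf) : B f g = ∫ x, (f : ℝ → ℝ) x * (g : ℝ → ℝ) x := by
  rw [B, L2.inner_def]
  refine integral_congr_ae ?_
  filter_upwards [(isHInf f).memLp.coeFn_toLp, (isHInf g).memLp.coeFn_toLp] with x h1 h2
  have h1' : (J f : ℝ → ℝ) x = (f : ℝ → ℝ) x := h1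
  have h2' : (J g : ℝ → ℝ) x = (g : ℝ → ℝ) x := h2
  rw [h1', h2']
  simp [mul_comm]

theorem B_comm (f g : HInf) : B f g = B g f := real_inner_comm _ _

theorem B_add_left (f g h : HInf) : B (f + g) h = B f h + B g h := by
  simp [B, inner_add_left]

theorem B_add_right (f g h : HInf) : B h (f + g) = B h f + B h g := by
  simp [B, inner_add_right]

theorem B_sub_left (f g h : HInf) : B (f - g) h = B f h - B g h := by
  simp [B, inner_sub_left]

theorem B_neg_left (f g : HInf) : B (-f) g = -B f g := by simp [B]

theorem B_neg_right (f g : HInf) : B f (-g) = -B f g := by simp [B]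

theorem B_smul_left (r : ℝ) (f g : HInf) : B (r • f) g = r * B f g := by
  simp [B, inner_smul_left]

theorem B_smul_right (r : ℝ) (f g : HInf) : B f (r • g) = r * B f g := by
  simp [B, inner_smul_right]

theorem B_self_nonneg (f : HInf) : 0 ≤ B f f := real_inner_self_nonneg

theorem B_D_right (f g : HInf) : B f (D g) = -B (D f) g := by
  rw [B_eq, B_eq]
  exact (isHInf f).integral_mul_deriv (isHInf g)

theorem B_mul_left (a f g : HInf) : B (a * f) g = B f (a * g) := by
  rw [B_eq, B_eq]
  refine integral_congr_ae (Eventually.of_forall fun x => ?_)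
  simp
  ring

theorem eq_zero_of_B_self {f : HInf} (h : B f f ≤ 0) : f = 0 := by
  have h0 : ∀ x, (f : ℝ → ℝ) x = 0 := by
    rw [B_eq] at h
    have h1 := (integral_eq_zero_iff_of_nonneg (fun x => mul_self_nonneg ((f : ℝ → ℝ) x))
      ((isHInf f).integrable_mul (isHInf f))).1
      (le_antisymm h (integral_nonneg fun x => mul_self_nonneg ((f : ℝ → ℝ) x)))
    have hc : Continuous fun x => (f : ℝ → ℝ) x * (f : ℝ → ℝ) x :=
      (isHInf f).1.continuous.mul (isHInf f).1.continuous
    have h2 := (hc.ae_eq_iff_eq volume continuous_const).1 h1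
    intro x
    exact mul_self_eq_zero.1 (congrFun h2 x)
  ext x
  simpa using h0 x

theorem abs_le_sqrt (f : HInf) (x : ℝ) : |(f : ℝ → ℝ) x| ≤ √(B f f + B (D f) (D f)) := by
  rw [B_eq, B_eq]
  exact Real.abs_le_sqrt ((isHInf f).sq_le x)

theorem abs_B_mul_le {a : HInf} {C : ℝ} (ha : ∀ x, |(a : ℝ → ℝ) x| ≤ C) (f g : HInf) :
    |B (a * f) g| ≤ C * (B f f + B g g) := by
  have hC : 0 ≤ C := (abs_nonneg _).trans (ha 0)
  rw [B_eq, B_eq, B_eq, ← integral_add ((isHInf f).integrable_mul (isHInf f))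
    ((isHInf g).integrable_mul (isHInf g)), ← integral_const_mul, ← Real.norm_eq_abs]
  refine norm_integral_le_of_norm_le ((((isHInf f).integrable_mul (isHInf f)).add
    ((isHInf g).integrable_mul (isHInf g))).const_mul C) (Eventually.of_forall fun x => ?_)
  simp only [NonUnitalSubalgebra.coe_mul, Pi.mul_apply, norm_mul, Real.norm_eq_abs]
  rw [mul_assoc]
  refine mul_le_mul (ha x) ?_ (by positivity) hC
  nlinarith [sq_nonneg (|(f : ℝ → ℝ) x| - |(g : ℝ → ℝ) x|), sq_abs ((f : ℝ → ℝ) x),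
    sq_abs ((g : ℝ → ℝ) x), mul_self_nonneg ((f : ℝ → ℝ) x), mul_self_nonneg ((g : ℝ → ℝ) x)]

theorem norm_J_mul_le {a : HInf} {C : ℝ} (ha : ∀ x, |(a : ℝ → ℝ) x| ≤ C) (f : HInf) :
    ‖J (a * f)‖ ≤ C * ‖J f‖ := by
  have hC : 0 ≤ C := (abs_nonneg _).trans (ha 0)
  refine Lp.norm_le_mul_norm_of_ae_le_mul ?_
  filter_upwards [(isHInf f).memLp.coeFn_toLp, (isHInf (a * f)).memLp.coeFn_toLp] with x h1 h2
  have h1' : (J f : ℝ → ℝ) x = (f : ℝ → ℝ) x := h1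
  have h2' : (J (a * f) : ℝ → ℝ) x = ((a * f : HInf) : ℝ → ℝ) x := h2
  rw [h1', h2']
  simp only [NonUnitalSubalgebra.coe_mul, Pi.mul_apply, norm_mul, Real.norm_eq_abs]
  gcongr
  exact ha x

theorem abs_le_norm (f : HInf) (x : ℝ) : |(f : ℝ → ℝ) x| ≤ ‖J f‖ + ‖J (D f)‖ := by
  refine (abs_le_sqrt f x).trans (Real.sqrt_le_iff.2 ⟨by positivity, ?_⟩)
  simp only [B, real_inner_self_eq_norm_sq]
  nlinarith [norm_nonneg (J f), norm_nonneg (J (D f))]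

/-! ### Differentiable curves in `H^∞`. -/

/-- The curve `f` in `H^∞(ℝ)` has the derivative `p` at `t` within `S`. -/
def HasDeriv (f : ℝ → HInf) (p : HInf) (S : Set ℝ) (t : ℝ) : Prop :=
  ∀ k : ℕ, HasDerivWithinAt (fun τ => J ((D ^ k) (f τ))) (J ((D ^ k) p)) S t

section HasDeriv

variable {f g : ℝ → HInf} {p q : HInf} {S : Set ℝ} {t : ℝ}

theorem HasDeriv.zero (hf : HasDeriv f p S t) :
    HasDerivWithinAt (fun τ => J (f τ)) (J p) S t := by
  simpa using hf 0

theorem HasDeriv.D (hf : HasDeriv f p S t) : HasDeriv (fun τ => D (f τ)) (D p) S t := fun k => by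
  simpa [pow_succ] using hf (k + 1)

theorem HasDeriv.add (hf : HasDeriv f p S t) (hg : HasDeriv g q S t) :
    HasDeriv (fun τ => f τ + g τ) (p + q) S t := fun k => by
  simpa using! (hf k).add (hg k)

theorem HasDeriv.sub (hf : HasDeriv f p S t) (hg : HasDeriv g q S t) :
    HasDeriv (fun τ => f τ - g τ) (p - q) S t := fun k => by
  simpa using! (hf k).sub (hg k)

theorem HasDeriv.smul (hf : HasDeriv f p S t) (r : ℝ) :
    HasDeriv (fun τ => r • f τ) (r • p) S t := fun k => by
  simpa using! (hf k).const_smul r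

theorem hasDerivWithinAt_inner {u v : ℝ → HInf}
    (hu : HasDerivWithinAt (fun τ => J (u τ)) (J p) S t)
    (hv : HasDerivWithinAt (fun τ => J (v τ)) (J q) S t) :
    HasDerivWithinAt (fun τ => B (u τ) (v τ)) (B (u t) q + B p (v t)) S t :=
  hu.inner ℝ hv

theorem HasDeriv.tendsto_slope (hf : HasDeriv f p S t) (k : ℕ) :
    Tendsto (fun τ => ‖J ((HInf.D ^ k) ((τ - t)⁻¹ • (f τ - f t) - p))‖) (𝓝[S \ {t}] t) (𝓝 0) := by
  have h := (hasDerivWithinAt_iff_tendsto_slope.1 (hf k)).sub_const (J ((HInf.D ^ k) p))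
  rw [sub_self] at h
  have h := h.norm
  rw [norm_zero] at h
  refine h.congr fun τ => ?_
  simp [slope_def_module]

theorem hasDeriv_of_tendsto_slope (h : ∀ k : ℕ,
    Tendsto (fun τ => ‖J ((HInf.D ^ k) ((τ - t)⁻¹ • (f τ - f t) - p))‖) (𝓝[S \ {t}] t) (𝓝 0)) :
    HasDeriv f p S t := by
  intro k
  rw [hasDerivWithinAt_iff_tendsto_slope, tendsto_iff_norm_sub_tendsto_zero]
  refine (h k).congr fun τ => ?_
  simp [slope_def_module]

/-- The product rule is needed only in `L²`, for the cubic terms of the KdV-KdV energy. One factor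
of each product is bounded in `L^∞`, for the remainder through its `H¹` norm. -/
theorem HasDeriv.mul (hf : HasDeriv f p S t) (hg : HasDeriv g q S t) :
    HasDerivWithinAt (fun τ => J (f τ * g τ)) (J (p * g t + f t * q)) S t := by
  rw [hasDerivWithinAt_iff_tendsto_slope, tendsto_iff_norm_sub_tendsto_zero]
  obtain ⟨C, hC⟩ := (isHInf (f t)).bounded
  obtain ⟨E, hE⟩ := (isHInf (g t)).bounded
  set F : ℝ → HInf := fun τ => (τ - t)⁻¹ • (f τ - f t) - p
  set G : ℝ → HInf := fun τ => (τ - t)⁻¹ • (g τ - g t) - q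
  have hF0 := hf.tendsto_slope 0
  have hF1 := hf.tendsto_slope 1
  have hG0 := hg.tendsto_slope 0
  simp only [pow_zero, pow_one, Module.End.one_apply] at hF0 hF1 hG0
  change Tendsto (fun τ => ‖J (F τ)‖) _ _ at hF0
  change Tendsto (fun τ => ‖J (HInf.D (F τ))‖) _ _ at hF1
  change Tendsto (fun τ => ‖J (G τ)‖) _ _ at hG0
  have hτ : Tendsto (fun τ => |τ - t|) (𝓝[S \ {t}] t) (𝓝 0) := by
    have : Continuous fun τ : ℝ => |τ - t| := by fun_prop
    have := (this.tendsto t).mono_left (nhdsWithin_le_nhds (s := S \ {t}))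
    simpa using this
  have hlim : Tendsto (fun τ => E * ‖J (F τ)‖ + C * ‖J (G τ)‖ +
      |τ - t| * (((‖J (F τ)‖ + ‖J (HInf.D (F τ))‖) + (‖J p‖ + ‖J (HInf.D p)‖)) *
        (‖J (G τ)‖ + ‖J q‖))) (𝓝[S \ {t}] t)
      (𝓝 (E * 0 + C * 0 + 0 * (((0 + 0) + (‖J p‖ + ‖J (HInf.D p)‖)) * (0 + ‖J q‖)))) :=
    ((hF0.const_mul E).add (hG0.const_mul C)).add
      (hτ.mul (((hF0.add hF1).add_const _).mul (hG0.add_const _)))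
  simp only [mul_zero, zero_mul, add_zero] at hlim
  refine squeeze_zero' (Eventually.of_forall fun τ => norm_nonneg _) ?_ hlim
  filter_upwards [self_mem_nhdsWithin] with τ hτ
  have hne : τ - t ≠ 0 := sub_ne_zero.2 hτ.2
  -- Insert `f τ = f t + (τ - t)(F τ + p)` and likewise for `g`; what is left is linear in the
  -- errors `F`, `G` or carries a factor `τ - t`.
  have e : slope (fun τ => J (f τ * g τ)) t τ - J (p * g t + f t * q) =
      J (g t * F τ) + J (f t * G τ) + (τ - t) • J ((F τ + p) * (G τ + q)) := by
    rw [slope_def_module, ← map_sub, ← map_smul, ← map_sub, ← map_smul, ← map_add, ← map_add]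
    congr 1
    ext x
    simp [F, G]
    field_simp
    ring
  rw [e]
  refine (norm_add₃_le).trans ?_
  gcongr
  · exact norm_J_mul_le hE _
  · exact norm_J_mul_le hC _
  · rw [norm_smul, Real.norm_eq_abs]
    gcongr
    refine (norm_J_mul_le (C := ‖J (F τ)‖ + ‖J (HInf.D (F τ))‖ + (‖J p‖ + ‖J (HInf.D p)‖))
      (fun x => ?_) _).trans ?_
    · refine (abs_add_le _ _).trans ?_
      gcongr
      · exact abs_le_norm _ x
      · exact abs_le_norm _ x
    · gcongr
      rw [map_add]
      exact norm_add_le _ _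

end HasDeriv

end HInf

namespace HInf

theorem coe_indicator {S : Set ℝ} {f : ℝ → ℝ → ℝ} (hf : ∀ t ∈ S, IsHInf (f t)) :
    ∃ F : ℝ → HInf, ∀ t ∈ S, (F t : ℝ → ℝ) = f t := by
  classical
  -- A solution says nothing about times outside the interval; there the curve is set to zero.
  exact ⟨fun t => if h : t ∈ S then ⟨f t, hf t h⟩ else 0, fun t ht => by simp [ht]⟩

theorem hasDeriv_of_hasTimeDerivWithin {f : ℝ → ℝ → ℝ} {F : ℝ → HInf} {p : HInf} {S : Set ℝ}
    {t : ℝ} (ht : t ∈ S) (hF : ∀ τ ∈ S, (F τ : ℝ → ℝ) = f τ)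
    (h : HasTimeDerivWithin f p S t) : HasDeriv F p S t := by
  refine hasDeriv_of_tendsto_slope fun k => ?_
  have h1 := (ENNReal.tendsto_toReal (by simp)).comp (h k)
  rw [ENNReal.toReal_zero] at h1
  refine h1.congr' ?_
  filter_upwards [self_mem_nhdsWithin] with τ hτ
  have e : (fun x => (f τ x - f t x) / (τ - t) - (p : ℝ → ℝ) x) =
      (((τ - t)⁻¹ • (F τ - F t) - p : HInf) : ℝ → ℝ) := by
    ext x
    simp [hF τ hτ.1, hF t ht, div_eq_inv_mul]
  rw [Function.comp_apply, e, ← coe_D_pow]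
  exact (Lp.norm_toLp _ (isHInf ((D ^ k) ((τ - t)⁻¹ • (F τ - F t) - p))).memLp).symm

theorem HasDeriv.exists_bound {f p : ℝ → HInf} {T : ℝ}
    (hf : ∀ t ∈ Icc 0 T, HasDeriv f (p t) (Icc 0 T) t) :
    ∃ C, ∀ t ∈ Icc 0 T, ∀ x, |(f t : ℝ → ℝ) x| ≤ C := by
  have h0 : ContinuousOn (fun t => J (f t)) (Icc 0 T) := fun t ht =>
    (hf t ht).zero.continuousWithinAt
  have h1 : ContinuousOn (fun t => J (HInf.D (f t))) (Icc 0 T) := fun t ht =>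
    (hf t ht).D.zero.continuousWithinAt
  obtain ⟨C0, hC0⟩ := isCompact_Icc.exists_bound_of_continuousOn h0
  obtain ⟨C1, hC1⟩ := isCompact_Icc.exists_bound_of_continuousOn h1
  exact ⟨C0 + C1, fun t ht x => (abs_le_norm _ x).trans (add_le_add (hC0 t ht) (hC1 t ht))⟩

end HInf

open HInf

/-! ### Uniqueness by energy estimates. -/

/-- A solution of the system as a curve in the algebra `H^∞(ℝ)`. -/
structure SolutionCurve (a b c d T : ℝ) (η u p q : ℝ → HInf) : Prop where
  hasDeriv_fst : ∀ t ∈ Icc 0 T, HasDeriv η (p t) (Icc 0 T) t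
  hasDeriv_snd : ∀ t ∈ Icc 0 T, HasDeriv u (q t) (Icc 0 T) t
  eq_fst : ∀ t ∈ Icc 0 T, p t - b • D (D (p t)) = -D (a • D (D (u t)) + u t + u t * η t)
  eq_snd : ∀ t ∈ Icc 0 T,
    q t - d • D (D (q t)) = -D (c • D (D (η t)) + η t + (1 / 2 : ℝ) • (u t * u t))

theorem IsSolution.exists_curve {a b c d T : ℝ} {v : ℝ → State} (hv : IsSolution a b c d T v) :
    ∃ η u p q : ℝ → HInf, SolutionCurve a b c d T η u p q ∧
      (∀ t ∈ Icc 0 T, (η t : ℝ → ℝ) = (v t).1) ∧ ∀ t ∈ Icc 0 T, (u t : ℝ → ℝ) = (v t).2 := by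
  obtain ⟨p, q, h⟩ := hv
  obtain ⟨η, hη⟩ := coe_indicator fun t ht => (h t ht).1
  obtain ⟨u, hu⟩ := coe_indicator fun t ht => (h t ht).2.1
  obtain ⟨p', hp⟩ := coe_indicator fun t ht => (h t ht).2.2.1
  obtain ⟨q', hq⟩ := coe_indicator fun t ht => (h t ht).2.2.2.1
  have hD2 : ∀ f : HInf, iteratedDeriv 2 (f : ℝ → ℝ) = (D (D f) : HInf) := fun f => by
    rw [← coe_D_pow]; rfl
  refine ⟨η, u, p', q', ⟨fun t ht => ?_, fun t ht => ?_, fun t ht => ?_, fun t ht => ?_⟩, hη, hu⟩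
  · exact hasDeriv_of_hasTimeDerivWithin ht hη (by rw [hp t ht]; exact (h t ht).2.2.2.2.1)
  · exact hasDeriv_of_hasTimeDerivWithin ht hu (by rw [hq t ht]; exact (h t ht).2.2.2.2.2.1)
  · ext x
    have := ((h t ht).2.2.2.2.2.2 x).1
    rw [← hη t ht, ← hu t ht, ← hp t ht, hD2, hD2] at this
    exact eq_neg_of_add_eq_zero_left this
  · ext x
    have := ((h t ht).2.2.2.2.2.2 x).2
    rw [← hη t ht, ← hu t ht, ← hq t ht, hD2, hD2] at this
    have e : ((c • D (D (η t)) + η t + (1 / 2 : ℝ) • (u t * u t) : HInf) : ℝ → ℝ) =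
        fun y => c * (D (D (η t)) : ℝ → ℝ) y + (η t : ℝ → ℝ) y + (1 / 2) * (u t : ℝ → ℝ) y ^ 2 := by
      ext y
      simp [sq]
    rw [← e] at this
    exact eq_neg_of_add_eq_zero_left this

/-- Grönwall: `f(s) exp(-Ls)` is nonincreasing. -/
theorem nonpos_of_deriv_le {f f' : ℝ → ℝ} {T L : ℝ}
    (hf : ∀ t ∈ Icc 0 T, HasDerivWithinAt f (f' t) (Icc 0 T) t)
    (hb : ∀ t ∈ Icc 0 T, f' t ≤ L * f t) (h0 : f 0 ≤ 0) : ∀ t ∈ Icc 0 T, f t ≤ 0 := by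
  intro t ht
  have hd : ∀ s ∈ Icc 0 T, HasDerivWithinAt (fun s => f s * Real.exp (-L * s))
      (f' s * Real.exp (-L * s) + f s * (Real.exp (-L * s) * (-L))) (Icc 0 T) s := fun s hs =>
    (hf s hs).mul ((((hasDerivAt_id s).const_mul (-L)).exp.hasDerivWithinAt).congr_deriv (by simp))
  have hanti : AntitoneOn (fun s => f s * Real.exp (-L * s)) (Icc 0 T) := by
    refine antitoneOn_of_deriv_nonpos (convex_Icc 0 T)
      (fun s hs => (hd s hs).continuousWithinAt) (fun s hs => ?_) (fun s hs => ?_)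
    · rw [interior_Icc] at hs ⊢
      exact ((hd s (Ioo_subset_Icc_self hs)).mono Ioo_subset_Icc_self).differentiableWithinAt
    · rw [interior_Icc] at hs
      have hs' := Ioo_subset_Icc_self hs
      rw [((hd s hs').hasDerivAt (Icc_mem_nhds hs.1 hs.2)).deriv]
      have := mul_nonneg (sub_nonneg.2 (hb s hs')) (Real.exp_pos (-L * s)).le
      linarith
  have h1 := hanti (left_mem_Icc.2 (ht.1.trans ht.2)) ht ht.1
  simp only [mul_zero, Real.exp_zero, mul_one] at h1
  by_contra hcon
  have := mul_pos (not_le.1 hcon) (Real.exp_pos (-L * t))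
  linarith

/-- The equations for the difference of two solutions. -/
structure DifferenceCurve (a b c d T : ℝ) (m e h w mt et p q : ℝ → HInf) : Prop where
  hasDeriv_m : ∀ t ∈ Icc 0 T, HasDeriv m (mt t) (Icc 0 T) t
  hasDeriv_e : ∀ t ∈ Icc 0 T, HasDeriv e (et t) (Icc 0 T) t
  hasDeriv_h : ∀ t ∈ Icc 0 T, HasDeriv h (p t) (Icc 0 T) t
  hasDeriv_w : ∀ t ∈ Icc 0 T, HasDeriv w (q t) (Icc 0 T) t
  eq_h : ∀ t ∈ Icc 0 T,
    p t - b • D (D (p t)) = -D (a • D (D (w t)) + w t + (m t * h t + e t * w t))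
  eq_w : ∀ t ∈ Icc 0 T,
    q t - d • D (D (q t)) = -D (c • D (D (h t)) + h t + m t * w t)
  bound : ∃ C, ∀ t ∈ Icc 0 T, ∀ x, |(m t : ℝ → ℝ) x| ≤ C ∧ |(e t : ℝ → ℝ) x| ≤ C ∧
    |(D (m t) : ℝ → ℝ) x| ≤ C ∧ |(D (e t) : ℝ → ℝ) x| ≤ C

/-- Using the means `m = (u + u')/2` and `e = (η + η')/2` as coefficients makes the differences
exact, `uη - u'η' = m h + e w` and `(u² - u'²)/2 = m w`. The same `m` then appears in both
equations, which the symmetric energy for KdV-KdV relies on. -/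
theorem SolutionCurve.difference {a b c d T : ℝ} {η u p q η' u' p' q' : ℝ → HInf}
    (h : SolutionCurve a b c d T η u p q) (h' : SolutionCurve a b c d T η' u' p' q') :
    DifferenceCurve a b c d T (fun t => (1 / 2 : ℝ) • (u t + u' t))
      (fun t => (1 / 2 : ℝ) • (η t + η' t)) (fun t => η t - η' t) (fun t => u t - u' t)
      (fun t => (1 / 2 : ℝ) • (q t + q' t)) (fun t => (1 / 2 : ℝ) • (p t + p' t))
      (fun t => p t - p' t) (fun t => q t - q' t) where
  hasDeriv_m t ht := ((h.hasDeriv_snd t ht).add (h'.hasDeriv_snd t ht)).smul _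
  hasDeriv_e t ht := ((h.hasDeriv_fst t ht).add (h'.hasDeriv_fst t ht)).smul _
  hasDeriv_h t ht := (h.hasDeriv_fst t ht).sub (h'.hasDeriv_fst t ht)
  hasDeriv_w t ht := (h.hasDeriv_snd t ht).sub (h'.hasDeriv_snd t ht)
  eq_h t ht := by
    have e : a • D (D (u t - u' t)) + (u t - u' t) + ((1 / 2 : ℝ) • (u t + u' t) * (η t - η' t) +
        (1 / 2 : ℝ) • (η t + η' t) * (u t - u' t)) =
        (a • D (D (u t)) + u t + u t * η t) - (a • D (D (u' t)) + u' t + u' t * η' t) := by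
      simp only [map_sub]
      ext x
      simp
      ring
    calc _ = (p t - b • D (D (p t))) - (p' t - b • D (D (p' t))) := by
          simp only [map_sub, smul_sub]; abel
      _ = _ := by rw [h.eq_fst t ht, h'.eq_fst t ht, e, map_sub D (_ + _ + _)]; abel
  eq_w t ht := by
    have e : c • D (D (η t - η' t)) + (η t - η' t) + (1 / 2 : ℝ) • (u t + u' t) * (u t - u' t) =
        (c • D (D (η t)) + η t + (1 / 2 : ℝ) • (u t * u t)) -
          (c • D (D (η' t)) + η' t + (1 / 2 : ℝ) • (u' t * u' t)) := by
      simp only [map_sub]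
      ext x
      simp
      ring
    calc _ = (q t - d • D (D (q t))) - (q' t - d • D (D (q' t))) := by
          simp only [map_sub, smul_sub]; abel
      _ = _ := by rw [h.eq_snd t ht, h'.eq_snd t ht, e, map_sub D (_ + _ + _)]; abel
  bound := by
    obtain ⟨C1, h1⟩ := HasDeriv.exists_bound fun t ht =>
      ((h.hasDeriv_snd t ht).add (h'.hasDeriv_snd t ht)).smul (1 / 2)
    obtain ⟨C2, h2⟩ := HasDeriv.exists_bound fun t ht =>
      ((h.hasDeriv_fst t ht).add (h'.hasDeriv_fst t ht)).smul (1 / 2)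
    obtain ⟨C3, h3⟩ := HasDeriv.exists_bound fun t ht =>
      (((h.hasDeriv_snd t ht).add (h'.hasDeriv_snd t ht)).smul (1 / 2)).D
    obtain ⟨C4, h4⟩ := HasDeriv.exists_bound fun t ht =>
      (((h.hasDeriv_fst t ht).add (h'.hasDeriv_fst t ht)).smul (1 / 2)).D
    refine ⟨max (max C1 C2) (max C3 C4), fun t ht x => ⟨?_, ?_, ?_, ?_⟩⟩
    · exact (h1 t ht x).trans (by simp)
    · exact (h2 t ht x).trans (by simp)
    · exact (h3 t ht x).trans (by simp)
    · exact (h4 t ht x).trans (by simp)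

/-- The energy pairs `(1 - b∂²)h` with `(1 + c∂²)h` and `(1 - d∂²)w` with `(1 + a∂²)w`. The signs of
the parameters make it equivalent to the squared `H²` norm, and the linear flow conserves it. The
nonlinear terms put at most one derivative on a factor `h` or `w` and pair it with at most two
derivatives, so `H²` controls them. -/
theorem DifferenceCurve.eq_zero_of_generic {a b c d T : ℝ} {m e h w mt et p q : ℝ → HInf}
    (H : DifferenceCurve a b c d T m e h w mt et p q) (ha : a < 0) (hc : c < 0) (hb : 0 < b)
    (hd : 0 < d) (h0 : h 0 = 0) (w0 : w 0 = 0) :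
    ∀ t ∈ Icc 0 T, h t = 0 ∧ w t = 0 := by
  obtain ⟨C, hC⟩ := H.bound
  set E : ℝ → ℝ := fun t => B (h t - b • D (D (h t))) (h t + c • D (D (h t))) +
    B (w t - d • D (D (w t))) (w t + a • D (D (w t))) with hE
  set X : ℝ → ℝ := fun t => B (h t) (h t) + B (w t) (w t) + B (D (h t)) (D (h t)) +
    B (D (w t)) (D (w t)) + B (D (D (h t))) (D (D (h t))) + B (D (D (w t))) (D (D (w t))) with hX
  have hEX : ∀ t, E t = B (h t) (h t) + (b - c) * B (D (h t)) (D (h t)) +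
      (-(b * c)) * B (D (D (h t))) (D (D (h t))) + B (w t) (w t) +
      (d - a) * B (D (w t)) (D (w t)) + (-(d * a)) * B (D (D (w t))) (D (D (w t))) := by
    intro t
    simp only [hE, B_add_right, B_sub_left, B_smul_left, B_smul_right]
    rw [B_D_right (h t) (D (h t)), B_D_right (w t) (D (w t)), B_comm (D (D (h t))) (h t),
      B_comm (D (D (w t))) (w t), B_D_right (h t) (D (h t)), B_D_right (w t) (D (w t))]
    ring
  obtain ⟨κ, hκ, k1, k2, k3, k4, k5⟩ : ∃ κ : ℝ, 0 < κ ∧ κ ≤ 1 ∧ κ ≤ b - c ∧ κ ≤ -(b * c) ∧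
      κ ≤ d - a ∧ κ ≤ -(d * a) := by
    refine ⟨min 1 (min (b - c) (min (-(b * c)) (min (d - a) (-(d * a))))), ?_, ?_, ?_, ?_, ?_, ?_⟩
    · have := mul_pos hb (neg_pos.2 hc)
      have := mul_pos hd (neg_pos.2 ha)
      refine lt_min one_pos (lt_min (by linarith) (lt_min (by linarith)
        (lt_min (by linarith) (by linarith))))
    all_goals simp
  have hXE : ∀ t, κ * X t ≤ E t := by
    intro t
    rw [hEX, hX]
    nlinarith [mul_nonneg (sub_nonneg.2 k1) (B_self_nonneg (h t)),
      mul_nonneg (sub_nonneg.2 k1) (B_self_nonneg (w t)),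
      mul_nonneg (sub_nonneg.2 k2) (B_self_nonneg (D (h t))),
      mul_nonneg (sub_nonneg.2 k3) (B_self_nonneg (D (D (h t)))),
      mul_nonneg (sub_nonneg.2 k4) (B_self_nonneg (D (w t))),
      mul_nonneg (sub_nonneg.2 k5) (B_self_nonneg (D (D (w t))))]
  have hder : ∀ t ∈ Icc 0 T, HasDerivWithinAt E
      (-2 * (B (D (m t * h t + e t * w t)) (h t + c • D (D (h t))) +
        B (D (m t * w t)) (w t + a • D (D (w t))))) (Icc 0 T) t := by
    intro t ht
    have hh := H.hasDeriv_h t ht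
    have hw := H.hasDeriv_w t ht
    refine ((hasDerivWithinAt_inner (hh.sub (hh.D.D.smul b)).zero
      (hh.add (hh.D.D.smul c)).zero).add (hasDerivWithinAt_inner (hw.sub (hw.D.D.smul d)).zero
      (hw.add (hw.D.D.smul a)).zero)).congr_deriv ?_
    -- The operators `1 - b∂²` and `1 + c∂²` are symmetric and commute, so both halves of the
    -- product rule are equal.
    have s1 : B (h t - b • D (D (h t))) (p t + c • D (D (p t))) =
        B (p t - b • D (D (p t))) (h t + c • D (D (h t))) := by
      simp only [B_add_right, B_sub_left, B_smul_left, B_smul_right]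
      rw [B_comm (h t) (p t), B_comm (D (D (h t))) (D (D (p t))), B_comm (h t) (D (D (p t))),
        B_comm (D (D (h t))) (p t), B_D_right (p t) (D (h t)), B_comm (D (D (p t))) (h t),
        B_D_right (h t) (D (p t)), B_comm (D (h t)) (D (p t))]
    have s2 : B (w t - d • D (D (w t))) (q t + a • D (D (q t))) =
        B (q t - d • D (D (q t))) (w t + a • D (D (w t))) := by
      simp only [B_add_right, B_sub_left, B_smul_left, B_smul_right]
      rw [B_comm (w t) (q t), B_comm (D (D (w t))) (D (D (q t))), B_comm (w t) (D (D (q t))),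
        B_comm (D (D (w t))) (q t), B_D_right (q t) (D (w t)), B_comm (D (D (q t))) (w t),
        B_D_right (w t) (D (q t)), B_comm (D (w t)) (D (q t))]
    -- The linear contributions of the two equations cancel because `∂ₓ` is antisymmetric.
    have s3 : B (D (w t + a • D (D (w t)))) (h t + c • D (D (h t))) +
        B (D (h t + c • D (D (h t)))) (w t + a • D (D (w t))) = 0 := by
      rw [B_comm (D (h t + c • D (D (h t)))), B_D_right]
      ring
    rw [s1, s2, H.eq_h t ht, H.eq_w t ht, B_neg_left, B_neg_left,
      add_comm (a • D (D (w t))) (w t), add_comm (c • D (D (h t))) (h t),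
      map_add D (w t + a • D (D (w t))), map_add D (h t + c • D (D (h t))), B_add_left,
      B_add_left]
    linear_combination -2 * s3
  -- Expanding gives six pairings with coefficient `1`, four with `-c`, two with `-a`, each at most
  -- `2 C X` up to its coefficient; with the outer factor `2` they total `C X (24 - 16c - 8a)`,
  -- which `16 C (2 - a - c) X` dominates.
  have hbound : ∀ t ∈ Icc 0 T,
      (-2 * (B (D (m t * h t + e t * w t)) (h t + c • D (D (h t))) +
        B (D (m t * w t)) (w t + a • D (D (w t))))) ≤ 16 * C * (2 - a - c) / κ * E t := by
    intro t ht
    have hm : ∀ x, |(m t : ℝ → ℝ) x| ≤ C := fun x => (hC t ht x).1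
    have he : ∀ x, |(e t : ℝ → ℝ) x| ≤ C := fun x => (hC t ht x).2.1
    have hm' : ∀ x, |(D (m t) : ℝ → ℝ) x| ≤ C := fun x => (hC t ht x).2.2.1
    have he' : ∀ x, |(D (e t) : ℝ → ℝ) x| ≤ C := fun x => (hC t ht x).2.2.2
    have hC0 : 0 ≤ C := (abs_nonneg _).trans (hm 0)
    have n1 := B_self_nonneg (h t)
    have n2 := B_self_nonneg (w t)
    have n3 := B_self_nonneg (D (h t))
    have n4 := B_self_nonneg (D (w t))
    have n5 := B_self_nonneg (D (D (h t)))
    have n6 := B_self_nonneg (D (D (w t)))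
    have hX0 : 0 ≤ X t := by simp only [hX]; positivity
    have key : ∀ {α : HInf} (_ : ∀ x, |(α : ℝ → ℝ) x| ≤ C) {f g : HInf}
        (_ : B f f ≤ X t) (_ : B g g ≤ X t) {r : ℝ} (_ : 0 ≤ r),
        |r * B (α * f) g| ≤ r * (2 * C * X t) := by
      intro α hα f g hf hg r hr
      rw [abs_mul, abs_of_nonneg hr]
      refine mul_le_mul_of_nonneg_left ((abs_B_mul_le hα f g).trans ?_) hr
      nlinarith
    have x1 : B (h t) (h t) ≤ X t := by simp only [hX]; linarith
    have x2 : B (w t) (w t) ≤ X t := by simp only [hX]; linarith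
    have x3 : B (D (h t)) (D (h t)) ≤ X t := by simp only [hX]; linarith
    have x4 : B (D (w t)) (D (w t)) ≤ X t := by simp only [hX]; linarith
    have x5 : B (D (D (h t))) (D (D (h t))) ≤ X t := by simp only [hX]; linarith
    have x6 : B (D (D (w t))) (D (D (w t))) ≤ X t := by simp only [hX]; linarith
    have rc : 0 ≤ -c := by linarith
    have ra : 0 ≤ -a := by linarith
    have y1 := abs_le.1 (key hm' x1 x1 zero_le_one)
    have y2 := abs_le.1 (key hm x3 x1 zero_le_one)
    have y3 := abs_le.1 (key he' x2 x1 zero_le_one)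
    have y4 := abs_le.1 (key he x4 x1 zero_le_one)
    have y5 := abs_le.1 (key hm' x1 x5 rc)
    have y6 := abs_le.1 (key hm x3 x5 rc)
    have y7 := abs_le.1 (key he' x2 x5 rc)
    have y8 := abs_le.1 (key he x4 x5 rc)
    have y9 := abs_le.1 (key hm' x2 x2 zero_le_one)
    have y10 := abs_le.1 (key hm x4 x2 zero_le_one)
    have y11 := abs_le.1 (key hm' x2 x6 ra)
    have y12 := abs_le.1 (key hm x4 x6 ra)
    have hfin : 16 * C * (2 - a - c) * X t ≤ 16 * C * (2 - a - c) / κ * E t := by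
      rw [div_mul_eq_mul_div, le_div_iff₀ hκ, mul_assoc _ (X t), mul_comm (X t)]
      exact mul_le_mul_of_nonneg_left (hXE t) (mul_nonneg (by positivity) (by linarith))
    refine le_trans ?_ hfin
    have hCX : 0 ≤ C * X t := mul_nonneg hC0 hX0
    have hcX := mul_nonneg rc hCX
    have haX := mul_nonneg ra hCX
    simp only [map_add, D_mul, B_add_left, B_add_right, B_smul_right]
    linarith
  intro t ht
  have hE0 : E 0 ≤ 0 := by simp [hE, h0, w0, B]
  have hEt := nonpos_of_deriv_le hder hbound hE0 t ht
  have hXt : X t ≤ 0 := by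
    by_contra hcon
    have := mul_pos hκ (not_le.1 hcon)
    linarith [hXE t]
  have n1 := B_self_nonneg (h t)
  have n2 := B_self_nonneg (w t)
  have n3 := B_self_nonneg (D (h t))
  have n4 := B_self_nonneg (D (w t))
  have n5 := B_self_nonneg (D (D (h t)))
  have n6 := B_self_nonneg (D (D (w t)))
  simp only [hX] at hXt
  exact ⟨eq_zero_of_B_self (by linarith), eq_zero_of_B_self (by linarith)⟩

/-- Here the `L²` norm alone loses one derivative. The form `h² + w² - α(h'² + w'²) + 2 m h w + e
w²` has as half its variational derivatives exactly the fluxes `Q`, `P` of the two equations, so it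
changes in time only through `m` and `e`. Its negative controls the `H¹` norm once a large multiple
`K` of the `L²` norm is added, and the growth of that multiple is itself bounded in `H¹`. -/
theorem DifferenceCurve.eq_zero_of_kdv {α T : ℝ} {m e h w mt et p q : ℝ → HInf}
    (H : DifferenceCurve α 0 α 0 T m e h w mt et p q) (hα : 0 < α)
    (hbt : ∃ C, ∀ t ∈ Icc 0 T, ∀ x, |(mt t : ℝ → ℝ) x| ≤ C ∧ |(et t : ℝ → ℝ) x| ≤ C)
    (h0 : h 0 = 0) (w0 : w 0 = 0) :
    ∀ t ∈ Icc 0 T, h t = 0 ∧ w t = 0 := by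
  obtain ⟨C, hC⟩ := H.bound
  obtain ⟨C', hC'⟩ := hbt
  -- The terms with `m` and `e` are together at most `4 |C|` times the squared `L²` norm, so a full
  -- `L²` norm remains after subtracting the form.
  set K : ℝ := 2 + 4 * |C| with hK
  set E : ℝ → ℝ := fun t => K * (B (h t) (h t) + B (w t) (w t)) -
    (B (h t) (h t) + B (w t) (w t) - α * (B (D (h t)) (D (h t)) + B (D (w t)) (D (w t))) +
      2 * B (m t * h t) (w t) + B (e t * w t) (w t)) with hE
  set X : ℝ → ℝ := fun t => B (h t) (h t) + B (w t) (w t) + B (D (h t)) (D (h t)) +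
    B (D (w t)) (D (w t)) with hX
  set κ : ℝ := min 1 α with hκdef
  have hκ : 0 < κ := lt_min one_pos hα
  have k1 : κ ≤ 1 := min_le_left _ _
  have k2 : κ ≤ α := min_le_right _ _
  have hXE : ∀ t ∈ Icc 0 T, κ * X t ≤ E t := by
    intro t ht
    have hm : ∀ x, |(m t : ℝ → ℝ) x| ≤ |C| := fun x => (hC t ht x).1.trans (le_abs_self C)
    have he : ∀ x, |(e t : ℝ → ℝ) x| ≤ |C| := fun x => (hC t ht x).2.1.trans (le_abs_self C)
    have b1 := (abs_le.1 (abs_B_mul_le hm (h t) (w t))).2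
    have b2 := (abs_le.1 (abs_B_mul_le he (w t) (w t))).2
    simp only [hE, hX, hK]
    nlinarith [mul_nonneg (sub_nonneg.2 k1) (B_self_nonneg (h t)),
      mul_nonneg (sub_nonneg.2 k1) (B_self_nonneg (w t)),
      mul_nonneg (sub_nonneg.2 k2) (B_self_nonneg (D (h t))),
      mul_nonneg (sub_nonneg.2 k2) (B_self_nonneg (D (w t))),
      mul_nonneg (abs_nonneg C) (B_self_nonneg (h t)),
      mul_nonneg (abs_nonneg C) (B_self_nonneg (w t))]
  have hder : ∀ t ∈ Icc 0 T, HasDerivWithinAt E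
      (2 * K * (B (m t * h t) (D (h t)) + B (e t * w t) (D (h t)) + B (m t * w t) (D (w t))) -
        (2 * B (mt t * h t) (w t) + B (et t * w t) (w t))) (Icc 0 T) t := by
    intro t ht
    have hh := H.hasDeriv_h t ht
    have hw := H.hasDeriv_w t ht
    have hhh := hasDerivWithinAt_inner hh.zero hh.zero
    have hww := hasDerivWithinAt_inner hw.zero hw.zero
    refine (((hhh.add hww).const_mul K).sub ((((hhh.add hww).sub
      (((hasDerivWithinAt_inner hh.D.zero hh.D.zero).add
      (hasDerivWithinAt_inner hw.D.zero hw.D.zero)).const_mul α)).add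
      ((hasDerivWithinAt_inner ((H.hasDeriv_m t ht).mul hh) hw.zero).const_mul 2)).add
      (hasDerivWithinAt_inner ((H.hasDeriv_e t ht).mul hw) hw.zero))).congr_deriv ?_
    set P := α • D (D (w t)) + w t + (m t * h t + e t * w t) with hP
    set Q := α • D (D (h t)) + h t + m t * w t with hQ
    have ep : p t = -D P := by
      rw [hP, ← H.eq_h t ht, zero_smul, sub_zero]
    have eq : q t = -D Q := by
      rw [hQ, ← H.eq_w t ht, zero_smul, sub_zero]
    -- The Hamiltonian structure `p = -∂ₓP`, `q = -∂ₓQ`: the evolution of the form through `h` and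
    -- `w` vanishes.
    have s1 : B (p t) Q + B (q t) P = 0 := by
      rw [ep, eq, B_neg_left, B_neg_left, B_comm (D Q), B_D_right]
      ring
    -- In the growth of the `L²` norm the first- and third-order linear terms cancel, and only
    -- pairings with one derivative are left.
    have s2 : B (h t) (p t) + B (w t) (q t) =
        B (m t * h t) (D (h t)) + B (e t * w t) (D (h t)) + B (m t * w t) (D (w t)) := by
      rw [ep, eq, B_neg_right, B_neg_right, B_D_right, B_D_right, hP, hQ]
      simp only [B_add_right, B_smul_right]
      rw [B_D_right (D (h t)) (D (w t)), B_comm (D (w t)) (D (D (h t))), B_comm (D (w t)) (h t),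
        B_D_right (h t) (w t), B_comm (m t * h t), B_comm (e t * w t), B_comm (m t * w t)]
      ring
    have s3 : B (D (h t)) (D (p t)) = -B (p t) (D (D (h t))) := by rw [B_D_right, B_comm]
    have s4 : B (D (w t)) (D (q t)) = -B (q t) (D (D (w t))) := by rw [B_D_right, B_comm]
    have s5 := s3
    have s6 := s4
    rw [B_comm] at s5 s6
    have c1 := B_comm (h t) (p t)
    have c2 := B_comm (w t) (q t)
    have c3 := B_comm (m t * h t) (q t)
    have c4 := B_mul_left (m t) (p t) (w t)
    have c5 := B_comm (e t * w t) (q t)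
    have c6 := B_mul_left (e t) (q t) (w t)
    rw [hP, hQ] at s1
    simp only [B_add_right, B_add_left, B_smul_right] at s1 ⊢
    linear_combination 2 * K * s2 - K * c1 - K * c2 - c1 - c2 + α * (s3 + s4 + s5 + s6) -
      2 * c3 - 2 * c4 - c5 - c6 - 2 * s1
  set L : ℝ := 2 * K * 6 * |C| + 6 * |C'| with hL
  have hK0 : 0 < K := by positivity
  have hbound : ∀ t ∈ Icc 0 T,
      2 * K * (B (m t * h t) (D (h t)) + B (e t * w t) (D (h t)) + B (m t * w t) (D (w t))) -
        (2 * B (mt t * h t) (w t) + B (et t * w t) (w t)) ≤ L / κ * E t := by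
    intro t ht
    have hm : ∀ x, |(m t : ℝ → ℝ) x| ≤ |C| := fun x => (hC t ht x).1.trans (le_abs_self C)
    have he : ∀ x, |(e t : ℝ → ℝ) x| ≤ |C| := fun x => (hC t ht x).2.1.trans (le_abs_self C)
    have hm' : ∀ x, |(mt t : ℝ → ℝ) x| ≤ |C'| := fun x => (hC' t ht x).1.trans (le_abs_self C')
    have he' : ∀ x, |(et t : ℝ → ℝ) x| ≤ |C'| := fun x => (hC' t ht x).2.trans (le_abs_self C')
    have n1 := B_self_nonneg (h t)
    have n2 := B_self_nonneg (w t)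
    have n3 := B_self_nonneg (D (h t))
    have n4 := B_self_nonneg (D (w t))
    have hX0 : 0 ≤ X t := by simp only [hX]; positivity
    have key : ∀ {A : ℝ} {β : HInf} (_ : ∀ x, |(β : ℝ → ℝ) x| ≤ |A|) {f g : HInf}
        (_ : B f f ≤ X t) (_ : B g g ≤ X t), |B (β * f) g| ≤ 2 * (|A| * X t) := by
      intro A β hβ f g hf hg
      refine (abs_B_mul_le hβ f g).trans ?_
      nlinarith [abs_nonneg A]
    have x1 : B (h t) (h t) ≤ X t := by simp only [hX]; linarith
    have x2 : B (w t) (w t) ≤ X t := by simp only [hX]; linarith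
    have x3 : B (D (h t)) (D (h t)) ≤ X t := by simp only [hX]; linarith
    have x4 : B (D (w t)) (D (w t)) ≤ X t := by simp only [hX]; linarith
    have y1 := abs_le.1 (key hm x1 x3)
    have y2 := abs_le.1 (key he x2 x3)
    have y3 := abs_le.1 (key hm x2 x4)
    have y4 := abs_le.1 (key hm' x1 x2)
    have y5 := abs_le.1 (key he' x2 x2)
    have hfin : L * X t ≤ L / κ * E t := by
      rw [div_mul_eq_mul_div, le_div_iff₀ hκ, mul_assoc _ (X t), mul_comm (X t)]
      exact mul_le_mul_of_nonneg_left (hXE t ht) (by positivity)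
    refine le_trans ?_ hfin
    have z : B (m t * h t) (D (h t)) + B (e t * w t) (D (h t)) + B (m t * w t) (D (w t)) ≤
      6 * (|C| * X t) := by linarith
    have z' := mul_le_mul_of_nonneg_left z (by positivity : (0 : ℝ) ≤ 2 * K)
    rw [hL]
    linarith
  intro t ht
  have hE0 : E 0 ≤ 0 := by simp [hE, h0, w0, B]
  have hEt := nonpos_of_deriv_le hder hbound hE0 t ht
  have hXt : X t ≤ 0 := by
    by_contra hcon
    have := mul_pos hκ (not_le.1 hcon)
    linarith [hXE t ht]
  have n1 := B_self_nonneg (h t)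
  have n2 := B_self_nonneg (w t)
  have n3 := B_self_nonneg (D (h t))
  have n4 := B_self_nonneg (D (w t))
  simp only [hX] at hXt
  exact ⟨eq_zero_of_B_self (by linarith), eq_zero_of_B_self (by linarith)⟩

theorem eq_of_difference {T : ℝ} {v w : ℝ → State} {η u η' u' : ℝ → HInf}
    (hη : ∀ t ∈ Icc 0 T, (η t : ℝ → ℝ) = (v t).1) (hu : ∀ t ∈ Icc 0 T, (u t : ℝ → ℝ) = (v t).2)
    (hη' : ∀ t ∈ Icc 0 T, (η' t : ℝ → ℝ) = (w t).1)
    (hu' : ∀ t ∈ Icc 0 T, (u' t : ℝ → ℝ) = (w t).2) (h0 : v 0 = w 0)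
    (h : η 0 - η' 0 = 0 → u 0 - u' 0 = 0 → ∀ t ∈ Icc 0 T, η t - η' t = 0 ∧ u t - u' t = 0) :
    ∀ t ∈ Icc 0 T, v t = w t := by
  intro t ht
  have hT : (0 : ℝ) ∈ Icc 0 T := left_mem_Icc.2 (ht.1.trans ht.2)
  obtain ⟨h1, h2⟩ := h
    (sub_eq_zero.2 (Subtype.ext (by rw [hη 0 hT, hη' 0 hT, h0])))
    (sub_eq_zero.2 (Subtype.ext (by rw [hu 0 hT, hu' 0 hT, h0]))) t ht
  refine Prod.ext ?_ ?_
  · rw [← hη t ht, ← hη' t ht, sub_eq_zero.1 h1]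
  · rw [← hu t ht, ← hu' t ht, sub_eq_zero.1 h2]

theorem uniqueSolutions_generic {a b c d : ℝ} (ha : a < 0) (hc : c < 0) (hb : 0 < b)
    (hd : 0 < d) : UniqueSolutions a b c d := by
  intro T v w hv hw h0
  obtain ⟨η, u, p, q, h, hη, hu⟩ := hv.exists_curve
  obtain ⟨η', u', p', q', h', hη', hu'⟩ := hw.exists_curve
  exact eq_of_difference hη hu hη' hu' h0 fun z1 z2 =>
    (h.difference h').eq_zero_of_generic ha hc hb hd z1 z2

/-- Since `b = d = 0`, the equations express the time derivatives by space derivatives, which are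
bounded on the compact interval. This bounds the time derivatives of the coefficients `m` and `e` in
the energy. -/
theorem SolutionCurve.exists_bound_deriv {α T : ℝ} {η u p q : ℝ → HInf}
    (h : SolutionCurve α 0 α 0 T η u p q) :
    ∃ C, ∀ t ∈ Icc 0 T, ∀ x, |(p t : ℝ → ℝ) x| ≤ C ∧ |(q t : ℝ → ℝ) x| ≤ C := by
  obtain ⟨C1, h1⟩ := HasDeriv.exists_bound fun t ht => h.hasDeriv_fst t ht
  obtain ⟨C2, h2⟩ := HasDeriv.exists_bound fun t ht => (h.hasDeriv_fst t ht).D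
  obtain ⟨C3, h3⟩ := HasDeriv.exists_bound fun t ht => (h.hasDeriv_fst t ht).D.D.D
  obtain ⟨C4, h4⟩ := HasDeriv.exists_bound fun t ht => h.hasDeriv_snd t ht
  obtain ⟨C5, h5⟩ := HasDeriv.exists_bound fun t ht => (h.hasDeriv_snd t ht).D
  obtain ⟨C6, h6⟩ := HasDeriv.exists_bound fun t ht => (h.hasDeriv_snd t ht).D.D.D
  refine ⟨|α| * C6 + C5 + (C5 * C1 + C4 * C2) + (|α| * C3 + C2 + C5 * C4 + C4 * C5),
    fun t ht x => ?_⟩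
  have a1 := h1 t ht x
  have a2 := h2 t ht x
  have a3 := h3 t ht x
  have a4 := h4 t ht x
  have a5 := h5 t ht x
  have a6 := h6 t ht x
  have p1 : 0 ≤ C1 := (abs_nonneg _).trans a1
  have p2 : 0 ≤ C2 := (abs_nonneg _).trans a2
  have p3 : 0 ≤ C3 := (abs_nonneg _).trans a3
  have p4 : 0 ≤ C4 := (abs_nonneg _).trans a4
  have p5 : 0 ≤ C5 := (abs_nonneg _).trans a5
  have p6 : 0 ≤ C6 := (abs_nonneg _).trans a6
  have e1 := h.eq_fst t ht
  have e2 := h.eq_snd t ht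
  rw [zero_smul, sub_zero] at e1 e2
  have b1 : |(p t : ℝ → ℝ) x| ≤ |α| * C6 + C5 + (C5 * C1 + C4 * C2) := by
    rw [e1]
    simp only [map_add, map_smul, D_mul, NonUnitalSubalgebra.coe_neg, Pi.neg_apply, abs_neg,
      NonUnitalSubalgebra.coe_add, Pi.add_apply, NonUnitalSubalgebra.coe_smul, Pi.smul_apply,
      NonUnitalSubalgebra.coe_mul, Pi.mul_apply, smul_eq_mul]
    refine (abs_add_le _ _).trans (add_le_add ((abs_add_le _ _).trans (add_le_add ?_ a5))
      ((abs_add_le _ _).trans (add_le_add ?_ ?_)))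
    · rw [abs_mul]; gcongr
    · rw [abs_mul]; gcongr
    · rw [abs_mul]; gcongr
  have b2 : |(q t : ℝ → ℝ) x| ≤ |α| * C3 + C2 + (1 / 2) * (C5 * C4 + C4 * C5) := by
    rw [e2]
    simp only [map_add, map_smul, D_mul, NonUnitalSubalgebra.coe_neg, Pi.neg_apply, abs_neg,
      NonUnitalSubalgebra.coe_add, Pi.add_apply, NonUnitalSubalgebra.coe_smul, Pi.smul_apply,
      NonUnitalSubalgebra.coe_mul, Pi.mul_apply, smul_eq_mul]
    refine (abs_add_le _ _).trans (add_le_add ((abs_add_le _ _).trans (add_le_add ?_ a2)) ?_)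
    · rw [abs_mul]; gcongr
    · rw [abs_mul, abs_of_pos (by norm_num : (0 : ℝ) < 1 / 2)]
      gcongr
      refine (abs_add_le _ _).trans (add_le_add ?_ ?_)
      · rw [abs_mul]; gcongr
      · rw [abs_mul]; gcongr
  have := mul_nonneg (abs_nonneg α) p6
  have := mul_nonneg (abs_nonneg α) p3
  have := mul_nonneg p5 p1
  have := mul_nonneg p4 p2
  have := mul_nonneg p5 p4
  constructor <;> linarith

theorem uniqueSolutions_kdv {α : ℝ} (hα : 0 < α) : UniqueSolutions α 0 α 0 := by
  intro T v w hv hw h0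
  obtain ⟨η, u, p, q, h, hη, hu⟩ := hv.exists_curve
  obtain ⟨η', u', p', q', h', hη', hu'⟩ := hw.exists_curve
  obtain ⟨C, hC⟩ := h.exists_bound_deriv
  obtain ⟨C', hC'⟩ := h'.exists_bound_deriv
  have half : ∀ {f g : HInf} {x : ℝ}, |(f : ℝ → ℝ) x| ≤ C → |(g : ℝ → ℝ) x| ≤ C' →
      |(((1 / 2 : ℝ) • (f + g) : HInf) : ℝ → ℝ) x| ≤ C + C' := by
    intro f g x hf hg
    simp only [NonUnitalSubalgebra.coe_smul, NonUnitalSubalgebra.coe_add, Pi.smul_apply,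
      Pi.add_apply, smul_eq_mul]
    rw [abs_mul, abs_of_pos (by norm_num : (0 : ℝ) < 1 / 2)]
    have := abs_add_le ((f : ℝ → ℝ) x) ((g : ℝ → ℝ) x)
    have := abs_nonneg ((f : ℝ → ℝ) x + (g : ℝ → ℝ) x)
    linarith
  exact eq_of_difference hη hu hη' hu' h0 fun z1 z2 =>
    (h.difference h').eq_zero_of_kdv hα ⟨C + C', fun t ht x =>
      ⟨half (hC t ht x).2 (hC' t ht x).2, half (hC t ht x).1 (hC' t ht x).1⟩⟩ z1 z2

/-! ### Weighted convolution estimates on the Fourier side. -/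

/-- The weight which dominates the solutions on the Fourier side, at the frequency scale `N`. -/
def weight (N ρ ξ : ℝ) : ℝ := Real.exp (-(ρ * (1 + |ξ| / N))) / (1 + (ξ / N) ^ 2)

theorem weight_pos (N ρ ξ : ℝ) : 0 < weight N ρ ξ := by unfold weight; positivity

theorem weight_neg (N ρ ξ : ℝ) : weight N ρ (-ξ) = weight N ρ ξ := by
  simp [weight, neg_div]

theorem weight_anti {N : ℝ} (hN : 0 < N) {ρ ρ' : ℝ} (h : ρ ≤ ρ') (ξ : ℝ) :
    weight N ρ' ξ ≤ weight N ρ ξ := by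
  unfold weight
  gcongr

theorem weight_le {N ρ : ℝ} (hN : 0 < N) (hρ : 0 ≤ ρ) (ξ : ℝ) :
    weight N ρ ξ ≤ (1 + (ξ / N) ^ 2)⁻¹ := by
  unfold weight
  rw [div_eq_mul_inv]
  refine mul_le_of_le_one_left (by positivity) (Real.exp_le_one_iff.2 ?_)
  have : 0 ≤ ρ * (1 + |ξ| / N) := by positivity
  linarith

/-- The exponentials combine by the triangle inequality, and the rational factors by `1 + (x + y)² ≤
2(1 + x²) + 2(1 + y²)`. -/
theorem weight_mul_le {N ρ : ℝ} (hN : 0 < N) (hρ : 0 ≤ ρ) (ξ ζ : ℝ) :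
    weight N ρ ζ * weight N ρ (ξ - ζ) ≤
      weight N ρ ξ * (2 * (1 + (ζ / N) ^ 2)⁻¹ + 2 * (1 + ((ξ - ζ) / N) ^ 2)⁻¹) := by
  unfold weight
  have h1 : Real.exp (-(ρ * (1 + |ζ| / N))) * Real.exp (-(ρ * (1 + |ξ - ζ| / N))) ≤
      Real.exp (-(ρ * (1 + |ξ| / N))) := by
    rw [← Real.exp_add, Real.exp_le_exp]
    have h2 : |ξ| / N ≤ |ζ| / N + |ξ - ζ| / N := by
      rw [← add_div]
      gcongr
      calc |ξ| = |ζ + (ξ - ζ)| := by ring_nf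
        _ ≤ _ := abs_add_le _ _
    nlinarith
  have h3 : 1 + (ξ / N) ^ 2 ≤ 2 * (1 + (ζ / N) ^ 2) + 2 * (1 + ((ξ - ζ) / N) ^ 2) := by
    have : ξ / N = ζ / N + (ξ - ζ) / N := by ring
    rw [this]
    nlinarith [sq_nonneg (ζ / N - (ξ - ζ) / N)]
  have h4 : (1 + (ζ / N) ^ 2)⁻¹ * (1 + ((ξ - ζ) / N) ^ 2)⁻¹ ≤ (1 + (ξ / N) ^ 2)⁻¹ *
      (2 * (1 + (ζ / N) ^ 2)⁻¹ + 2 * (1 + ((ξ - ζ) / N) ^ 2)⁻¹) := by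
    rw [inv_mul_eq_div (1 + (ξ / N) ^ 2), le_div_iff₀ (by positivity)]
    have e : 2 * (1 + (ζ / N) ^ 2)⁻¹ + 2 * (1 + ((ξ - ζ) / N) ^ 2)⁻¹ =
        (1 + (ζ / N) ^ 2)⁻¹ * (1 + ((ξ - ζ) / N) ^ 2)⁻¹ *
          (2 * (1 + (ζ / N) ^ 2) + 2 * (1 + ((ξ - ζ) / N) ^ 2)) := by
      field_simp
      ring
    rw [e]
    gcongr
  calc _ = (Real.exp (-(ρ * (1 + |ζ| / N))) * Real.exp (-(ρ * (1 + |ξ - ζ| / N)))) *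
        ((1 + (ζ / N) ^ 2)⁻¹ * (1 + ((ξ - ζ) / N) ^ 2)⁻¹) := by ring
    _ ≤ Real.exp (-(ρ * (1 + |ξ| / N))) * ((1 + (ξ / N) ^ 2)⁻¹ *
      (2 * (1 + (ζ / N) ^ 2)⁻¹ + 2 * (1 + ((ξ - ζ) / N) ^ 2)⁻¹)) := by gcongr
    _ = _ := by ring

theorem integrable_inv_one_add_div_sq {N : ℝ} (hN : 0 < N) :
    Integrable (fun ζ : ℝ => (1 + (ζ / N) ^ 2)⁻¹) :=
  integrable_inv_one_add_sq.comp_div hN.ne'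

theorem integral_inv_one_add_div_sq {N : ℝ} (hN : 0 < N) :
    ∫ ζ : ℝ, (1 + (ζ / N) ^ 2)⁻¹ = Real.pi * N := by
  rw [Measure.integral_comp_div (fun x : ℝ => (1 + x ^ 2)⁻¹) N, integral_univ_inv_one_add_sq,
    abs_of_pos hN, smul_eq_mul, mul_comm]

/-- The convolution of two real functions on the line. -/
def rconv (f g : ℝ → ℝ) (ξ : ℝ) : ℝ := ∫ ζ, f ζ * g (ξ - ζ)

section rconv

variable {f f' g g' : ℝ → ℝ} {N ρ F F' G G' : ℝ}

theorem integrable_rconv (hN : 0 < N) (hρ : 0 ≤ ρ) (hf : Continuous f) (hg : Continuous g)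
    (hF : ∀ ζ, |f ζ| ≤ F * weight N ρ ζ) (hG : ∀ ζ, |g ζ| ≤ G * weight N ρ ζ) (ξ : ℝ) :
    Integrable (fun ζ => f ζ * g (ξ - ζ)) := by
  have hF0 : 0 ≤ F := nonneg_of_mul_nonneg_left ((abs_nonneg _).trans (hF 0)) (weight_pos N ρ 0)
  have hG0 : 0 ≤ G := nonneg_of_mul_nonneg_left ((abs_nonneg _).trans (hG 0)) (weight_pos N ρ 0)
  refine ((integrable_inv_one_add_div_sq hN).const_mul (F * G)).mono'
    (by fun_prop : Continuous fun ζ => f ζ * g (ξ - ζ)).aestronglyMeasurable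
    (Eventually.of_forall fun ζ => ?_)
  rw [norm_mul, Real.norm_eq_abs, Real.norm_eq_abs]
  calc |f ζ| * |g (ξ - ζ)| ≤ (F * (1 + (ζ / N) ^ 2)⁻¹) * (G * 1) := by
        refine mul_le_mul ((hF ζ).trans ?_) ((hG _).trans ?_) (abs_nonneg _) (by positivity)
        · gcongr
          exact weight_le hN hρ ζ
        · gcongr
          refine (weight_le hN hρ _).trans (inv_le_one_of_one_le₀ ?_)
          have := sq_nonneg ((ξ - ζ) / N)
          linarith
    _ = _ := by ring

/-- Integrating the product bound for the weight: each of the two bumps has integral `πN` and comes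
with a factor `2`, hence `4πN`. -/
theorem abs_rconv_le (hN : 0 < N) (hρ : 0 ≤ ρ)
    (hF : ∀ ζ, |f ζ| ≤ F * weight N ρ ζ) (hG : ∀ ζ, |g ζ| ≤ G * weight N ρ ζ) (ξ : ℝ) :
    |rconv f g ξ| ≤ F * G * (4 * Real.pi * N) * weight N ρ ξ := by
  have hF0 : 0 ≤ F := nonneg_of_mul_nonneg_left ((abs_nonneg _).trans (hF 0)) (weight_pos N ρ 0)
  have hG0 : 0 ≤ G := nonneg_of_mul_nonneg_left ((abs_nonneg _).trans (hG 0)) (weight_pos N ρ 0)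
  have i1 := integrable_inv_one_add_div_sq hN
  have i2 : Integrable (fun ζ : ℝ => (1 + ((ξ - ζ) / N) ^ 2)⁻¹) := i1.comp_sub_left ξ
  have e : F * G * (4 * Real.pi * N) * weight N ρ ξ = ∫ ζ, F * G * weight N ρ ξ *
      (2 * (1 + (ζ / N) ^ 2)⁻¹ + 2 * (1 + ((ξ - ζ) / N) ^ 2)⁻¹) := by
    rw [integral_const_mul, integral_add (i1.const_mul 2) (i2.const_mul 2), integral_const_mul,
      integral_const_mul, integral_sub_left_eq_self (fun x : ℝ => (1 + (x / N) ^ 2)⁻¹) volume ξ,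
      integral_inv_one_add_div_sq hN]
    ring
  rw [e, rconv, ← Real.norm_eq_abs]
  refine norm_integral_le_of_norm_le (((i1.const_mul 2).add (i2.const_mul 2)).const_mul _)
    (Eventually.of_forall fun ζ => ?_)
  rw [norm_mul, Real.norm_eq_abs, Real.norm_eq_abs]
  calc |f ζ| * |g (ξ - ζ)| ≤ (F * weight N ρ ζ) * (G * weight N ρ (ξ - ζ)) :=
        mul_le_mul (hF _) (hG _) (abs_nonneg _) (mul_nonneg hF0 (weight_pos _ _ _).le)
    _ = F * G * (weight N ρ ζ * weight N ρ (ξ - ζ)) := by ring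
    _ ≤ F * G * (weight N ρ ξ *
        (2 * (1 + (ζ / N) ^ 2)⁻¹ + 2 * (1 + ((ξ - ζ) / N) ^ 2)⁻¹)) :=
        mul_le_mul_of_nonneg_left (weight_mul_le hN hρ ξ ζ) (mul_nonneg hF0 hG0)
    _ = _ := by ring

theorem continuous_rconv_param {X : Type*} [TopologicalSpace X] [FirstCountableTopology X]
    {f g : X → ℝ → ℝ} {ξ : X → ℝ} (hN : 0 < N) (hf : Continuous fun p : X × ℝ => f p.1 p.2)
    (hg : Continuous fun p : X × ℝ => g p.1 p.2) (hξ : Continuous ξ)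
    (hF : ∀ x ζ, |f x ζ| ≤ F * (1 + (ζ / N) ^ 2)⁻¹) (hG : ∀ x ζ, |g x ζ| ≤ G) :
    Continuous fun x => rconv (f x) (g x) (ξ x) := by
  refine continuous_of_dominated (bound := fun ζ => F * (1 + (ζ / N) ^ 2)⁻¹ * G) ?_ ?_ ?_ ?_
  · intro x
    have h1 : Continuous fun ζ => f x ζ := hf.comp (by fun_prop : Continuous fun ζ : ℝ => (x, ζ))
    have h2 : Continuous fun ζ => g x (ξ x - ζ) :=
      hg.comp (by fun_prop : Continuous fun ζ : ℝ => (x, ξ x - ζ))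
    exact (h1.mul h2).aestronglyMeasurable
  · intro x
    refine Eventually.of_forall fun ζ => ?_
    rw [norm_mul, Real.norm_eq_abs, Real.norm_eq_abs]
    exact mul_le_mul (hF x ζ) (hG x _) (abs_nonneg _) ((abs_nonneg _).trans (hF x ζ))
  · exact ((integrable_inv_one_add_div_sq hN).const_mul F).mul_const G
  · refine Eventually.of_forall fun ζ => ?_
    have h1 : Continuous fun x => f x ζ := hf.comp (by fun_prop : Continuous fun x : X => (x, ζ))
    have h2 : Continuous fun x => g x (ξ x - ζ) :=
      hg.comp (by fun_prop : Continuous fun x : X => (x, ξ x - ζ))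
    exact h1.mul h2

theorem rconv_neg (f g : ℝ → ℝ) (ξ : ℝ) :
    rconv f g (-ξ) = rconv (fun ζ => f (-ζ)) (fun ζ => g (-ζ)) ξ := by
  unfold rconv
  rw [← integral_neg_eq_self]
  congr 1
  ext ζ
  rw [show -ξ - -ζ = -(ξ - ζ) by ring]

theorem rconv_sub_left (hN : 0 < N) (hρ : 0 ≤ ρ) (hf : Continuous f) (hf' : Continuous f')
    (hg : Continuous g) (hF : ∀ ζ, |f ζ| ≤ F * weight N ρ ζ) (hF' : ∀ ζ, |f' ζ| ≤ F' * weight N ρ ζ)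
    (hG : ∀ ζ, |g ζ| ≤ G * weight N ρ ζ) (ξ : ℝ) :
    rconv (fun ζ => f ζ - f' ζ) g ξ = rconv f g ξ - rconv f' g ξ := by
  unfold rconv
  rw [← integral_sub (integrable_rconv hN hρ hf hg hF hG ξ)
    (integrable_rconv hN hρ hf' hg hF' hG ξ)]
  simp only [sub_mul]

theorem rconv_sub_right (hN : 0 < N) (hρ : 0 ≤ ρ) (hf : Continuous f) (hg : Continuous g)
    (hg' : Continuous g') (hF : ∀ ζ, |f ζ| ≤ F * weight N ρ ζ)
    (hG : ∀ ζ, |g ζ| ≤ G * weight N ρ ζ) (hG' : ∀ ζ, |g' ζ| ≤ G' * weight N ρ ζ) (ξ : ℝ) :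
    rconv f (fun ζ => g ζ - g' ζ) ξ = rconv f g ξ - rconv f g' ξ := by
  unfold rconv
  rw [← integral_sub (integrable_rconv hN hρ hf hg hF hG ξ)
    (integrable_rconv hN hρ hf hg' hF hG' ξ)]
  simp only [mul_sub]

end rconv

/-! ### The linear group and the bilinear form on the Fourier side. -/

/-- The symbols of the linear and the nonlinear part of the system, in the unknowns `(H, U)` with
`η̂ = H` and `û = iU`: `∂ₜ H = freq r U + b₁ (U ⋆ H)`, `∂ₜ U = -(freq / r) H + b₂ (U ⋆ U) / 2`. -/
structure Model where
  (freq r b₁ b₂ : ℝ → ℝ)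
  K : ℝ
  continuous_freq : Continuous freq
  continuous_r : Continuous r
  continuous_b₁ : Continuous b₁
  continuous_b₂ : Continuous b₂
  freq_neg : ∀ ξ, freq (-ξ) = -freq ξ
  r_neg : ∀ ξ, r (-ξ) = r ξ
  b₁_neg : ∀ ξ, b₁ (-ξ) = -b₁ ξ
  b₂_neg : ∀ ξ, b₂ (-ξ) = -b₂ ξ
  r_pos : ∀ ξ, 0 < r ξ
  r_le : ∀ ξ, r ξ ≤ K
  inv_r_le : ∀ ξ, (r ξ)⁻¹ ≤ K

namespace Model

variable (M : Model)

theorem K_pos : 0 < M.K := (M.r_pos 0).trans_le (M.r_le 0)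

/-- The linear group. -/
def grp (t ξ : ℝ) (y : ℝ × ℝ) : ℝ × ℝ :=
  (Real.cos (M.freq ξ * t) * y.1 + M.r ξ * Real.sin (M.freq ξ * t) * y.2,
    -((M.r ξ)⁻¹ * Real.sin (M.freq ξ * t)) * y.1 + Real.cos (M.freq ξ * t) * y.2)

theorem grp_sub (t ξ : ℝ) (y z : ℝ × ℝ) : M.grp t ξ (y - z) = M.grp t ξ y - M.grp t ξ z := by
  ext <;> simp [grp] <;> ring

theorem norm_grp_le (t ξ : ℝ) (y : ℝ × ℝ) : ‖M.grp t ξ y‖ ≤ (1 + M.K) * ‖y‖ := by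
  have h1 := norm_fst_le y
  have h2 := norm_snd_le y
  rw [Real.norm_eq_abs] at h1 h2
  have hc := Real.abs_cos_le_one (M.freq ξ * t)
  have hs := Real.abs_sin_le_one (M.freq ξ * t)
  have hr := M.r_le ξ
  have hr' := M.inv_r_le ξ
  have hr0 := M.r_pos ξ
  have hK := M.K_pos
  have n := norm_nonneg y
  rw [Prod.norm_def]
  refine max_le ?_ ?_
  · rw [Real.norm_eq_abs]
    refine (abs_add_le _ _).trans ?_
    rw [abs_mul, abs_mul, abs_mul, abs_of_pos hr0]
    calc _ ≤ 1 * ‖y‖ + M.K * 1 * ‖y‖ := by gcongr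
      _ = _ := by ring
  · rw [Real.norm_eq_abs]
    refine (abs_add_le _ _).trans ?_
    rw [abs_mul, abs_neg, abs_mul, abs_mul, abs_of_pos (inv_pos.2 hr0)]
    calc _ ≤ M.K * 1 * ‖y‖ + 1 * ‖y‖ := by gcongr
      _ = _ := by ring

/-- The group is close to the identity while the phase is small; this keeps the initial bump in
place up to the time of inflation. -/
theorem norm_grp_sub_self_le (t ξ : ℝ) (y : ℝ × ℝ) :
    ‖M.grp t ξ y - y‖ ≤ (1 + M.K) * |M.freq ξ * t| * ‖y‖ := by
  have h1 := norm_fst_le y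
  have h2 := norm_snd_le y
  rw [Real.norm_eq_abs] at h1 h2
  have hc : |Real.cos (M.freq ξ * t) - 1| ≤ |M.freq ξ * t| := by
    have := Real.abs_cos_sub_cos_le (M.freq ξ * t) 0
    simpa using this
  have hs : |Real.sin (M.freq ξ * t)| ≤ |M.freq ξ * t| := Real.abs_sin_le_abs
  have hr := M.r_le ξ
  have hr' := M.inv_r_le ξ
  have hr0 := M.r_pos ξ
  have hK := M.K_pos
  have n := norm_nonneg y
  rw [Prod.norm_def]
  refine max_le ?_ ?_
  · rw [Real.norm_eq_abs]
    have e : (M.grp t ξ y - y).1 = (Real.cos (M.freq ξ * t) - 1) * y.1 +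
        M.r ξ * Real.sin (M.freq ξ * t) * y.2 := by simp [grp]; ring
    rw [e]
    refine (abs_add_le _ _).trans ?_
    rw [abs_mul, abs_mul, abs_mul, abs_of_pos hr0]
    calc _ ≤ |M.freq ξ * t| * ‖y‖ + M.K * |M.freq ξ * t| * ‖y‖ := by gcongr
      _ = _ := by ring
  · rw [Real.norm_eq_abs]
    have e : (M.grp t ξ y - y).2 = -((M.r ξ)⁻¹ * Real.sin (M.freq ξ * t)) * y.1 +
        (Real.cos (M.freq ξ * t) - 1) * y.2 := by simp [grp]; ring
    rw [e]
    refine (abs_add_le _ _).trans ?_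
    rw [abs_mul, abs_neg, abs_mul, abs_mul, abs_of_pos (inv_pos.2 hr0)]
    calc _ ≤ M.K * |M.freq ξ * t| * ‖y‖ + |M.freq ξ * t| * ‖y‖ := by gcongr
      _ = _ := by ring

theorem grp_neg_grp (t ξ : ℝ) (y : ℝ × ℝ) : M.grp t ξ (M.grp (-t) ξ y) = y := by
  have hr := (M.r_pos ξ).ne'
  have h := Real.sin_sq_add_cos_sq (M.freq ξ * t)
  ext
  · simp only [grp, mul_neg, Real.cos_neg, Real.sin_neg]
    field_simp
    linear_combination y.1 * h
  · simp only [grp, mul_neg, Real.cos_neg, Real.sin_neg]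
    field_simp
    linear_combination M.r ξ * y.2 * h

/-- `y` has an even first and an odd second component. -/
def HasParity (y : ℝ → ℝ × ℝ) : Prop := ∀ ξ, y (-ξ) = ((y ξ).1, -(y ξ).2)

theorem HasParity.grp {M : Model} {y : ℝ → ℝ × ℝ} (h : HasParity y) (t : ℝ) :
    HasParity (fun ξ => M.grp t ξ (y ξ)) := by
  intro ξ
  ext <;> (simp [Model.grp, h ξ, M.freq_neg, M.r_neg]; try ring)

theorem continuous_grp {X : Type*} [TopologicalSpace X] {t ξ : X → ℝ} {y : X → ℝ × ℝ}
    (ht : Continuous t) (hξ : Continuous ξ) (hy : Continuous y) :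
    Continuous fun x => M.grp (t x) (ξ x) (y x) := by
  have h1 := M.continuous_freq
  have h2 := M.continuous_r
  have h3 : Continuous fun x => (M.r (ξ x))⁻¹ :=
    (h2.comp hξ).inv₀ fun x => (M.r_pos _).ne'
  unfold grp
  fun_prop

/-- The bilinear form of the nonlinearity. -/
def nl (v w : ℝ → ℝ × ℝ) (ξ : ℝ) : ℝ × ℝ :=
  (M.b₁ ξ * rconv (fun ζ => (v ζ).2) (fun ζ => (w ζ).1) ξ,
    2⁻¹ * M.b₂ ξ * rconv (fun ζ => (v ζ).2) (fun ζ => (w ζ).2) ξ)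

theorem HasParity.nl {M : Model} {v w : ℝ → ℝ × ℝ} (hv : HasParity v) (hw : HasParity w) :
    HasParity (M.nl v w) := by
  intro ξ
  have hn : ∀ f g : ℝ → ℝ, rconv (fun ζ => -f ζ) g ξ = -rconv f g ξ := fun f g => by
    simp [rconv, integral_neg]
  have hn' : ∀ f g : ℝ → ℝ, rconv f (fun ζ => -g ζ) ξ = -rconv f g ξ := fun f g => by
    simp [rconv, integral_neg]
  ext
  · simp only [Model.nl, M.b₁_neg, rconv_neg]
    simp only [hv _, hw _, hn]
    ring
  · simp only [Model.nl, M.b₂_neg, rconv_neg]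
    simp only [hv _, hw _, hn, hn']
    ring

/-- The bounds on the nonlinear symbols at the frequency scale `N`. -/
def Scale (N P : ℝ) : Prop :=
  0 < N ∧ ∀ ξ, |M.b₁ ξ| ≤ P * (1 + |ξ| / N) ∧ |M.b₂ ξ| ≤ P * (1 + |ξ| / N)

section Scale

variable {M} {N P ρ F G : ℝ} {v v' w w' : ℝ → ℝ × ℝ}

theorem norm_nl_le (h : M.Scale N P) (hρ : 0 ≤ ρ) (hv : ∀ ζ, ‖v ζ‖ ≤ F * weight N ρ ζ)
    (hw : ∀ ζ, ‖w ζ‖ ≤ G * weight N ρ ζ) (ξ : ℝ) :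
    ‖M.nl v w ξ‖ ≤ P * (4 * Real.pi * N) * (F * G) * ((1 + |ξ| / N) * weight N ρ ξ) := by
  have h1 := abs_rconv_le h.1 hρ (fun ζ => (norm_snd_le (v ζ)).trans (hv ζ))
    (fun ζ => (norm_fst_le (w ζ)).trans (hw ζ)) ξ
  have h2 := abs_rconv_le h.1 hρ (fun ζ => (norm_snd_le (v ζ)).trans (hv ζ))
    (fun ζ => (norm_snd_le (w ζ)).trans (hw ζ)) ξ
  have hP : 0 ≤ P * (1 + |ξ| / N) := (abs_nonneg _).trans (h.2 ξ).1
  rw [Prod.norm_def]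
  refine max_le ?_ ?_
  · rw [nl, Real.norm_eq_abs, abs_mul]
    calc _ ≤ (P * (1 + |ξ| / N)) * (F * G * (4 * Real.pi * N) * weight N ρ ξ) :=
          mul_le_mul (h.2 ξ).1 h1 (abs_nonneg _) hP
      _ = _ := by ring
  · rw [nl, Real.norm_eq_abs, abs_mul, abs_mul]
    calc _ ≤ (1 * (P * (1 + |ξ| / N))) * (F * G * (4 * Real.pi * N) * weight N ρ ξ) := by
          refine mul_le_mul ?_ h2 (abs_nonneg _) (by rw [one_mul]; exact hP)
          refine mul_le_mul ?_ (h.2 ξ).2 (abs_nonneg _) zero_le_one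
          rw [abs_of_pos (by norm_num)]
          norm_num
      _ = _ := by ring

theorem nl_sub (h : M.Scale N P) (hρ : 0 ≤ ρ) (hv : Continuous v) (hw : Continuous w)
    (hF : ∀ ζ, ‖v ζ‖ ≤ F * weight N ρ ζ) (hG : ∀ ζ, ‖w ζ‖ ≤ G * weight N ρ ζ) (ξ : ℝ) :
    M.nl v v ξ - M.nl w w ξ =
      M.nl (fun ζ => v ζ - w ζ) v ξ + M.nl w (fun ζ => v ζ - w ζ) ξ := by
  have f1 : ∀ ζ, |(v ζ).1| ≤ F * weight N ρ ζ := fun ζ => (norm_fst_le (v ζ)).trans (hF ζ)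
  have f2 : ∀ ζ, |(v ζ).2| ≤ F * weight N ρ ζ := fun ζ => (norm_snd_le (v ζ)).trans (hF ζ)
  have g1 : ∀ ζ, |(w ζ).1| ≤ G * weight N ρ ζ := fun ζ => (norm_fst_le (w ζ)).trans (hG ζ)
  have g2 : ∀ ζ, |(w ζ).2| ≤ G * weight N ρ ζ := fun ζ => (norm_snd_le (w ζ)).trans (hG ζ)
  ext
  · simp only [nl, Prod.fst_sub, Prod.fst_add, Prod.snd_sub]
    rw [rconv_sub_left h.1 hρ (by fun_prop) (by fun_prop) (by fun_prop) f2 g2 f1,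
      rconv_sub_right h.1 hρ (by fun_prop) (by fun_prop) (by fun_prop) g2 f1 g1]
    ring
  · simp only [nl, Prod.snd_sub, Prod.snd_add]
    rw [rconv_sub_left h.1 hρ (by fun_prop) (by fun_prop) (by fun_prop) f2 g2 f2,
      rconv_sub_right h.1 hρ (by fun_prop) (by fun_prop) (by fun_prop) g2 f2 g2]
    ring

end Scale

end Model

/-! ### Cauchy–Kovalevskaya scale and the Duhamel fixed point. -/

theorem continuous_comp_pair {X E : Type*} [TopologicalSpace X] [TopologicalSpace E]
    {f : ℝ → ℝ → E} (h : Continuous fun p : ℝ × ℝ => f p.1 p.2) {a b : X → ℝ} (ha : Continuous a)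
    (hb : Continuous b) : Continuous fun x => f (a x) (b x) :=
  h.comp (ha.prodMk hb)

/-- The projection of the line onto `[0, T]`. -/
def clamp (T t : ℝ) : ℝ := max 0 (min t T)

theorem clamp_nonneg (T t : ℝ) : 0 ≤ clamp T t := le_max_left _ _

theorem clamp_le {T : ℝ} (hT : 0 ≤ T) (t : ℝ) : clamp T t ≤ T := max_le hT (min_le_right _ _)

theorem clamp_of_mem {T t : ℝ} (ht : t ∈ Icc 0 T) : clamp T t = t := by
  rw [clamp, min_eq_left ht.2, max_eq_right ht.1]

theorem continuous_clamp (T : ℝ) : Continuous (clamp T) := by unfold clamp; fun_prop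

/-- The rate of exponential decay on the Fourier side at time `t`. -/
def rate (T t : ℝ) : ℝ := 1 - clamp T t / (2 * T)

theorem half_le_rate {T : ℝ} (hT : 0 < T) (t : ℝ) : 1 / 2 ≤ rate T t := by
  have : clamp T t / (2 * T) ≤ 1 / 2 := by
    rw [div_le_iff₀ (by positivity)]
    linarith [clamp_le hT.le t]
  unfold rate
  linarith

theorem rate_le {T : ℝ} (hT : 0 < T) (t : ℝ) : rate T t ≤ 1 := by
  have := div_nonneg (clamp_nonneg T t) (by positivity : 0 ≤ 2 * T)
  unfold rate
  linarith

theorem rate_nonneg {T : ℝ} (hT : 0 < T) (t : ℝ) : 0 ≤ rate T t := by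
  linarith [half_le_rate hT t]

theorem continuous_weight_rate (N T : ℝ) :
    Continuous fun p : ℝ × ℝ => weight N (rate T p.1) p.2 := by
  have h1 := continuous_clamp T
  have h2 : Continuous (rate T) := by unfold rate; fun_prop
  unfold weight
  refine Continuous.div (by fun_prop) (by fun_prop) fun p => ?_
  positivity

/-- The shrinking rate recovers the symbol growth: with `z = 1 + |ξ|/N`, the function `z exp(-(1 -
s/(2T)) z)` is the derivative of `2T exp(-(1 - s/(2T)) z)`, so the integral up to time `t` costs
only a factor `2T` and no power of `z`. -/
theorem norm_integral_clamp_le {N T A ξ : ℝ} (hN : 0 < N) (hT : 0 < T) (t : ℝ) {q : ℝ → ℝ × ℝ}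
    (hA : 0 ≤ A) (hq : ∀ s, ‖q s‖ ≤ A * ((1 + |ξ| / N) * weight N (rate T s) ξ)) :
    ‖∫ s in (0 : ℝ)..clamp T t, q s‖ ≤ A * (2 * T) * weight N (rate T t) ξ := by
  set z : ℝ := 1 + |ξ| / N with hz
  have hz0 : 0 < z := by positivity
  set F : ℝ → ℝ := fun s => 2 * T * Real.exp (-((1 - s / (2 * T)) * z)) with hF
  have hd : ∀ s, HasDerivAt F (z * Real.exp (-((1 - s / (2 * T)) * z))) s := by
    intro s
    have h1 : HasDerivAt (fun s : ℝ => -((1 - s / (2 * T)) * z)) (z / (2 * T)) s := by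
      have := ((((hasDerivAt_id s).div_const (2 * T)).const_sub 1).mul_const z).neg
      refine this.congr_deriv ?_
      ring
    refine (h1.exp.const_mul (2 * T)).congr_deriv ?_
    field_simp
  have hc : Continuous fun s : ℝ => z * Real.exp (-((1 - s / (2 * T)) * z)) := by fun_prop
  have hint : ∫ s in (0 : ℝ)..clamp T t, z * Real.exp (-((1 - s / (2 * T)) * z)) ≤
      2 * T * Real.exp (-(rate T t * z)) := by
    rw [intervalIntegral.integral_eq_sub_of_hasDerivAt (fun s _ => hd s)
      (hc.intervalIntegrable _ _)]
    simp only [hF, rate]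
    have : 0 ≤ 2 * T * Real.exp (-((1 - 0 / (2 * T)) * z)) := by positivity
    linarith
  have hD : (0 : ℝ) < 1 + (ξ / N) ^ 2 := by positivity
  calc ‖∫ s in (0 : ℝ)..clamp T t, q s‖
      ≤ ∫ s in (0 : ℝ)..clamp T t,
        A / (1 + (ξ / N) ^ 2) * (z * Real.exp (-((1 - s / (2 * T)) * z))) := by
        refine intervalIntegral.norm_integral_le_of_norm_le (clamp_nonneg T t)
          (Eventually.of_forall fun s hs => ?_) ((hc.const_mul _).intervalIntegrable _ _)
        refine (hq s).trans (le_of_eq ?_)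
        have : rate T s = 1 - s / (2 * T) := by
          rw [rate, clamp_of_mem ⟨hs.1.le, hs.2.trans (clamp_le hT.le t)⟩]
        rw [weight, this]
        ring
    _ = A / (1 + (ξ / N) ^ 2) * ∫ s in (0 : ℝ)..clamp T t,
        (z * Real.exp (-((1 - s / (2 * T)) * z))) := intervalIntegral.integral_const_mul _ _
    _ ≤ A / (1 + (ξ / N) ^ 2) * (2 * T * Real.exp (-(rate T t * z))) := by gcongr
    _ = _ := by rw [weight]; ring

namespace Model

variable (M : Model) (N T : ℝ)

local notation "X" => BoundedContinuousFunction (ℝ × ℝ) (ℝ × ℝ)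

/-- The profile with the normalized profile `g`. -/
def prof (g : X) (t ξ : ℝ) : ℝ × ℝ := weight N (rate T t) ξ • g (t, ξ)

/-- The state with the normalized profile `g`. -/
def vel (g : X) (t ξ : ℝ) : ℝ × ℝ := M.grp t ξ (prof N T g t ξ)

/-- The time derivative of the profile. -/
def force (g : X) (t ξ : ℝ) : ℝ × ℝ := M.grp (-t) ξ (M.nl (M.vel N T g t) (M.vel N T g t) ξ)

variable {M N T} {P : ℝ}

theorem norm_prof_le (g : X) (t ξ : ℝ) : ‖prof N T g t ξ‖ ≤ ‖g‖ * weight N (rate T t) ξ := by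
  rw [prof, norm_smul, Real.norm_of_nonneg (weight_pos _ _ _).le, mul_comm]
  exact mul_le_mul_of_nonneg_right (g.norm_coe_le_norm _) (weight_pos _ _ _).le

theorem norm_vel_le (g : X) (t ξ : ℝ) :
    ‖M.vel N T g t ξ‖ ≤ (1 + M.K) * ‖g‖ * weight N (rate T t) ξ := by
  have hK := M.K_pos
  refine (M.norm_grp_le _ _ _).trans ?_
  rw [mul_assoc]
  exact mul_le_mul_of_nonneg_left (norm_prof_le g t ξ) (by positivity)

theorem vel_sub (g g' : X) (t ξ : ℝ) :
    M.vel N T (g - g') t ξ = M.vel N T g t ξ - M.vel N T g' t ξ := by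
  simp only [vel, prof, ← grp_sub, ← smul_sub]
  rfl

theorem continuous_vel (g : X) : Continuous fun p : ℝ × ℝ => M.vel N T g p.1 p.2 := by
  refine M.continuous_grp continuous_fst continuous_snd ?_
  exact (continuous_weight_rate N T).smul g.continuous

theorem continuous_vel_right (g : X) (t : ℝ) : Continuous (M.vel N T g t) :=
  continuous_comp_pair (f := M.vel N T g) (continuous_vel g) continuous_const continuous_id

theorem continuous_nl_vel (hN : 0 < N) (hT : 0 < T) (g : X) :
    Continuous fun p : ℝ × ℝ => M.nl (M.vel N T g p.1) (M.vel N T g p.1) p.2 := by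
  have hK := M.K_pos
  have hv : Continuous fun p : (ℝ × ℝ) × ℝ => M.vel N T g p.1.1 p.2 :=
    continuous_comp_pair (f := M.vel N T g) (continuous_vel g) (by fun_prop) (by fun_prop)
  have hw : ∀ t ζ, weight N (rate T t) ζ ≤ (1 + (ζ / N) ^ 2)⁻¹ := fun t ζ =>
    weight_le hN (rate_nonneg hT t) ζ
  have hA : ∀ t ζ, ‖M.vel N T g t ζ‖ ≤ (1 + M.K) * ‖g‖ * (1 + (ζ / N) ^ 2)⁻¹ := fun t ζ =>
    (norm_vel_le g t ζ).trans (mul_le_mul_of_nonneg_left (hw t ζ) (by positivity))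
  have hB : ∀ t ζ, ‖M.vel N T g t ζ‖ ≤ (1 + M.K) * ‖g‖ := fun t ζ => by
    refine (hA t ζ).trans (mul_le_of_le_one_right (by positivity) (inv_le_one_of_one_le₀ ?_))
    have := sq_nonneg (ζ / N)
    linarith
  have h1 := M.continuous_b₁
  have h2 := M.continuous_b₂
  have c1 : Continuous fun p : ℝ × ℝ => rconv (fun ζ => (M.vel N T g p.1 ζ).2)
      (fun ζ => (M.vel N T g p.1 ζ).1) p.2 :=
    continuous_rconv_param hN hv.snd hv.fst continuous_snd
      (fun p ζ => (norm_snd_le _).trans (hA p.1 ζ)) (fun p ζ => (norm_fst_le _).trans (hB p.1 ζ))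
  have c2 : Continuous fun p : ℝ × ℝ => rconv (fun ζ => (M.vel N T g p.1 ζ).2)
      (fun ζ => (M.vel N T g p.1 ζ).2) p.2 :=
    continuous_rconv_param hN hv.snd hv.snd continuous_snd
      (fun p ζ => (norm_snd_le _).trans (hA p.1 ζ)) (fun p ζ => (norm_snd_le _).trans (hB p.1 ζ))
  unfold nl
  fun_prop

theorem continuous_force (hN : 0 < N) (hT : 0 < T) (g : X) :
    Continuous fun p : ℝ × ℝ => M.force N T g p.1 p.2 :=
  M.continuous_grp continuous_fst.neg continuous_snd (continuous_nl_vel hN hT g)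

theorem continuous_force_left (hN : 0 < N) (hT : 0 < T) (g : X) (ξ : ℝ) :
    Continuous fun t => M.force N T g t ξ :=
  continuous_comp_pair (f := M.force N T g) (continuous_force hN hT g) continuous_id
    continuous_const

/-- The constant in the bilinear estimate. -/
def gain (M : Model) (N T P : ℝ) : ℝ := (1 + M.K) ^ 3 * (P * (4 * Real.pi * N)) * (2 * T)

theorem norm_grp_nl_le (h : M.Scale N P) (hT : 0 < T) {v w : ℝ → ℝ × ℝ} {F G t : ℝ}
    (hv : ∀ ζ, ‖v ζ‖ ≤ (1 + M.K) * F * weight N (rate T t) ζ)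
    (hw : ∀ ζ, ‖w ζ‖ ≤ (1 + M.K) * G * weight N (rate T t) ζ) (s ξ : ℝ) :
    ‖M.grp s ξ (M.nl v w ξ)‖ ≤ ((1 + M.K) ^ 3 * (P * (4 * Real.pi * N))) * (F * G) *
      ((1 + |ξ| / N) * weight N (rate T t) ξ) := by
  have hK := M.K_pos
  refine (M.norm_grp_le _ _ _).trans ?_
  calc _ ≤ (1 + M.K) * (P * (4 * Real.pi * N) * ((1 + M.K) * F * ((1 + M.K) * G)) *
        ((1 + |ξ| / N) * weight N (rate T t) ξ)) :=
        mul_le_mul_of_nonneg_left (norm_nl_le h (rate_nonneg hT t) hv hw ξ) (by positivity)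
    _ = _ := by ring

theorem norm_force_le (h : M.Scale N P) (hT : 0 < T) (g : X) (t ξ : ℝ) :
    ‖M.force N T g t ξ‖ ≤ ((1 + M.K) ^ 3 * (P * (4 * Real.pi * N))) * (‖g‖ * ‖g‖) *
      ((1 + |ξ| / N) * weight N (rate T t) ξ) :=
  norm_grp_nl_le h hT (norm_vel_le g t) (norm_vel_le g t) _ _

theorem norm_force_sub_le (h : M.Scale N P) (hT : 0 < T) (g g' : X) (t ξ : ℝ) :
    ‖M.force N T g t ξ - M.force N T g' t ξ‖ ≤
      ((1 + M.K) ^ 3 * (P * (4 * Real.pi * N))) * ((‖g‖ + ‖g'‖) * ‖g - g'‖) *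
      ((1 + |ξ| / N) * weight N (rate T t) ξ) := by
  have e : (fun ζ => M.vel N T g t ζ - M.vel N T g' t ζ) = M.vel N T (g - g') t := by
    ext1 ζ
    rw [vel_sub]
  have e2 : M.force N T g t ξ - M.force N T g' t ξ =
      M.grp (-t) ξ (M.nl (M.vel N T (g - g') t) (M.vel N T g t) ξ) +
      M.grp (-t) ξ (M.nl (M.vel N T g' t) (M.vel N T (g - g') t) ξ) := by
    rw [force, force, ← grp_sub, nl_sub h (rate_nonneg hT t) (continuous_vel_right g t)
      (continuous_vel_right g' t) (norm_vel_le g t) (norm_vel_le g' t), e, ← sub_neg_eq_add,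
      grp_sub, sub_eq_add_neg]
    congr 1
    ext <;> simp [grp] <;> ring
  rw [e2]
  refine (norm_add_le _ _).trans ((add_le_add
    (norm_grp_nl_le h hT (norm_vel_le (g - g') t) (norm_vel_le g t) _ _)
    (norm_grp_nl_le h hT (norm_vel_le g' t) (norm_vel_le (g - g') t) _ _)).trans (le_of_eq ?_))
  ring

theorem scale_P_nonneg (h : M.Scale N P) : 0 ≤ P := by
  have := (abs_nonneg _).trans (h.2 0).1
  simpa using this

theorem gain_nonneg (h : M.Scale N P) (hT : 0 < T) : 0 ≤ M.gain N T P := by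
  have hK := M.K_pos
  have := scale_P_nonneg h
  have := h.1
  unfold gain
  positivity

theorem norm_integral_force_le (h : M.Scale N P) (hT : 0 < T) (g : X) (t ξ : ℝ) :
    ‖∫ s in (0 : ℝ)..clamp T t, M.force N T g s ξ‖ ≤
      M.gain N T P * (‖g‖ * ‖g‖) * weight N (rate T t) ξ := by
  have hK := M.K_pos
  have := scale_P_nonneg h
  have := h.1
  refine (norm_integral_clamp_le h.1 hT t (by positivity)
    (fun s => norm_force_le h hT g s ξ)).trans (le_of_eq ?_)
  rw [gain]
  ring

theorem norm_integral_force_sub_le (h : M.Scale N P) (hT : 0 < T) (g g' : X) (t ξ : ℝ) :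
    ‖(∫ s in (0 : ℝ)..clamp T t, M.force N T g s ξ) -
      ∫ s in (0 : ℝ)..clamp T t, M.force N T g' s ξ‖ ≤
      M.gain N T P * ((‖g‖ + ‖g'‖) * ‖g - g'‖) * weight N (rate T t) ξ := by
  have hK := M.K_pos
  have := scale_P_nonneg h
  have hN := h.1
  rw [← intervalIntegral.integral_sub
    ((continuous_force_left hN hT g ξ).intervalIntegrable _ _)
    ((continuous_force_left hN hT g' ξ).intervalIntegrable _ _)]
  refine (norm_integral_clamp_le h.1 hT t (by positivity)
    (fun s => norm_force_sub_le h hT g g' s ξ)).trans (le_of_eq ?_)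
  rw [gain]
  ring

/-- The right-hand side of the Duhamel formula for the profile. -/
def duhamel (M : Model) (N T : ℝ) (y₀ : ℝ → ℝ × ℝ) (g : X) (t ξ : ℝ) : ℝ × ℝ :=
  y₀ ξ + ∫ s in (0 : ℝ)..clamp T t, M.force N T g s ξ

theorem continuous_duhamel (hN : 0 < N) (hT : 0 < T) {y₀ : ℝ → ℝ × ℝ} (hy : Continuous y₀)
    (g : X) : Continuous fun p : ℝ × ℝ => M.duhamel N T y₀ g p.1 p.2 := by
  have h := continuous_force (M := M) hN hT g
  have h1 := intervalIntegral.continuous_parametric_intervalIntegral_of_continuous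
    (μ := volume) (a₀ := 0) (f := fun (p : ℝ × ℝ) (s : ℝ) => M.force N T g s p.2)
    (s := fun p : ℝ × ℝ => clamp T p.1)
    (continuous_comp_pair (f := M.force N T g) h (a := fun p : (ℝ × ℝ) × ℝ => p.2)
      (b := fun p : (ℝ × ℝ) × ℝ => p.1.2) (by fun_prop) (by fun_prop))
    ((continuous_clamp T).comp continuous_fst)
  exact (hy.comp continuous_snd).add h1

theorem norm_duhamel_le (h : M.Scale N P) (hT : 0 < T) {y₀ : ℝ → ℝ × ℝ} {A : ℝ} (hA : 0 ≤ A)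
    (hy : ∀ ξ, ‖y₀ ξ‖ ≤ A * weight N 1 ξ) (g : X) (t ξ : ℝ) :
    ‖M.duhamel N T y₀ g t ξ‖ ≤ (A + M.gain N T P * (‖g‖ * ‖g‖)) * weight N (rate T t) ξ := by
  rw [add_mul]
  exact (norm_add_le _ _).trans (add_le_add
    ((hy ξ).trans (mul_le_mul_of_nonneg_left (weight_anti h.1 (rate_le hT t) ξ) hA))
    (norm_integral_force_le h hT g t ξ))

theorem hasParity_duhamel {y₀ : ℝ → ℝ × ℝ} (hy : HasParity y₀) {g : X}
    (hN : 0 < N) (hT : 0 < T) (hg : ∀ t, HasParity fun ξ => g (t, ξ)) (t : ℝ) :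
    HasParity (M.duhamel N T y₀ g t) := by
  have hv : ∀ s, HasParity (M.vel N T g s) := fun s => by
    refine HasParity.grp (M := M) (y := prof N T g s) (fun ξ => ?_) s
    have := hg s ξ
    beta_reduce at this
    rw [prof, prof, weight_neg, this]
    ext <;> simp
  have hf : ∀ s, HasParity (M.force N T g s) := fun s =>
    ((hv s).nl (M := M) (hv s)).grp (M := M) (-s)
  intro ξ
  have hi : ∀ ξ, IntervalIntegrable (fun s => M.force N T g s ξ) volume 0 (clamp T t) := fun ξ =>
    (continuous_force_left hN hT g ξ).intervalIntegrable _ _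
  have e : ∀ ξ, ∫ s in (0 : ℝ)..clamp T t, M.force N T g s ξ =
      (∫ s in (0 : ℝ)..clamp T t, (M.force N T g s ξ).1,
        ∫ s in (0 : ℝ)..clamp T t, (M.force N T g s ξ).2) := fun ξ => by
    ext
    · exact ((ContinuousLinearMap.fst ℝ ℝ ℝ).intervalIntegral_comp_comm (hi ξ)).symm
    · exact ((ContinuousLinearMap.snd ℝ ℝ ℝ).intervalIntegral_comp_comm (hi ξ)).symm
  rw [duhamel, duhamel, e, e, hy ξ]
  simp only [hf _ ξ, intervalIntegral.integral_neg]
  ext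
  · simp
  · simp
    ring

/-- The Duhamel map on normalized profiles. -/
def duhamelMap (h : M.Scale N P) (hT : 0 < T) {y₀ : ℝ → ℝ × ℝ} (hyc : Continuous y₀) {A : ℝ}
    (hA : 0 ≤ A) (hy : ∀ ξ, ‖y₀ ξ‖ ≤ A * weight N 1 ξ) (g : X) : X :=
  BoundedContinuousFunction.ofNormedAddCommGroup
    (fun p => (weight N (rate T p.1) p.2)⁻¹ • M.duhamel N T y₀ g p.1 p.2)
    (((continuous_weight_rate N T).inv₀ fun p => (weight_pos _ _ _).ne').smul
      (continuous_duhamel h.1 hT hyc g))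
    (A + M.gain N T P * (‖g‖ * ‖g‖)) (fun p => by
      rw [norm_smul, norm_inv, Real.norm_of_nonneg (weight_pos _ _ _).le,
        inv_mul_le_iff₀ (weight_pos _ _ _), mul_comm (weight _ _ _)]
      exact norm_duhamel_le h hT hA hy g p.1 p.2)

/-- Banach's theorem on the ball of radius `2A`. The parity condition is closed and preserved, so it
is built into the complete set and holds for the fixed point. -/
theorem exists_fixedPoint (h : M.Scale N P) (hT : 0 < T) {y₀ : ℝ → ℝ × ℝ} (hyc : Continuous y₀)
    {A : ℝ} (hA : 0 ≤ A) (hy : ∀ ξ, ‖y₀ ξ‖ ≤ A * weight N 1 ξ) (hpar : HasParity y₀)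
    (hsmall : 8 * M.gain N T P * A ≤ 1) :
    ∃ g : X, ‖g‖ ≤ 2 * A ∧ (∀ t, HasParity fun ξ => g (t, ξ)) ∧
      ∀ t ξ, prof N T g t ξ = M.duhamel N T y₀ g t ξ := by
  have hΓ := gain_nonneg h hT
  set Ψ := M.duhamelMap h hT hyc hA hy with hΨ
  set S : Set X := {g | ‖g‖ ≤ 2 * A ∧ ∀ t, HasParity fun ξ => g (t, ξ)} with hS
  have hclosed : IsClosed S := by
    refine IsClosed.inter (isClosed_le continuous_norm continuous_const) ?_
    have hev : ∀ p : ℝ × ℝ, Continuous fun g : X => g p := fun p =>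
      (continuous_apply p).comp BoundedContinuousFunction.continuous_coe
    have : {g : X | ∀ t, HasParity fun ξ => g (t, ξ)} =
        ⋂ t : ℝ, ⋂ ξ : ℝ, {g : X | g (t, -ξ) = ((g (t, ξ)).1, -(g (t, ξ)).2)} := by
      ext g
      simp [HasParity]
    change IsClosed {g : X | ∀ t, HasParity fun ξ => g (t, ξ)}
    rw [this]
    refine isClosed_iInter fun t => isClosed_iInter fun ξ => isClosed_eq (hev _) ?_
    exact (continuous_fst.comp (hev _)).prodMk (continuous_snd.comp (hev _)).neg
  have hmaps : MapsTo Ψ S S := by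
    intro g hg
    refine ⟨?_, fun t ξ => ?_⟩
    -- From `8 · gain · A ≤ 1` the quadratic term is at most `gain · 4A² ≤ A/2`, so the ball is
    -- preserved; the same inequality gives the Lipschitz constant `4 · gain · A ≤ 1/2`.
    · refine (BoundedContinuousFunction.norm_ofNormedAddCommGroup_le _
        (by positivity) _).trans ?_
      have h1 : ‖g‖ * ‖g‖ ≤ (2 * A) * (2 * A) :=
        mul_le_mul hg.1 hg.1 (norm_nonneg _) (by positivity)
      nlinarith [mul_le_mul_of_nonneg_left h1 hΓ, mul_le_mul_of_nonneg_right hsmall hA]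
    · have := hasParity_duhamel (M := M) hpar h.1 hT hg.2 t ξ
      change (weight N (rate T t) (-ξ))⁻¹ • M.duhamel N T y₀ g t (-ξ) =
        (((weight N (rate T t) ξ)⁻¹ • M.duhamel N T y₀ g t ξ).1,
          -((weight N (rate T t) ξ)⁻¹ • M.duhamel N T y₀ g t ξ).2)
      rw [this, weight_neg]
      ext <;> simp
  have hcontr : ContractingWith (1 / 2) (hmaps.restrict Ψ S S) := by
    refine ⟨by norm_num, LipschitzWith.of_dist_le_mul fun g g' => ?_⟩
    change dist (Ψ g) (Ψ g') ≤ _ * dist (g : X) (g' : X)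
    rw [dist_eq_norm, dist_eq_norm]
    refine (BoundedContinuousFunction.norm_le (by positivity)).2 fun p => ?_
    change ‖(weight N (rate T p.1) p.2)⁻¹ • M.duhamel N T y₀ g p.1 p.2 -
      (weight N (rate T p.1) p.2)⁻¹ • M.duhamel N T y₀ g' p.1 p.2‖ ≤ _
    rw [← smul_sub, norm_smul, norm_inv, Real.norm_of_nonneg (weight_pos _ _ _).le,
      inv_mul_le_iff₀ (weight_pos _ _ _), mul_comm (weight _ _ _), duhamel, duhamel,
      add_sub_add_left_eq_sub]
    refine (norm_integral_force_sub_le h hT _ _ _ _).trans ?_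
    refine mul_le_mul_of_nonneg_right ?_ (weight_pos _ _ _).le
    have h1 : ‖(g : X)‖ + ‖(g' : X)‖ ≤ 4 * A := by linarith [g.2.1, g'.2.1]
    calc M.gain N T P * ((‖(g : X)‖ + ‖(g' : X)‖) * ‖(g : X) - g'‖)
        ≤ M.gain N T P * ((4 * A) * ‖(g : X) - g'‖) := by gcongr
      _ = (4 * M.gain N T P * A) * ‖(g : X) - g'‖ := by ring
      _ ≤ (1 / 2) * ‖(g : X) - g'‖ := by
          gcongr
          linarith
      _ = _ := by simp
  have h0 : (0 : X) ∈ S := ⟨by simpa using hA, fun t ξ => by ext <;> simp⟩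
  obtain ⟨g, hgS, hfix, -⟩ := hcontr.exists_fixedPoint' hclosed.isComplete hmaps h0
    (edist_ne_top _ _)
  refine ⟨g, hgS.1, hgS.2, fun t ξ => ?_⟩
  have e : g (t, ξ) = (weight N (rate T t) ξ)⁻¹ • M.duhamel N T y₀ g t ξ :=
    congrArg (fun f : X => f (t, ξ)) hfix.symm
  rw [prof, e, smul_inv_smul₀ (weight_pos _ _ _).ne']

end Model

/-! ### From the fixed point to a smooth solution of the system. -/

namespace Model

variable {M : Model} {N T P A : ℝ}

/-- A solution of the system on the Fourier side, in the unknowns `v = (H, U)`. -/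
structure IsSpectralSolution (M : Model) (T : ℝ) (v : ℝ → ℝ → ℝ × ℝ) : Prop where
  continuous : Continuous fun p : ℝ × ℝ => v p.1 p.2
  continuous_nl : Continuous fun p : ℝ × ℝ => M.nl (v p.1) (v p.1) p.2
  parity : ∀ t, HasParity (v t)
  hasDerivWithinAt : ∀ t ∈ Icc 0 T, ∀ ξ, HasDerivWithinAt (fun τ => v τ ξ)
    (M.freq ξ * M.r ξ * (v t ξ).2 + (M.nl (v t) (v t) ξ).1,
      -(M.freq ξ * (M.r ξ)⁻¹) * (v t ξ).1 + (M.nl (v t) (v t) ξ).2) (Icc 0 T) t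

/-- Variation of constants: conjugation by the group turns the equation for the profile into the
full equation. -/
theorem hasDerivWithinAt_grp {y : ℝ → ℝ × ℝ} {f : ℝ × ℝ} {S : Set ℝ} {t : ℝ} (ξ : ℝ)
    (hy : HasDerivWithinAt y (M.grp (-t) ξ f) S t) :
    HasDerivWithinAt (fun τ => M.grp τ ξ (y τ))
      (M.freq ξ * M.r ξ * (M.grp t ξ (y t)).2 + f.1,
        -(M.freq ξ * (M.r ξ)⁻¹) * (M.grp t ξ (y t)).1 + f.2) S t := by
  have hr := (M.r_pos ξ).ne'
  have y1 : HasDerivWithinAt (fun τ => (y τ).1) (M.grp (-t) ξ f).1 S t :=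
    (ContinuousLinearMap.fst ℝ ℝ ℝ).hasFDerivAt.comp_hasDerivWithinAt t hy
  have y2 : HasDerivWithinAt (fun τ => (y τ).2) (M.grp (-t) ξ f).2 S t :=
    (ContinuousLinearMap.snd ℝ ℝ ℝ).hasFDerivAt.comp_hasDerivWithinAt t hy
  have hl : HasDerivWithinAt (fun τ => M.freq ξ * τ) (M.freq ξ) S t := by
    simpa using (hasDerivWithinAt_id t S).const_mul (M.freq ξ)
  have hc := hl.cos
  have hs := hl.sin
  have hf := M.grp_neg_grp t ξ f
  have hf1 := congrArg Prod.fst hf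
  have hf2 := congrArg Prod.snd hf
  simp only [grp] at hf1 hf2 y1 y2 ⊢
  refine HasDerivWithinAt.prodMk ?_ ?_
  · refine ((hc.mul y1).add ((hs.const_mul (M.r ξ)).mul y2)).congr_deriv ?_
    linear_combination hf1 + M.freq ξ * Real.sin (M.freq ξ * t) * (y t).1 * mul_inv_cancel₀ hr
  · refine (((hs.const_mul (M.r ξ)⁻¹).neg.mul y1).add (hc.mul y2)).congr_deriv ?_
    simp only [Pi.neg_apply]
    linear_combination hf2 + M.freq ξ * Real.sin (M.freq ξ * t) * (y t).2 * mul_inv_cancel₀ hr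

/-- The deviation from the data splits into the Duhamel integral, quadratic in `A`, and the drift of
the linear flow on the data. -/
theorem exists_isSpectralSolution (h : M.Scale N P) (hT : 0 < T) {y₀ : ℝ → ℝ × ℝ}
    (hyc : Continuous y₀) (hA : 0 ≤ A) (hy : ∀ ξ, ‖y₀ ξ‖ ≤ A * weight N 1 ξ)
    (hpar : HasParity y₀) (hsmall : 8 * M.gain N T P * A ≤ 1) :
    ∃ v : ℝ → ℝ → ℝ × ℝ, M.IsSpectralSolution T v ∧ v 0 = y₀ ∧
      (∀ t ξ, ‖v t ξ‖ ≤ (1 + M.K) * (2 * A) * weight N (rate T t) ξ) ∧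
      ∀ t ξ, ‖v t ξ - y₀ ξ‖ ≤ (1 + M.K) * (M.gain N T P * (4 * A ^ 2)) * weight N (rate T t) ξ +
        (1 + M.K) * |M.freq ξ * t| * ‖y₀ ξ‖ := by
  obtain ⟨g, hg, hgpar, hfix⟩ := exists_fixedPoint h hT hyc hA hy hpar hsmall
  have hK := M.K_pos
  have hpv : ∀ t, HasParity (prof N T g t) := fun t ξ => by
    have := hgpar t ξ
    beta_reduce at this
    rw [prof, prof, weight_neg, this]
    ext <;> simp
  refine ⟨M.vel N T g, ⟨continuous_vel g, continuous_nl_vel h.1 hT g,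
    fun t => (hpv t).grp (M := M) t, fun t ht ξ => ?_⟩, ?_, fun t ξ => ?_, fun t ξ => ?_⟩
  · refine hasDerivWithinAt_grp ξ (y := fun τ => prof N T g τ ξ) ?_
    have hc := continuous_force_left (M := M) h.1 hT g ξ
    have h1 : HasDerivAt (fun τ => y₀ ξ + ∫ s in (0 : ℝ)..τ, M.force N T g s ξ)
        (M.force N T g t ξ) t :=
      (intervalIntegral.integral_hasDerivAt_right (hc.intervalIntegrable _ _)
        hc.aestronglyMeasurable.stronglyMeasurableAtFilter hc.continuousAt).const_add _
    refine h1.hasDerivWithinAt.congr_of_mem (fun τ hτ => ?_) ht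
    rw [hfix, duhamel, clamp_of_mem hτ]
  · ext1 ξ
    have h0 : prof N T g 0 ξ = y₀ ξ := by
      rw [hfix, duhamel, clamp_of_mem (left_mem_Icc.2 hT.le), intervalIntegral.integral_same,
        add_zero]
    rw [vel, h0]
    ext <;> simp [grp]
  · refine (norm_vel_le g t ξ).trans ?_
    have := (weight_pos N (rate T t) ξ).le
    gcongr
  · have e : M.vel N T g t ξ - y₀ ξ = M.grp t ξ (prof N T g t ξ - y₀ ξ) +
        (M.grp t ξ (y₀ ξ) - y₀ ξ) := by
      rw [grp_sub, vel]
      abel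
    rw [e]
    refine (norm_add_le _ _).trans (add_le_add ?_ (M.norm_grp_sub_self_le t ξ _))
    refine (M.norm_grp_le _ _ _).trans ?_
    rw [hfix, duhamel, add_sub_cancel_left, mul_assoc]
    refine mul_le_mul_of_nonneg_left ((norm_integral_force_le h hT g t ξ).trans ?_) (by positivity)
    have h1 : ‖g‖ * ‖g‖ ≤ 4 * A ^ 2 :=
      (mul_le_mul hg hg (norm_nonneg _) (by positivity)).trans (le_of_eq (by ring))
    exact mul_le_mul_of_nonneg_right (mul_le_mul_of_nonneg_left h1 (gain_nonneg h hT))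
      (weight_pos _ _ _).le

/-- The symbols of `M` are those of the system with the parameters `a, b, c, d`. -/
structure Represents (M : Model) (a b c d : ℝ) : Prop where
  eq_freq_mul : ∀ ξ, (1 + b * (2 * Real.pi * ξ) ^ 2) * (M.freq ξ * M.r ξ) =
    2 * Real.pi * ξ * (1 - a * (2 * Real.pi * ξ) ^ 2)
  eq_freq_div : ∀ ξ, (1 + d * (2 * Real.pi * ξ) ^ 2) * (M.freq ξ * (M.r ξ)⁻¹) =
    2 * Real.pi * ξ * (1 - c * (2 * Real.pi * ξ) ^ 2)
  eq_b₁ : ∀ ξ, (1 + b * (2 * Real.pi * ξ) ^ 2) * M.b₁ ξ = 2 * Real.pi * ξ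
  eq_b₂ : ∀ ξ, (1 + d * (2 * Real.pi * ξ) ^ 2) * M.b₂ ξ = 2 * Real.pi * ξ
  growth : ∃ C : ℝ, ∀ ξ, |M.freq ξ| ≤ C * (1 + |ξ|) ^ 3

end Model

/-- The constant is uniform in `ρ ≥ 1/2`, hence in time along the decreasing rate. -/
theorem exists_pow_mul_weight_le {N : ℝ} (hN : 0 < N) (k : ℕ) :
    ∃ C, ∀ ρ, 1 / 2 ≤ ρ → ∀ ξ, (1 + |ξ|) ^ k * weight N ρ ξ ≤ C := by
  refine ⟨(2 * N) ^ k * k.factorial * Real.exp (1 / (2 * N)), fun ρ hρ ξ => ?_⟩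
  have h1 : weight N ρ ξ ≤ Real.exp (-(|ξ| / (2 * N))) := by
    unfold weight
    refine (div_le_self (Real.exp_pos _).le ?_).trans (Real.exp_le_exp.2 (neg_le_neg ?_))
    · have := sq_nonneg (ξ / N)
      linarith
    · have h2 : 0 ≤ |ξ| / N := by positivity
      have h3 : |ξ| / (2 * N) = 1 / 2 * (|ξ| / N) := by field_simp
      rw [h3]
      nlinarith
  have h2 := Real.pow_div_factorial_le_exp ((1 + |ξ|) / (2 * N)) (by positivity) k
  rw [div_le_iff₀ (by positivity), div_pow, div_le_iff₀ (by positivity)] at h2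
  have h0 := (weight_pos N ρ ξ).le
  calc (1 + |ξ|) ^ k * weight N ρ ξ
      ≤ (Real.exp ((1 + |ξ|) / (2 * N)) * k.factorial * (2 * N) ^ k) *
        Real.exp (-(|ξ| / (2 * N))) := by gcongr
    _ = (2 * N) ^ k * k.factorial *
        (Real.exp ((1 + |ξ|) / (2 * N)) * Real.exp (-(|ξ| / (2 * N)))) := by ring
    _ = _ := by
      rw [← Real.exp_add]
      congr 2
      ring

/-- An equation of the system, read off from the symbols. -/
theorem IsSpectral.synth_equation {G W C : ℝ → ℂ} (hG : IsSpectral G) (hW : IsSpectral W)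
    (hC : IsSpectral C) (a b k : ℝ)
    (h : ∀ ξ, G ξ + (-b : ℝ) * (Boussinesq.dsym ξ ^ 2 * G ξ) + Boussinesq.dsym ξ *
      ((a : ℝ) * (Boussinesq.dsym ξ ^ 2 * W ξ) + W ξ + (k : ℝ) * C ξ) = 0) (x : ℝ) :
    (synth G x - b * iteratedDeriv 2 (synth G) x) +
      deriv (fun y => a * iteratedDeriv 2 (synth W) y + synth W y + k * synth C y) x = 0 := by
  have hG2 := (hG.dsym_pow 2).smul (-b)
  have hW2 := (hW.dsym_pow 2).smul a
  have hC2 := hC.smul k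
  have hS := (hW2.add hW).add hC2
  have e : (fun y => a * iteratedDeriv 2 (synth W) y + synth W y + k * synth C y) =
      synth fun ξ => (a : ℝ) * (Boussinesq.dsym ξ ^ 2 * W ξ) + W ξ + (k : ℝ) * C ξ := by
    funext y
    rw [(hW2.add hW).synth_add hC2, hW2.synth_add hW, (hW.dsym_pow 2).synth_smul,
      hC.synth_smul, hW.iteratedDeriv_synth]
  have e2 := (hG.add hG2).synth_add hS.dsym x
  rw [e, hS.deriv_synth, hG.iteratedDeriv_synth]
  rw [hG.synth_add hG2, (hG.dsym_pow 2).synth_smul] at e2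
  have e3 : synth (fun ξ => G ξ + (-b : ℝ) * (Boussinesq.dsym ξ ^ 2 * G ξ) + Boussinesq.dsym ξ *
      ((a : ℝ) * (Boussinesq.dsym ξ ^ 2 * W ξ) + W ξ + (k : ℝ) * C ξ)) x = 0 := by
    rw [funext h, synth, Real.fourierInv_eq]
    simp
  rw [e3] at e2
  linarith

/-- The Fourier transform of the first component of the solution. -/
def etaHat (v : ℝ → ℝ × ℝ) (ξ : ℝ) : ℂ := ((v ξ).1 : ℂ)

/-- The Fourier transform of the second component of the solution. -/
def uHat (v : ℝ → ℝ × ℝ) (ξ : ℝ) : ℂ := Complex.I * ((v ξ).2 : ℂ)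

theorem isSpectral_etaHat {v : ℝ → ℝ × ℝ} (hc : Continuous v) (hp : Model.HasParity v)
    (hd : ∀ k : ℕ, ∃ C, ∀ ξ, (1 + |ξ|) ^ k * ‖v ξ‖ ≤ C) : IsSpectral (etaHat v) where
  cont := by unfold etaHat; fun_prop
  decay k := by
    obtain ⟨C, hC⟩ := hd k
    refine ⟨C, fun ξ => le_trans ?_ (hC ξ)⟩
    rw [etaHat, Complex.norm_real]
    gcongr
    exact norm_fst_le _
  herm ξ := by rw [etaHat, etaHat, hp, Complex.conj_ofReal]

theorem isSpectral_uHat {v : ℝ → ℝ × ℝ} (hc : Continuous v) (hp : Model.HasParity v)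
    (hd : ∀ k : ℕ, ∃ C, ∀ ξ, (1 + |ξ|) ^ k * ‖v ξ‖ ≤ C) : IsSpectral (uHat v) where
  cont := by unfold uHat; fun_prop
  decay k := by
    obtain ⟨C, hC⟩ := hd k
    refine ⟨C, fun ξ => le_trans ?_ (hC ξ)⟩
    rw [uHat, norm_mul, Complex.norm_I, one_mul, Complex.norm_real]
    gcongr
    exact norm_snd_le _
  herm ξ := by simp [uHat, hp ξ]

theorem conv_uHat_etaHat (v : ℝ → ℝ × ℝ) (ξ : ℝ) : conv (uHat v) (etaHat v) ξ =
    Complex.I * (rconv (fun ζ => (v ζ).2) (fun ζ => (v ζ).1) ξ : ℂ) := by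
  rw [conv, rconv, ← integral_complex_ofReal, ← integral_const_mul]
  congr 1
  ext ζ
  simp [uHat, etaHat, mul_assoc]

theorem conv_uHat_uHat (v : ℝ → ℝ × ℝ) (ξ : ℝ) : conv (uHat v) (uHat v) ξ =
    -(rconv (fun ζ => (v ζ).2) (fun ζ => (v ζ).2) ξ : ℂ) := by
  rw [conv, rconv, ← integral_complex_ofReal, ← integral_neg]
  congr 1
  ext ζ
  simp only [uHat, Complex.ofReal_mul]
  linear_combination ((v ζ).2 : ℂ) * ((v (ξ - ζ)).2 : ℂ) * Complex.I_mul_I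

namespace Model

variable {M : Model} {N T P A : ℝ}

/-- The time derivative of a solution on the Fourier side. -/
def velocity (M : Model) (v : ℝ → ℝ × ℝ) (ξ : ℝ) : ℝ × ℝ :=
  (M.freq ξ * M.r ξ * (v ξ).2 + (M.nl v v ξ).1,
    -(M.freq ξ * (M.r ξ)⁻¹) * (v ξ).1 + (M.nl v v ξ).2)

theorem HasParity.velocity {v : ℝ → ℝ × ℝ} (hv : HasParity v) : HasParity (M.velocity v) := by
  intro ξ
  have := hv.nl (M := M) hv ξ
  ext
  · simp [Model.velocity, this, hv ξ, M.freq_neg, M.r_neg]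
  · simp [Model.velocity, this, hv ξ, M.freq_neg, M.r_neg]
    ring

theorem exists_bound_velocity {a b c d F : ℝ} (hM : M.Represents a b c d) (h : M.Scale N P)
    (k : ℕ) : ∃ C, ∀ ρ, 1 / 2 ≤ ρ → ∀ v : ℝ → ℝ × ℝ, (∀ ξ, ‖v ξ‖ ≤ F * weight N ρ ξ) →
      ∀ ξ, (1 + |ξ|) ^ k * ‖M.velocity v ξ‖ ≤ C := by
  obtain ⟨C₁, hC₁⟩ := hM.growth
  obtain ⟨C₂, hC₂⟩ := exists_pow_mul_weight_le h.1 (k + 3)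
  have hN := h.1
  have hK := M.K_pos
  have hP := scale_P_nonneg h
  have hC₁0 : 0 ≤ C₁ := by
    have := (abs_nonneg _).trans (hC₁ 0)
    simpa using this
  refine ⟨(C₁ * M.K * |F| + P * (4 * Real.pi * N) * (|F| * |F|) * (1 + 1 / N)) * C₂,
    fun ρ hρ v hv ξ => ?_⟩
  have hv' : ∀ ξ, ‖v ξ‖ ≤ |F| * weight N ρ ξ := fun ξ => (hv ξ).trans
    (mul_le_mul_of_nonneg_right (le_abs_self F) (weight_pos _ _ _).le)
  have hw := (weight_pos N ρ ξ).le
  have e1 : ‖((M.freq ξ * M.r ξ * (v ξ).2, -(M.freq ξ * (M.r ξ)⁻¹) * (v ξ).1) : ℝ × ℝ)‖ ≤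
      C₁ * (1 + |ξ|) ^ 3 * M.K * (|F| * weight N ρ ξ) := by
    have hr0 := M.r_pos ξ
    rw [Prod.norm_def]
    refine max_le ?_ ?_
    · rw [Real.norm_eq_abs, abs_mul, abs_mul, abs_of_pos hr0]
      have := (norm_snd_le (v ξ)).trans (hv' ξ)
      rw [Real.norm_eq_abs] at this
      gcongr
      · exact hC₁ ξ
      · exact M.r_le ξ
    · rw [Real.norm_eq_abs, abs_mul, abs_neg, abs_mul, abs_of_pos (inv_pos.2 hr0)]
      have := (norm_fst_le (v ξ)).trans (hv' ξ)
      rw [Real.norm_eq_abs] at this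
      gcongr
      · exact hC₁ ξ
      · exact M.inv_r_le ξ
  have e2 := norm_nl_le h (by linarith : 0 ≤ ρ) hv' hv' ξ
  have e3 : 1 + |ξ| / N ≤ (1 + 1 / N) * (1 + |ξ|) ^ 3 := by
    have h1 : 1 + |ξ| / N ≤ (1 + 1 / N) * (1 + |ξ|) := by
      have : (1 + 1 / N) * (1 + |ξ|) = 1 + |ξ| / N + (|ξ| + 1 / N) := by ring
      rw [this]
      have : 0 ≤ |ξ| + 1 / N := by positivity
      linarith
    refine h1.trans (mul_le_mul_of_nonneg_left ?_ (by positivity))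
    exact le_self_pow₀ (by linarith [abs_nonneg ξ]) (by norm_num)
  have e : M.velocity v ξ = (M.freq ξ * M.r ξ * (v ξ).2, -(M.freq ξ * (M.r ξ)⁻¹) * (v ξ).1) +
      M.nl v v ξ := rfl
  calc (1 + |ξ|) ^ k * ‖M.velocity v ξ‖
      ≤ (1 + |ξ|) ^ k * (C₁ * (1 + |ξ|) ^ 3 * M.K * (|F| * weight N ρ ξ) +
        P * (4 * Real.pi * N) * (|F| * |F|) * (((1 + 1 / N) * (1 + |ξ|) ^ 3) * weight N ρ ξ)) := by
        rw [e]
        gcongr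
        refine (norm_add_le _ _).trans (add_le_add e1 (e2.trans ?_))
        gcongr
    _ = (C₁ * M.K * |F| + P * (4 * Real.pi * N) * (|F| * |F|) * (1 + 1 / N)) *
        ((1 + |ξ|) ^ (k + 3) * weight N ρ ξ) := by ring
    _ ≤ _ := by
        gcongr
        exact hC₂ ρ hρ ξ

/-- Parity of `(H, U)` is Hermitian symmetry of `H` and `iU`, so the synthesized functions are real.
The exponential decay puts them and their time derivatives in `H^∞`, and the equations are read off
from the symbols. -/
theorem IsSpectralSolution.isSolution {a b c d F : ℝ} {v : ℝ → ℝ → ℝ × ℝ}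
    (hv : M.IsSpectralSolution T v) (hM : M.Represents a b c d) (h : M.Scale N P) (hT : 0 < T)
    (hF : ∀ t ξ, ‖v t ξ‖ ≤ F * weight N (rate T t) ξ) :
    (∀ t, IsSpectral (etaHat (v t)) ∧ IsSpectral (uHat (v t))) ∧
      IsSolution a b c d T fun t => (synth (etaHat (v t)), synth (uHat (v t))) := by
  have hcv : ∀ t, Continuous (v t) := fun t =>
    continuous_comp_pair (f := v) hv.continuous continuous_const continuous_id
  have hcn : ∀ t, Continuous (M.nl (v t) (v t)) := fun t =>
    continuous_comp_pair (f := fun t => M.nl (v t) (v t)) hv.continuous_nl continuous_const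
      continuous_id
  have hdv : ∀ t, ∀ k : ℕ, ∃ C, ∀ ξ, (1 + |ξ|) ^ k * ‖v t ξ‖ ≤ C := by
    intro t k
    obtain ⟨C, hC⟩ := exists_pow_mul_weight_le h.1 k
    refine ⟨|F| * C, fun ξ => ?_⟩
    calc (1 + |ξ|) ^ k * ‖v t ξ‖ ≤ (1 + |ξ|) ^ k * (|F| * weight N (rate T t) ξ) := by
          have := (weight_pos N (rate T t) ξ).le
          gcongr
          exact (hF t ξ).trans (by gcongr; exact le_abs_self F)
      _ = |F| * ((1 + |ξ|) ^ k * weight N (rate T t) ξ) := by ring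
      _ ≤ _ := by gcongr; exact hC _ (half_le_rate hT t) ξ
  have hcd : ∀ t, Continuous (M.velocity (v t)) := fun t => by
    have h1 := M.continuous_freq
    have h2 := M.continuous_r
    have h3 : Continuous fun ξ => (M.r ξ)⁻¹ := h2.inv₀ fun ξ => (M.r_pos _).ne'
    have h4 := hcv t
    have h5 := hcn t
    exact (((h1.mul h2).mul h4.snd).add h5.fst).prodMk (((h1.mul h3).neg.mul h4.fst).add h5.snd)
  have hbd : ∀ k : ℕ, ∃ C, ∀ t, ∀ ξ, (1 + |ξ|) ^ k * ‖M.velocity (v t) ξ‖ ≤ C := by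
    intro k
    obtain ⟨C, hC⟩ := exists_bound_velocity (F := F) hM h k
    exact ⟨C, fun t => hC _ (half_le_rate hT t) _ (hF t)⟩
  have hdd : ∀ t, ∀ k : ℕ, ∃ C, ∀ ξ, (1 + |ξ|) ^ k * ‖M.velocity (v t) ξ‖ ≤ C := fun t k =>
    (hbd k).imp fun C hC => hC t
  have s1 : ∀ t, IsSpectral (etaHat (v t)) := fun t =>
    isSpectral_etaHat (hcv t) (hv.parity t) (hdv t)
  have s2 : ∀ t, IsSpectral (uHat (v t)) := fun t =>
    isSpectral_uHat (hcv t) (hv.parity t) (hdv t)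
  have s3 : ∀ t, IsSpectral (etaHat (M.velocity (v t))) := fun t =>
    isSpectral_etaHat (hcd t) ((hv.parity t).velocity (M := M)) (hdd t)
  have s4 : ∀ t, IsSpectral (uHat (M.velocity (v t))) := fun t =>
    isSpectral_uHat (hcd t) ((hv.parity t).velocity (M := M)) (hdd t)
  refine ⟨fun t => ⟨s1 t, s2 t⟩, fun t => synth (etaHat (M.velocity (v t))),
    fun t => synth (uHat (M.velocity (v t))), fun t ht => ⟨(s1 t).isHInf_synth,
    (s2 t).isHInf_synth, (s3 t).isHInf_synth, (s4 t).isHInf_synth, ?_, ?_, fun x => ⟨?_, ?_⟩⟩⟩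
  · refine hasTimeDerivWithin_synth (F := fun t => etaHat (v t))
      (F' := fun t => etaHat (M.velocity (v t))) (fun t _ => s1 t) (fun t _ => s3 t)
      (fun t ht ξ => ?_) (fun k => ?_) ht
    · exact ((Complex.ofRealCLM.comp (ContinuousLinearMap.fst ℝ ℝ ℝ)).hasFDerivAt
        |>.comp_hasDerivWithinAt t (hv.hasDerivWithinAt t ht ξ))
    · obtain ⟨C, hC⟩ := hbd k
      refine ⟨C, fun t _ ξ => le_trans ?_ (hC t ξ)⟩
      rw [etaHat, Complex.norm_real]
      gcongr
      exact norm_fst_le _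
  · refine hasTimeDerivWithin_synth (F := fun t => uHat (v t))
      (F' := fun t => uHat (M.velocity (v t))) (fun t _ => s2 t) (fun t _ => s4 t)
      (fun t ht ξ => ?_) (fun k => ?_) ht
    · exact ((Complex.ofRealCLM.comp (ContinuousLinearMap.snd ℝ ℝ ℝ)).hasFDerivAt
        |>.comp_hasDerivWithinAt t (hv.hasDerivWithinAt t ht ξ)).const_mul Complex.I
    · obtain ⟨C, hC⟩ := hbd k
      refine ⟨C, fun t _ ξ => le_trans ?_ (hC t ξ)⟩
      rw [uHat, norm_mul, Complex.norm_I, one_mul, Complex.norm_real]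
      gcongr
      exact norm_snd_le _
  · have hc := (s2 t).conv (s1 t)
    have key := (s3 t).synth_equation (s2 t) hc a b 1 (fun ξ => ?_) x
    · simp only [one_mul, (s2 t).synth_mul (s1 t) hc] at key
      exact key
    · rw [conv_uHat_etaHat]
      have h1 : ((1 : ℂ) + b * (2 * Real.pi * ξ) ^ 2) * (M.freq ξ * M.r ξ) =
        2 * Real.pi * ξ * (1 - a * (2 * Real.pi * ξ) ^ 2) := by exact_mod_cast hM.eq_freq_mul ξ
      have h2 : ((1 : ℂ) + b * (2 * Real.pi * ξ) ^ 2) * M.b₁ ξ = 2 * Real.pi * ξ := by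
        exact_mod_cast hM.eq_b₁ ξ
      simp only [etaHat, uHat, velocity, nl, dsym]
      push_cast
      set R : ℂ := (rconv (fun ζ => (v t ζ).2) (fun ζ => (v t ζ).1) ξ : ℂ)
      have e : (2 * (Real.pi : ℂ) * Complex.I * ξ) ^ 2 = -(2 * Real.pi * ξ) ^ 2 := by
        linear_combination (2 * (Real.pi : ℂ) * ξ) ^ 2 * Complex.I_sq
      rw [e]
      linear_combination ((v t ξ).2 : ℂ) * h1 + R * h2 + 2 * Real.pi * ξ *
        ((1 - a * (2 * Real.pi * ξ) ^ 2) * ((v t ξ).2 : ℂ) + R) * Complex.I_sq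
  · have hc := (s2 t).conv (s2 t)
    have key := (s4 t).synth_equation (s1 t) hc c d (1 / 2) (fun ξ => ?_) x
    · simp only [(s2 t).synth_mul (s2 t) hc, ← pow_two] at key
      exact key
    · rw [conv_uHat_uHat]
      have h1 : ((1 : ℂ) + d * (2 * Real.pi * ξ) ^ 2) * (M.freq ξ * (M.r ξ : ℂ)⁻¹) =
        2 * Real.pi * ξ * (1 - c * (2 * Real.pi * ξ) ^ 2) := by exact_mod_cast hM.eq_freq_div ξ
      have h2 : ((1 : ℂ) + d * (2 * Real.pi * ξ) ^ 2) * M.b₂ ξ = 2 * Real.pi * ξ := by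
        exact_mod_cast hM.eq_b₂ ξ
      simp only [etaHat, uHat, velocity, nl, dsym]
      push_cast
      set R : ℂ := (rconv (fun ζ => (v t ζ).2) (fun ζ => (v t ζ).2) ξ : ℂ)
      have e : (2 * (Real.pi : ℂ) * Complex.I * ξ) ^ 2 = -(2 * Real.pi * ξ) ^ 2 := by
        linear_combination (2 * (Real.pi : ℂ) * ξ) ^ 2 * Complex.I_sq
      rw [e]
      linear_combination Complex.I * (-((v t ξ).1 : ℂ) * h1 + 2⁻¹ * R * h2)

end Model

/-! ### The initial data. -/

/-- An odd profile supported in `1 ≤ |x| ≤ 2`. -/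
def oddTent (x : ℝ) : ℝ := max 0 (1 - 2 * |x - 3 / 2|) - max 0 (1 - 2 * |-x - 3 / 2|)

theorem continuous_oddTent : Continuous oddTent := by unfold oddTent; fun_prop

theorem oddTent_neg (x : ℝ) : oddTent (-x) = -oddTent x := by simp [oddTent]

theorem oddTent_of_nonneg {x : ℝ} (hx : 0 ≤ x) : oddTent x = max 0 (1 - 2 * |x - 3 / 2|) := by
  rw [oddTent, max_eq_left (b := 1 - 2 * |-x - 3 / 2|), sub_zero]
  rw [abs_of_nonpos (by linarith)]
  linarith

theorem oddTent_nonneg {x : ℝ} (hx : 0 ≤ x) : 0 ≤ oddTent x := by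
  rw [oddTent_of_nonneg hx]
  exact le_max_left _ _

theorem oddTent_abs (x : ℝ) : |oddTent x| = oddTent |x| := by
  rcases le_total 0 x with h | h
  · rw [abs_of_nonneg h, abs_of_nonneg (oddTent_nonneg h)]
  · rw [abs_of_nonpos h, ← abs_neg, ← oddTent_neg, abs_of_nonneg (oddTent_nonneg (by linarith))]

theorem abs_oddTent_le_one (x : ℝ) : |oddTent x| ≤ 1 := by
  rw [oddTent_abs, oddTent_of_nonneg (abs_nonneg x)]
  exact max_le zero_le_one (by linarith [abs_nonneg (|x| - 3 / 2)])

theorem oddTent_eq_zero_of_lt {x : ℝ} (h : |x| ≤ 1) : oddTent x = 0 := by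
  rw [← abs_eq_zero, oddTent_abs, oddTent_of_nonneg (abs_nonneg x)]
  refine max_eq_left ?_
  linarith [neg_le_abs (|x| - 3 / 2)]

theorem oddTent_eq_zero_of_gt {x : ℝ} (h : 2 ≤ |x|) : oddTent x = 0 := by
  rw [← abs_eq_zero, oddTent_abs, oddTent_of_nonneg (abs_nonneg x)]
  refine max_eq_left ?_
  linarith [le_abs_self (|x| - 3 / 2)]

/-- When both factors are nonzero, `|x|, |y| > 1`; a sum of size at most `1` then forces opposite
signs. -/
theorem oddTent_mul_nonpos {x y : ℝ} (h : |x + y| ≤ 1) : oddTent x * oddTent y ≤ 0 := by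
  have key : ∀ {x y : ℝ}, 0 ≤ x → |x + y| ≤ 1 → oddTent x * oddTent y ≤ 0 := by
    intro x y hx h
    rcases le_total y 0 with hy | hy
    · have := oddTent_nonneg (x := -y) (by linarith)
      rw [oddTent_neg] at this
      nlinarith [oddTent_nonneg hx]
    · rw [oddTent_eq_zero_of_lt (x := x), zero_mul]
      rw [abs_of_nonneg hx]
      linarith [le_abs_self (x + y)]
  rcases le_total 0 x with hx | hx
  · exact key hx h
  · have := key (x := -x) (y := -y) (by linarith) (by rwa [← neg_add, abs_neg])
    rwa [oddTent_neg, oddTent_neg, neg_mul_neg] at this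

theorem oddTent_mul_le {x y : ℝ} (h : |x + y| ≤ 1 / 8) (h1 : 11 / 8 ≤ x) (h2 : x ≤ 13 / 8) :
    oddTent x * oddTent y ≤ -(3 / 8) := by
  obtain ⟨h3, h4⟩ := abs_le.1 h
  have hx : 3 / 4 ≤ oddTent x := by
    rw [oddTent_of_nonneg (by linarith)]
    refine le_max_of_le_right ?_
    have : |x - 3 / 2| ≤ 1 / 8 := abs_le.2 ⟨by linarith, by linarith⟩
    linarith
  have hy : 1 / 2 ≤ oddTent (-y) := by
    rw [oddTent_of_nonneg (by linarith)]
    refine le_max_of_le_right ?_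
    have : |-y - 3 / 2| ≤ 1 / 4 := abs_le.2 ⟨by linarith, by linarith⟩
    linarith
  rw [oddTent_neg] at hy
  nlinarith

/-- The amplitude that fits the profile under the exponential weight. -/
def amp : ℝ := Real.exp (-3) / 5

theorem amp_pos : 0 < amp := by unfold amp; positivity

/-- The second component of the initial data on the Fourier side. -/
def pulse (A N ξ : ℝ) : ℝ := A * amp * oddTent (ξ / N)

theorem continuous_pulse (A N : ℝ) : Continuous (pulse A N) := by
  unfold pulse
  have := continuous_oddTent
  fun_prop

theorem pulse_neg (A N ξ : ℝ) : pulse A N (-ξ) = -pulse A N ξ := by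
  rw [pulse, neg_div, oddTent_neg, pulse, mul_neg]

section

variable {A N : ℝ}

theorem abs_div_eq (hN : 0 < N) (ξ : ℝ) : |ξ / N| = |ξ| / N := by rw [abs_div, abs_of_pos hN]

theorem pulse_eq_zero_of_le (hN : 0 < N) {ξ : ℝ} (h : |ξ| ≤ N) : pulse A N ξ = 0 := by
  rw [pulse, oddTent_eq_zero_of_lt, mul_zero]
  rw [abs_div_eq hN, div_le_one hN]
  exact h

theorem pulse_eq_zero_of_ge (hN : 0 < N) {ξ : ℝ} (h : 2 * N ≤ |ξ|) : pulse A N ξ = 0 := by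
  rw [pulse, oddTent_eq_zero_of_gt, mul_zero]
  rw [abs_div_eq hN, le_div_iff₀ hN]
  exact h

theorem abs_pulse_le (hA : 0 ≤ A) (ξ : ℝ) : |pulse A N ξ| ≤ A * amp := by
  rw [pulse, abs_mul, abs_of_nonneg (mul_nonneg hA amp_pos.le)]
  exact mul_le_of_le_one_right (mul_nonneg hA amp_pos.le) (abs_oddTent_le_one _)

/-- On the support `|ξ| ≤ 2N` the exponent is at least `-3` and the denominator at most `5`, which
explains `exp(-3)/5`. -/
theorem amp_le_weight (hN : 0 < N) {ξ : ℝ} (h : |ξ| ≤ 2 * N) : amp ≤ weight N 1 ξ := by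
  have h1 : |ξ| / N ≤ 2 := (div_le_iff₀ hN).2 h
  have h2 : (ξ / N) ^ 2 ≤ 4 := by
    rw [← sq_abs, abs_div_eq hN]
    have : 0 ≤ |ξ| / N := by positivity
    nlinarith
  unfold amp weight
  gcongr <;> linarith

theorem abs_pulse_le_weight (hA : 0 ≤ A) (hN : 0 < N) (ξ : ℝ) :
    |pulse A N ξ| ≤ A * weight N 1 ξ := by
  rcases le_total (|ξ|) (2 * N) with h | h
  · exact (abs_pulse_le hA ξ).trans (mul_le_mul_of_nonneg_left (amp_le_weight hN h) hA)
  · rw [pulse_eq_zero_of_ge hN h, abs_zero]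
    exact mul_nonneg hA (weight_pos _ _ _).le

/-- The integrand is nonpositive everywhere and at most `-(3/8)(A · amp)²` on an interval of length
`N/4`. The condition `N ≥ 8` makes the rescaled output frequency at most `1/8`. -/
theorem rconv_pulse_le (hA : 0 ≤ A) (hN : 8 ≤ N) {ξ : ℝ} (hξ : |ξ| ≤ 1) :
    rconv (pulse A N) (pulse A N) ξ ≤ -(3 * amp ^ 2 / 32 * (A ^ 2 * N)) := by
  have hN0 : 0 < N := by linarith
  have hle : ∀ ζ, pulse A N ζ * pulse A N (ξ - ζ) ≤
      (Icc (11 / 8 * N) (13 / 8 * N)).indicator (fun _ => -(3 / 8 * (A * amp) ^ 2)) ζ := by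
    intro ζ
    have e : pulse A N ζ * pulse A N (ξ - ζ) =
        (A * amp) ^ 2 * (oddTent (ζ / N) * oddTent ((ξ - ζ) / N)) := by unfold pulse; ring
    have hs : |ζ / N + (ξ - ζ) / N| ≤ 1 / 8 := by
      rw [← add_div, add_sub_cancel, abs_div_eq hN0, div_le_iff₀ hN0]
      linarith
    rw [e]
    by_cases hζ : ζ ∈ Icc (11 / 8 * N) (13 / 8 * N)
    · rw [indicator_of_mem hζ]
      have := mul_le_mul_of_nonneg_left (oddTent_mul_le hs ((le_div_iff₀ hN0).2 hζ.1)
        ((div_le_iff₀ hN0).2 hζ.2)) (sq_nonneg (A * amp))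
      linarith
    · rw [indicator_of_notMem hζ]
      exact mul_nonpos_of_nonneg_of_nonpos (sq_nonneg _) (oddTent_mul_nonpos (hs.trans (by norm_num)))
  have hi := integrable_rconv (ρ := 1) (F := A) (G := A) hN0 zero_le_one (continuous_pulse A N)
    (continuous_pulse A N) (abs_pulse_le_weight hA hN0) (abs_pulse_le_weight hA hN0) ξ
  have hj : Integrable ((Icc (11 / 8 * N) (13 / 8 * N)).indicator
      (fun _ => -(3 / 8 * (A * amp) ^ 2))) :=
    (integrable_indicator_iff measurableSet_Icc).2 (integrableOn_const (by simp))
  refine (integral_mono hi hj hle).trans (le_of_eq ?_)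
  rw [integral_indicator measurableSet_Icc, setIntegral_const, smul_eq_mul, Measure.real,
    Real.volume_Icc, ENNReal.toReal_ofReal (by linarith)]
  ring

end

/-! ### Norm inflation at low frequencies. -/

namespace Model

variable {M : Model} {C : ℝ} {m : ℕ}

/-- Bounds for the symbols at frequencies of order `N`. -/
structure Bounds (M : Model) (C : ℝ) (m : ℕ) : Prop where
  pos : 0 < C
  abs_b₁_le : ∀ N, 1 ≤ N → ∀ ξ, |M.b₁ ξ| ≤ C * N ^ m * (1 + |ξ| / N)
  abs_b₂_le : ∀ N, 1 ≤ N → ∀ ξ, |M.b₂ ξ| ≤ C * N ^ m * (1 + |ξ| / N)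
  abs_freq_le : ∀ N, 1 ≤ N → ∀ ξ, |ξ| ≤ 2 * N → |M.freq ξ| ≤ C * N * (N ^ m) ^ 2
  le_b₂ : ∀ ξ ∈ Icc (1 / 2 : ℝ) 1, 1 / C ≤ M.b₂ ξ

theorem Bounds.scale (h : M.Bounds C m) {N : ℝ} (hN : 1 ≤ N) : M.Scale N (C * N ^ m) :=
  ⟨by linarith, fun ξ => ⟨h.abs_b₁_le N hN ξ, h.abs_b₂_le N hN ξ⟩⟩

/-- With `κ = N^m / A` small, the solution stays within `O(κ A)` of the data in the weighted norm.
So `U ⋆ U` keeps half of its initial size at low frequencies up to time `1/(A²N)` and drives `U`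
there at a rate of order `A²N`. -/
theorem exists_inflation (h : M.Bounds C m) : ∃ κ > 0, ∃ c > 0, ∀ N A : ℝ, 8 ≤ N → 1 ≤ A →
    N ^ m ≤ κ * A → ∃ v : ℝ → ℝ → ℝ × ℝ, M.IsSpectralSolution (1 / (A ^ 2 * N)) v ∧
      (v 0 = fun ξ => (0, pulse A N ξ)) ∧
      (∃ F, ∀ t ξ, ‖v t ξ‖ ≤ F * weight N (rate (1 / (A ^ 2 * N)) t) ξ) ∧
      ∀ ξ ∈ Icc (1 / 2 : ℝ) 1, (v (1 / (A ^ 2 * N)) ξ).2 ≤ -c := by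
  have hC := h.pos
  have hK := M.K_pos
  have ha := amp_pos
  obtain ⟨G, hG⟩ : ∃ G, G = 8 * Real.pi * C * (1 + M.K) ^ 3 := ⟨_, rfl⟩
  obtain ⟨C₁, hC₁⟩ : ∃ C₁, C₁ = (1 + M.K) * (4 * G + C) := ⟨_, rfl⟩
  obtain ⟨C₂, hC₂⟩ : ∃ C₂, C₂ = 2 * (1 + M.K) := ⟨_, rfl⟩
  obtain ⟨C₃, hC₃⟩ : ∃ C₃, C₃ = 8 * Real.pi * C₁ * C₂ := ⟨_, rfl⟩
  obtain ⟨c₀, hc₀⟩ : ∃ c₀, c₀ = 3 * amp ^ 2 / 32 := ⟨_, rfl⟩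
  have hG0 : 0 < G := by rw [hG]; positivity
  have hC₁0 : 0 < C₁ := by rw [hC₁]; positivity
  have hC₂0 : 0 < C₂ := by rw [hC₂]; positivity
  have hC₃0 : 0 < C₃ := by rw [hC₃]; positivity
  have hc₀0 : 0 < c₀ := by rw [hc₀]; positivity
  -- The four smallness conditions serve in turn: `κ² ≤ κ` for the linear phase, the contraction,
  -- the error in `U ⋆ U`, and the linear term at low frequencies.
  refine ⟨min (min 1 (1 / (8 * G))) (min (c₀ / (2 * C₃)) (c₀ / (8 * C * (C * M.K * C₁)))),
    by positivity, c₀ / (8 * C), by positivity, fun N A hN hA hNA => ?_⟩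
  have hN0 : 0 < N := by linarith
  have hA0 : 0 < A := by linarith
  obtain ⟨κ, hκ⟩ : ∃ κ, κ = N ^ m / A := ⟨_, rfl⟩
  have hκ0 : 0 < κ := by rw [hκ]; positivity
  have hNm : N ^ m = κ * A := by rw [hκ, div_mul_cancel₀ _ hA0.ne']
  rw [hNm, mul_le_mul_iff_left₀ hA0, le_min_iff, le_min_iff, le_min_iff,
    le_div_iff₀ (by positivity), le_div_iff₀ (by positivity), le_div_iff₀ (by positivity)] at hNA
  obtain ⟨⟨k1, k2⟩, k3, k4⟩ := hNA
  obtain ⟨T, hT⟩ : ∃ T, T = 1 / (A ^ 2 * N) := ⟨_, rfl⟩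
  have hT0 : 0 < T := by rw [hT]; positivity
  have hAT : A ^ 2 * N * T = 1 := by rw [hT]; field_simp
  rw [← hT]
  have hS : M.Scale N (C * N ^ m) := h.scale (by linarith)
  have hgain : M.gain N T (C * N ^ m) * A = G * κ := by
    rw [gain, hNm, hG]
    linear_combination 8 * Real.pi * C * (1 + M.K) ^ 3 * κ * hAT
  have hw := fun ρ ξ => (weight_pos N ρ ξ).le
  have hw1 : ∀ ξ, weight N (1 / 2) ξ ≤ 1 := fun ξ =>
    (weight_le hN0 (by norm_num) ξ).trans (inv_le_one_of_one_le₀ (by nlinarith [sq_nonneg (ξ / N)]))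
  have hyn : ∀ ξ, ‖((0, pulse A N ξ) : ℝ × ℝ)‖ = |pulse A N ξ| := fun ξ => by simp [Prod.norm_def]
  obtain ⟨v, hv, hv0, hvF, hvd⟩ := exists_isSpectralSolution (M := M) (A := A) hS hT0
    (y₀ := fun ξ => (0, pulse A N ξ)) (continuous_const.prodMk (continuous_pulse A N)) hA0.le
    (fun ξ => by rw [hyn]; exact abs_pulse_le_weight hA0.le hN0 ξ)
    (fun ξ => by simp [pulse_neg]) (by rw [mul_assoc, hgain]; linarith)
  refine ⟨v, hv, hv0, ⟨_, hvF⟩, ?_⟩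
  have hA2 : A ≤ A ^ 2 * N := by nlinarith
  have bF : ∀ t ξ, ‖v t ξ‖ ≤ C₂ * A * weight N (1 / 2) ξ := fun t ξ => by
    refine (hvF t ξ).trans ?_
    rw [hC₂, show (1 + M.K) * (2 * A) = 2 * (1 + M.K) * A by ring]
    exact mul_le_mul_of_nonneg_left (weight_anti hN0 (half_le_rate hT0 t) ξ) (by positivity)
  have bp : ∀ ξ, |pulse A N ξ| ≤ C₂ * A * weight N (1 / 2) ξ := fun ξ => by
    rw [← hyn, ← congrFun hv0 ξ]
    exact bF 0 ξ
  have bd : ∀ t ∈ Icc 0 T, ∀ ξ, ‖v t ξ - (0, pulse A N ξ)‖ ≤ C₁ * κ * A * weight N (1 / 2) ξ := by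
    intro t ht ξ
    have h1 : (1 + M.K) * (M.gain N T (C * N ^ m) * (4 * A ^ 2)) * weight N (rate T t) ξ ≤
        (1 + M.K) * (4 * G * κ * A) * weight N (1 / 2) ξ := by
      rw [show M.gain N T (C * N ^ m) * (4 * A ^ 2) = 4 * (M.gain N T (C * N ^ m) * A) * A by ring,
        hgain, show 4 * (G * κ) * A = 4 * G * κ * A by ring]
      exact mul_le_mul_of_nonneg_left (weight_anti hN0 (half_le_rate hT0 t) ξ) (by positivity)
    -- The drift matters only on the support of the pulse, where the phase is at most `C N (N^m)² T
    -- = C κ²`.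
    have h2 : |M.freq ξ * t| * |pulse A N ξ| ≤ C * κ * (A * weight N (1 / 2) ξ) := by
      rcases le_total (|ξ|) (2 * N) with hξ | hξ
      · have h3 : |M.freq ξ * t| ≤ C * κ := by
          rw [abs_mul, abs_of_nonneg ht.1]
          calc |M.freq ξ| * t ≤ C * N * (N ^ m) ^ 2 * T :=
                mul_le_mul (h.abs_freq_le N (by linarith) ξ hξ) ht.2 ht.1 (by positivity)
            _ = C * κ * κ := by
                rw [hNm]
                linear_combination C * κ ^ 2 * hAT
            _ ≤ _ := mul_le_of_le_one_right (by positivity) k1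
        refine mul_le_mul h3 ((abs_pulse_le_weight hA0.le hN0 ξ).trans ?_) (abs_nonneg _)
          (by positivity)
        exact mul_le_mul_of_nonneg_left (weight_anti hN0 (by norm_num) ξ) hA0.le
      · rw [pulse_eq_zero_of_ge hN0 hξ, abs_zero, mul_zero]
        have := hw (1 / 2) ξ
        positivity
    refine (hvd t ξ).trans ?_
    rw [hyn, hC₁, mul_assoc (1 + M.K) |M.freq ξ * t|]
    have h3 := mul_le_mul_of_nonneg_left h2 (by positivity : 0 ≤ 1 + M.K)
    calc _ ≤ (1 + M.K) * (4 * G * κ * A) * weight N (1 / 2) ξ +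
          (1 + M.K) * (C * κ * (A * weight N (1 / 2) ξ)) := add_le_add h1 h3
      _ = _ := by ring
  have bR : ∀ t ∈ Icc 0 T, ∀ ξ, |ξ| ≤ 1 →
      rconv (fun ζ => (v t ζ).2) (fun ζ => (v t ζ).2) ξ ≤ -(c₀ / 2 * (A ^ 2 * N)) := by
    intro t ht ξ hξ
    have hvc : Continuous fun ζ => (v t ζ).2 :=
      (continuous_comp_pair (f := v) hv.continuous continuous_const continuous_id).snd
    have hpc := continuous_pulse A N
    have b2 : ∀ ζ, |(v t ζ).2| ≤ C₂ * A * weight N (1 / 2) ζ := fun ζ =>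
      (norm_snd_le (v t ζ)).trans (bF t ζ)
    have b3 : ∀ ζ, |(v t ζ).2 - pulse A N ζ| ≤ C₁ * κ * A * weight N (1 / 2) ζ := fun ζ =>
      (norm_snd_le (v t ζ - (0, pulse A N ζ))).trans (bd t ht ζ)
    have hh : (0 : ℝ) ≤ 1 / 2 := by norm_num
    -- Replace the two factors of `U ⋆ U` by the pulse one at a time; each replacement costs at most
    -- a quarter of `c₀ A²N`.
    have e1 := rconv_sub_left hN0 hh hvc hpc hvc b2 bp b2 ξ
    have e2 := rconv_sub_right hN0 hh hpc hvc hpc bp b2 bp ξ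
    have a1 := (le_abs_self _).trans (abs_rconv_le hN0 hh b3 b2 ξ)
    have a2 := (le_abs_self _).trans (abs_rconv_le hN0 hh bp b3 ξ)
    have a3 := rconv_pulse_le hA0.le hN hξ
    have hX : 0 ≤ C₁ * κ * A * (C₂ * A) * (4 * Real.pi * N) := by positivity
    have a1' := a1.trans (mul_le_of_le_one_right hX (hw1 ξ))
    have a2' := a2.trans (le_of_eq_of_le (by ring) (mul_le_of_le_one_right hX (hw1 ξ)))
    have hX' : C₁ * κ * A * (C₂ * A) * (4 * Real.pi * N) ≤ c₀ / 4 * (A ^ 2 * N) := by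
      calc _ = κ * (2 * C₃) / 4 * (A ^ 2 * N) := by rw [hC₃]; ring
        _ ≤ _ := by gcongr
    rw [hc₀] at hX' ⊢
    linarith
  intro ξ hξ
  have hξ1 : |ξ| ≤ 1 := abs_le.2 ⟨by linarith [hξ.1], hξ.2⟩
  have hd : ∀ t ∈ Icc 0 T, HasDerivWithinAt (fun τ => (v τ ξ).2)
      (-(M.freq ξ * (M.r ξ)⁻¹) * (v t ξ).1 + (M.nl (v t) (v t) ξ).2) (Icc 0 T) t := fun t ht =>
    (ContinuousLinearMap.snd ℝ ℝ ℝ).hasFDerivAt.comp_hasDerivWithinAt t (hv.hasDerivWithinAt t ht ξ)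
  have hp0 : pulse A N ξ = 0 := pulse_eq_zero_of_le hN0 (by linarith)
  have hle : ∀ t ∈ Icc 0 T, -(M.freq ξ * (M.r ξ)⁻¹) * (v t ξ).1 + (M.nl (v t) (v t) ξ).2 ≤
      -(c₀ / (8 * C)) * (A ^ 2 * N) := by
    intro t ht
    have h1 : |(v t ξ).1| ≤ C₁ * κ * A := by
      have := (norm_fst_le (v t ξ - (0, pulse A N ξ))).trans (bd t ht ξ)
      rw [Prod.fst_sub, sub_zero, Real.norm_eq_abs] at this
      refine this.trans (mul_le_of_le_one_right (by positivity) ?_)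
      exact hw1 ξ
    have h2 : |M.freq ξ * (M.r ξ)⁻¹| ≤ C * M.K := by
      have := h.abs_freq_le 1 le_rfl ξ (by linarith)
      rw [abs_mul, abs_of_pos (inv_pos.2 (M.r_pos ξ))]
      refine mul_le_mul (by simpa using this) (M.inv_r_le ξ) (inv_pos.2 (M.r_pos ξ)).le hC.le
    have h3 : -(M.freq ξ * (M.r ξ)⁻¹) * (v t ξ).1 ≤ c₀ / (8 * C) * (A ^ 2 * N) := by
      calc _ ≤ |(M.freq ξ * (M.r ξ)⁻¹)| * |(v t ξ).1| := by
            rw [← abs_neg, ← abs_mul]; exact le_abs_self _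
        _ ≤ C * M.K * (C₁ * κ * A) := mul_le_mul h2 h1 (abs_nonneg _) (by positivity)
        _ ≤ c₀ / (8 * C) * A := by
            rw [div_mul_eq_mul_div, le_div_iff₀ (by positivity)]
            nlinarith
        _ ≤ _ := by gcongr
    have h4 : (M.nl (v t) (v t) ξ).2 ≤ -(c₀ / (4 * C) * (A ^ 2 * N)) := by
      have hb := h.le_b₂ ξ hξ
      have hR := bR t ht ξ hξ1
      have h5 : 0 ≤ c₀ / 2 * (A ^ 2 * N) := by positivity
      have h6 : 0 < 1 / C := by positivity
      calc _ = 2⁻¹ * (M.b₂ ξ * rconv (fun ζ => (v t ζ).2) (fun ζ => (v t ζ).2) ξ) := by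
            rw [nl]; ring
        _ ≤ 2⁻¹ * (1 / C * -(c₀ / 2 * (A ^ 2 * N))) := by
            refine mul_le_mul_of_nonneg_left ?_ (by norm_num)
            nlinarith
        _ = _ := by field_simp; ring
    have h7 : c₀ / (4 * C) = 2 * (c₀ / (8 * C)) := by field_simp; ring
    rw [h7] at h4
    linarith
  have hcont : ContinuousOn (fun τ => (v τ ξ).2) (Icc 0 T) := fun t ht =>
    (hd t ht).continuousWithinAt
  -- The pulse vanishes at these frequencies, so `U` starts from zero and stays below the line of
  -- slope `-(c₀/(8C)) A²N`; at time `T` this line has the value `-c₀/(8C)`.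
  have := image_le_of_deriv_right_le_deriv_boundary hcont
    (fun t ht => (hd t (Ico_subset_Icc_self ht)).mono_of_mem_nhdsWithin (Icc_mem_nhdsGE_of_mem ht))
    (B := fun τ => -(c₀ / (8 * C)) * (A ^ 2 * N) * τ) (B' := fun _ => -(c₀ / (8 * C)) * (A ^ 2 * N))
    (by rw [hv0]; simp [hp0]) (by fun_prop)
    (fun t _ => by
      simpa only [mul_one, id] using (hasDerivWithinAt_id t (Ici t)).const_mul
        (-(c₀ / (8 * C)) * (A ^ 2 * N)))
    (fun t ht => hle t (Ico_subset_Icc_self ht)) (right_mem_Icc.2 hT0.le)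
  refine this.trans (le_of_eq ?_)
  linear_combination -(c₀ / (8 * C)) * hAT

/-- For `s ≤ 0` the Sobolev weight is at most `N^(2s)` on the support, which lies in an interval of
length `4N`. -/
theorem sobolevNorm_pulse_le {s A N : ℝ} (hs : s ≤ 0) (hA : 0 ≤ A) (hN : 1 ≤ N)
    (h : IsSpectral (uHat fun ξ => (0, pulse A N ξ))) :
    sobolevNorm s (synth (uHat fun ξ => (0, pulse A N ξ))) ≤
      ENNReal.ofReal (4 * N * N ^ (2 * s) * A ^ 2) ^ (1 / 2 : ℝ) := by
  have hN0 : 0 < N := by linarith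
  rw [h.sobolevNorm_synth]
  refine ENNReal.rpow_le_rpow ?_ (by norm_num)
  have hb : ∀ ξ, ENNReal.ofReal ((1 + (2 * Real.pi * ξ) ^ 2) ^ s) *
      ‖uHat (fun ξ => (0, pulse A N ξ)) ξ‖ₑ ^ 2 ≤
      (Icc (-(2 * N)) (2 * N)).indicator (fun _ => ENNReal.ofReal (N ^ (2 * s) * A ^ 2)) ξ := by
    intro ξ
    have hn : ‖uHat (fun ξ => (0, pulse A N ξ)) ξ‖ₑ = ENNReal.ofReal |pulse A N ξ| := by
      rw [← ofReal_norm, uHat, norm_mul, Complex.norm_I, one_mul, Complex.norm_real,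
        Real.norm_eq_abs]
    rw [hn, ← ENNReal.ofReal_pow (abs_nonneg _), ← ENNReal.ofReal_mul (by positivity)]
    rcases le_total (|ξ|) N with h1 | h1
    · rw [pulse_eq_zero_of_le hN0 h1]
      simp
    rcases le_total (2 * N) (|ξ|) with h2 | h2
    · rw [pulse_eq_zero_of_ge hN0 h2]
      simp
    rw [indicator_of_mem (show ξ ∈ Icc (-(2 * N)) (2 * N) from abs_le.1 h2)]
    refine ENNReal.ofReal_le_ofReal (mul_le_mul ?_ ?_ (by positivity) (by positivity))
    · rw [Real.rpow_mul hN0.le]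
      refine Real.rpow_le_rpow_of_nonpos (by positivity) ?_ hs
      rw [Real.rpow_two]
      have h3 := Real.two_le_pi
      have h4 : N ^ 2 ≤ ξ ^ 2 := by rw [← sq_abs ξ]; gcongr
      have h5 : 1 ≤ (2 * Real.pi) ^ 2 := by nlinarith
      have h6 := le_mul_of_one_le_left (sq_nonneg ξ) h5
      rw [mul_pow (2 * Real.pi)]
      linarith
    · have h3 : amp ≤ 1 := by
        have := Real.exp_le_one_iff.2 (by norm_num : (-3 : ℝ) ≤ 0)
        unfold amp
        linarith
      gcongr
      exact (abs_pulse_le hA ξ).trans (mul_le_of_le_one_right hA h3)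
  refine (lintegral_mono hb).trans (le_of_eq ?_)
  rw [lintegral_indicator measurableSet_Icc, setLIntegral_const, Real.volume_Icc,
    ← ENNReal.ofReal_mul (by positivity)]
  congr 1
  ring

/-- A lower bound for the `H^s` norm in terms of the low frequencies. -/
def lowNorm (s c : ℝ) : ℝ≥0∞ :=
  (ENNReal.ofReal ((1 + (2 * Real.pi) ^ 2) ^ s) * ENNReal.ofReal c ^ 2 *
    ENNReal.ofReal (1 / 2)) ^ (1 / 2 : ℝ)

theorem lowNorm_pos {c : ℝ} (s : ℝ) (hc : 0 < c) : 0 < lowNorm s c := by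
  refine ENNReal.rpow_pos_of_nonneg ?_ (by norm_num)
  have h1 : 0 < (1 + (2 * Real.pi) ^ 2) ^ s := by positivity
  refine ENNReal.mul_pos (mul_ne_zero ?_ (pow_ne_zero 2 ?_)) ?_
  · exact (ENNReal.ofReal_pos.2 h1).ne'
  · exact (ENNReal.ofReal_pos.2 hc).ne'
  · exact (ENNReal.ofReal_pos.2 (by norm_num)).ne'

/-- Only `1/2 ≤ ξ ≤ 1` is kept; for `s ≤ 0` the Sobolev weight there is at least its value at `ξ =
1`. -/
theorem lowNorm_le_sobolevNorm {s c : ℝ} (hs : s ≤ 0) {v : ℝ → ℝ × ℝ} (h : IsSpectral (uHat v))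
    (hv : ∀ ξ ∈ Icc (1 / 2 : ℝ) 1, (v ξ).2 ≤ -c) : lowNorm s c ≤ sobolevNorm s (synth (uHat v)) := by
  rw [h.sobolevNorm_synth, lowNorm]
  refine ENNReal.rpow_le_rpow ?_ (by norm_num)
  have e : ENNReal.ofReal (1 / 2) = volume (Icc (1 / 2 : ℝ) 1) := by
    rw [Real.volume_Icc]
    norm_num
  rw [e, ← setLIntegral_const]
  refine (setLIntegral_mono_ae' measurableSet_Icc (Eventually.of_forall fun ξ hξ => ?_)).trans
    (setLIntegral_le_lintegral _ _)
  gcongr ?_ * ?_ ^ 2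
  · refine ENNReal.ofReal_le_ofReal (Real.rpow_le_rpow_of_nonpos (by positivity) ?_ hs)
    have : ξ ^ 2 ≤ 1 := by nlinarith [hξ.1, hξ.2]
    nlinarith [sq_nonneg Real.pi]
  · rw [← ofReal_norm, uHat, norm_mul, Complex.norm_I, one_mul, Complex.norm_real,
      Real.norm_eq_abs]
    exact ENNReal.ofReal_le_ofReal ((le_neg.2 (hv ξ hξ)).trans (neg_le_abs _))

theorem sobolevNorm_synth_zero (s : ℝ) {F : ℝ → ℂ} (h : IsSpectral F) (hF : ∀ ξ, F ξ = 0) :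
    sobolevNorm s (synth F) = 0 := by
  rw [h.sobolevNorm_synth]
  simp [hF]

end Model

/-! ### Failure of continuity of the flow map. -/

/-- By uniqueness the solution chosen in `flowMap` agrees with the constructed one. -/
theorem UniqueSolutions.flowMap_eq {a b c d t : ℝ} (h : UniqueSolutions a b c d) (ht : 0 ≤ t)
    {v : ℝ → State} (hv : IsSolution a b c d t v) : flowMap a b c d (v 0) t = v t := by
  have hs : SolvableUpTo a b c d (v 0) t := ⟨v, hv, rfl⟩
  rw [flowMap, dif_pos hs]
  exact h t _ v hs.choose_spec.1 hv hs.choose_spec.2 t (right_mem_Icc.2 ht)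

theorem not_flowContinuousAtOrigin {a b c d C s T : ℝ} {M : Model} {m : ℕ}
    (hM : M.Represents a b c d) (hB : M.Bounds C m) (hu : UniqueSolutions a b c d)
    (hs : s < -1 / 2 - m) (hT : 0 < T) : ¬ FlowContinuousAtOrigin a b c d s T := by
  intro hf
  obtain ⟨κ, hκ, c₁, hc₁, H⟩ := Model.exists_inflation hB
  obtain ⟨δ, hδ, hf⟩ := hf _ (Model.lowNorm_pos s hc₁)
  -- Half of the gap to the critical exponent: with `A = N^(m+e)` the squared norm of the data is at
  -- most `4 N^(1 + 2s + 2m + 2e) = 4 N^(-2e)`, while `N^m / A = N^(-e)` still tends to zero.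
  obtain ⟨e, he⟩ : ∃ e, e = (-1 / 2 - m - s) / 2 := ⟨_, rfl⟩
  have he0 : 0 < e := by rw [he]; linarith
  have hs0 : s ≤ 0 := by have : (0 : ℝ) ≤ m := m.cast_nonneg; linarith
  have l1 : ∀ᶠ N : ℝ in atTop, N ^ (-e) < κ := (tendsto_rpow_neg_atTop he0).eventually_lt_const hκ
  have l2 : ∀ᶠ N : ℝ in atTop, ENNReal.ofReal (4 * N ^ (-(2 * e))) ^ (1 / 2 : ℝ) < δ := by
    have h1 : Tendsto (fun N : ℝ => ENNReal.ofReal (4 * N ^ (-(2 * e))) ^ (1 / 2 : ℝ)) atTop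
        (𝓝 (ENNReal.ofReal (4 * 0) ^ (1 / 2 : ℝ))) :=
      (ENNReal.continuous_rpow_const.tendsto _).comp
        (ENNReal.tendsto_ofReal ((tendsto_rpow_neg_atTop (by positivity)).const_mul 4))
    refine h1.eventually_lt_const ?_
    rw [mul_zero, ENNReal.ofReal_zero, ENNReal.zero_rpow_of_pos (by norm_num)]
    exact hδ
  -- The condition `N ≥ 1/T`, together with `A ≥ 1`, brings the inflation time below `T`.
  obtain ⟨N, hN1, hN2, hN3, hN4⟩ :=
    (l1.and (l2.and ((eventually_ge_atTop 8).and (eventually_ge_atTop (1 / T))))).exists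
  have hN0 : 0 < N := by linarith
  obtain ⟨A, hA⟩ : ∃ A, A = N ^ (m + e) := ⟨_, rfl⟩
  have hA1 : 1 ≤ A := by
    rw [hA]
    exact Real.one_le_rpow (by linarith) (by positivity)
  have hNA : N ^ m ≤ κ * A := by
    calc N ^ m = N ^ (-e) * A := by
          rw [hA, ← Real.rpow_add hN0, ← Real.rpow_natCast]
          congr 1
          ring
      _ ≤ _ := by gcongr
  obtain ⟨v, hv, hv0, ⟨F, hF⟩, hlow⟩ := H N A hN3 hA1 hNA
  have hτ0 : 0 < 1 / (A ^ 2 * N) := by positivity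
  obtain ⟨hspec, hsol⟩ := hv.isSolution hM (hB.scale (by linarith)) hτ0 hF
  have hτT : 1 / (A ^ 2 * N) ≤ T := by
    rw [div_le_iff₀ (by positivity)]
    rw [div_le_iff₀ hT] at hN4
    nlinarith
  have h0 : 1 / (A ^ 2 * N) ∈ Icc 0 T := ⟨hτ0.le, hτT⟩
  have hlt := hf _ (hspec 0).1.isHInf_synth (hspec 0).2.isHInf_synth ?_ _ h0 ⟨_, hsol, rfl⟩
  · have e1 := hu.flowMap_eq hτ0.le hsol
    beta_reduce at e1
    rw [e1] at hlt
    exact hlt.not_ge ((Model.lowNorm_le_sobolevNorm hs0 (hspec _).2 hlow).trans le_add_self)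
  · have hsp := hspec 0
    rw [hv0] at hsp ⊢
    rw [stateNorm, Model.sobolevNorm_synth_zero s hsp.1 (fun ξ => by simp [etaHat]), zero_add]
    refine (Model.sobolevNorm_pulse_le hs0 (by linarith) (by linarith) hsp.2).trans_lt ?_
    convert hN2 using 3
    calc 4 * N * N ^ (2 * s) * A ^ 2 = 4 * (N ^ (1 : ℝ) * N ^ (2 * s) * (N ^ (m + e) * N ^ (m + e))) := by
          rw [hA, Real.rpow_one]
          ring
      _ = _ := by
          rw [← Real.rpow_add hN0, ← Real.rpow_add hN0, ← Real.rpow_add hN0]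
          congr 2
          rw [he]
          ring

/-! ### The KdV-KdV regime. -/

/-- The symbols of the KdV-KdV system. -/
def kdvModel : Model where
  freq ξ := 2 * Real.pi * ξ * (1 - 1 / 6 * (2 * Real.pi * ξ) ^ 2)
  r _ := 1
  b₁ ξ := 2 * Real.pi * ξ
  b₂ ξ := 2 * Real.pi * ξ
  K := 1
  continuous_freq := by fun_prop
  continuous_r := by fun_prop
  continuous_b₁ := by fun_prop
  continuous_b₂ := by fun_prop
  freq_neg ξ := by ring
  r_neg ξ := rfl
  b₁_neg ξ := by ring
  b₂_neg ξ := by ring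
  r_pos ξ := one_pos
  r_le ξ := le_rfl
  inv_r_le ξ := by norm_num

theorem kdvModel_represents : kdvModel.Represents (1 / 6) 0 (1 / 6) 0 where
  eq_freq_mul ξ := by simp only [kdvModel]; ring
  eq_freq_div ξ := by simp only [kdvModel]; ring
  eq_b₁ ξ := by simp only [kdvModel]; ring
  eq_b₂ ξ := by simp only [kdvModel]; ring
  growth := by
    refine ⟨2 * Real.pi * (1 + 1 / 6 * (2 * Real.pi) ^ 2), fun ξ => ?_⟩
    have h0 := abs_nonneg ξ
    have h1 : |1 - 1 / 6 * (2 * Real.pi * ξ) ^ 2| ≤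
        (1 + 1 / 6 * (2 * Real.pi) ^ 2) * (1 + |ξ|) ^ 2 := by
      rw [mul_pow, ← sq_abs ξ]
      refine abs_le.2 ⟨?_, ?_⟩ <;> nlinarith [sq_nonneg Real.pi, sq_nonneg (|ξ|),
        mul_nonneg (sq_nonneg Real.pi) h0]
    calc |2 * Real.pi * ξ * (1 - 1 / 6 * (2 * Real.pi * ξ) ^ 2)|
        = 2 * Real.pi * |ξ| * |1 - 1 / 6 * (2 * Real.pi * ξ) ^ 2| := by
          rw [abs_mul, abs_mul, abs_of_pos Real.two_pi_pos]
      _ ≤ 2 * Real.pi * (1 + |ξ|) * ((1 + 1 / 6 * (2 * Real.pi) ^ 2) * (1 + |ξ|) ^ 2) := by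
          gcongr
          linarith
      _ = _ := by ring

/-- Here `m = 1`: the nonlinear symbol is a full derivative, bounded through `N (1 + |ξ|/N) = N +
|ξ|`, and the cubic dispersion is of order `N · (N^1)²`. -/
theorem kdvModel_bounds : kdvModel.Bounds (4 * Real.pi * (1 + 4 * (2 * Real.pi) ^ 2)) 1 := by
  have hb : ∀ N : ℝ, 1 ≤ N → ∀ ξ : ℝ, |2 * Real.pi * ξ| ≤
      4 * Real.pi * (1 + 4 * (2 * Real.pi) ^ 2) * N ^ 1 * (1 + |ξ| / N) := by
    intro N hN ξ
    have hN0 : 0 < N := by linarith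
    have e : N * (1 + |ξ| / N) = N + |ξ| := by field_simp
    rw [abs_mul, abs_of_pos Real.two_pi_pos, pow_one, mul_assoc _ N, e]
    refine mul_le_mul ?_ (by linarith) (abs_nonneg _) (by positivity)
    nlinarith [Real.pi_pos, mul_pos Real.pi_pos (pow_pos Real.pi_pos 2)]
  refine ⟨by positivity, hb, hb, fun N hN ξ hξ => ?_, fun ξ hξ => ?_⟩
  · have hN0 : 0 < N := by linarith
    have h1 : ξ ^ 2 ≤ 4 * N ^ 2 := by
      rw [← sq_abs]
      nlinarith [abs_nonneg ξ]
    have h2 : (1 : ℝ) ≤ N ^ 2 := by nlinarith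
    have h3 : |1 - 1 / 6 * (2 * Real.pi * ξ) ^ 2| ≤ (1 + 4 * (2 * Real.pi) ^ 2) * N ^ 2 := by
      rw [mul_pow]
      have h4 : (2 * Real.pi) ^ 2 * ξ ^ 2 ≤ (2 * Real.pi) ^ 2 * (4 * N ^ 2) := by gcongr
      have h5 : 0 ≤ (2 * Real.pi) ^ 2 * ξ ^ 2 := by positivity
      refine abs_le.2 ⟨?_, ?_⟩ <;> nlinarith
    calc |2 * Real.pi * ξ * (1 - 1 / 6 * (2 * Real.pi * ξ) ^ 2)|
        = 2 * Real.pi * |ξ| * |1 - 1 / 6 * (2 * Real.pi * ξ) ^ 2| := by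
          rw [abs_mul, abs_mul, abs_of_pos Real.two_pi_pos]
      _ ≤ 2 * Real.pi * (2 * N) * ((1 + 4 * (2 * Real.pi) ^ 2) * N ^ 2) := by gcongr
      _ = _ := by ring
  · have h1 : 1 ≤ 2 * Real.pi * ξ := by nlinarith [hξ.1, Real.two_le_pi]
    have h2 : 1 ≤ 4 * Real.pi * (1 + 4 * (2 * Real.pi) ^ 2) := by
      nlinarith [Real.two_le_pi, sq_nonneg Real.pi]
    exact (div_le_one_of_le₀ h2 (by linarith)).trans h1

/-! ### The generic regime. -/

section generic

variable {a b c d : ℝ}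

/-- Bounds for a quotient of two positive symbols of order two. -/
theorem div_symbol_le {p q : ℝ} (hp : 0 < p) (hq : 0 < q) {X : ℝ} (hX : 0 ≤ X) :
    (1 + p * X) / (1 + q * X) ≤ 1 + p / q := by
  rw [div_le_iff₀ (by positivity)]
  have : (1 + p / q) * (1 + q * X) = 1 + p * X + (p / q + q * X) := by field_simp; ring
  rw [this]
  have : 0 ≤ p / q + q * X := by positivity
  linarith

/-- The quotient of the dispersive symbols of the two equations. -/
def symbolRatio (a b c d ξ : ℝ) : ℝ :=
  (1 + -a * (2 * Real.pi * ξ) ^ 2) / (1 + b * (2 * Real.pi * ξ) ^ 2) *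
    ((1 + d * (2 * Real.pi * ξ) ^ 2) / (1 + -c * (2 * Real.pi * ξ) ^ 2))

/-- Positivity permits the square root `r`, which balances the two off-diagonal linear symbols and
makes the linear flow oscillatory with a real frequency. -/
theorem symbolRatio_pos (ha : a < 0) (hc : c < 0) (hb : 0 < b) (hd : 0 < d) (ξ : ℝ) :
    0 < symbolRatio a b c d ξ := by
  have := neg_pos.2 ha
  have := neg_pos.2 hc
  unfold symbolRatio
  positivity

theorem symbolRatio_le (ha : a < 0) (hc : c < 0) (hb : 0 < b) (hd : 0 < d) (ξ : ℝ) :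
    symbolRatio a b c d ξ ≤ (1 + -a / b) * (1 + d / -c) := by
  have ha' := neg_pos.2 ha
  have := neg_pos.2 hc
  exact mul_le_mul (div_symbol_le ha' hb (sq_nonneg _)) (div_symbol_le hd this (sq_nonneg _))
    (by positivity) (by positivity)

theorem inv_symbolRatio_le (ha : a < 0) (hc : c < 0) (hb : 0 < b) (hd : 0 < d) (ξ : ℝ) :
    (symbolRatio a b c d ξ)⁻¹ ≤ (1 + b / -a) * (1 + -c / d) := by
  have := neg_pos.2 ha
  have := neg_pos.2 hc
  rw [symbolRatio, mul_inv, inv_div, inv_div]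
  exact mul_le_mul (div_symbol_le hb (neg_pos.2 ha) (sq_nonneg _))
    (div_symbol_le this hd (sq_nonneg _)) (by positivity) (by positivity)

theorem sqrt_le_one_add {x y : ℝ} (hy : 0 ≤ y) (h : x ≤ y) : √x ≤ 1 + y :=
  Real.sqrt_le_iff.2 ⟨by linarith, by nlinarith⟩

theorem continuous_one_add_mul_sq (q : ℝ) :
    Continuous fun ξ : ℝ => 1 + q * (2 * Real.pi * ξ) ^ 2 := by fun_prop

theorem one_add_mul_sq_pos {q : ℝ} (hq : 0 < q) (ξ : ℝ) : 0 < 1 + q * (2 * Real.pi * ξ) ^ 2 := by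
  positivity

theorem continuous_symbolRatio (hc : c < 0) (hb : 0 < b) : Continuous (symbolRatio a b c d) :=
  ((continuous_one_add_mul_sq _).div (continuous_one_add_mul_sq _)
    fun ξ => (one_add_mul_sq_pos hb ξ).ne').mul ((continuous_one_add_mul_sq _).div
      (continuous_one_add_mul_sq _) fun ξ => (one_add_mul_sq_pos (neg_pos.2 hc) ξ).ne')

/-- The symbols of the generic system. -/
def genericModel (ha : a < 0) (hc : c < 0) (hb : 0 < b) (hd : 0 < d) : Model where
  freq ξ := 2 * Real.pi * ξ * (1 + -a * (2 * Real.pi * ξ) ^ 2) / (1 + b * (2 * Real.pi * ξ) ^ 2) *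
    (√(symbolRatio a b c d ξ))⁻¹
  r ξ := √(symbolRatio a b c d ξ)
  b₁ ξ := 2 * Real.pi * ξ / (1 + b * (2 * Real.pi * ξ) ^ 2)
  b₂ ξ := 2 * Real.pi * ξ / (1 + d * (2 * Real.pi * ξ) ^ 2)
  -- The sum of a bound for `r` and one for `r⁻¹`, each from `√x ≤ 1 + y` for `x ≤ y`.
  K := (1 + (1 + -a / b) * (1 + d / -c)) + (1 + (1 + b / -a) * (1 + -c / d))
  continuous_freq := (((by fun_prop : Continuous fun ξ : ℝ => 2 * Real.pi * ξ).mul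
    (continuous_one_add_mul_sq _)).div (continuous_one_add_mul_sq _)
      fun ξ => (one_add_mul_sq_pos hb ξ).ne').mul ((continuous_symbolRatio hc hb).sqrt.inv₀
        fun ξ => (Real.sqrt_pos.2 (symbolRatio_pos ha hc hb hd ξ)).ne')
  continuous_r := (continuous_symbolRatio hc hb).sqrt
  continuous_b₁ := (by fun_prop : Continuous fun ξ : ℝ => 2 * Real.pi * ξ).div
    (continuous_one_add_mul_sq _) fun ξ => (one_add_mul_sq_pos hb ξ).ne'
  continuous_b₂ := (by fun_prop : Continuous fun ξ : ℝ => 2 * Real.pi * ξ).div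
    (continuous_one_add_mul_sq _) fun ξ => (one_add_mul_sq_pos hd ξ).ne'
  freq_neg ξ := by simp only [symbolRatio, mul_neg, neg_sq]; ring
  r_neg ξ := by simp only [symbolRatio, mul_neg, neg_sq]
  b₁_neg ξ := by simp only [mul_neg, neg_sq]; ring
  b₂_neg ξ := by simp only [mul_neg, neg_sq]; ring
  r_pos ξ := Real.sqrt_pos.2 (symbolRatio_pos ha hc hb hd ξ)
  r_le ξ := by
    have := neg_pos.2 ha
    have := neg_pos.2 hc
    refine (sqrt_le_one_add (by positivity) (symbolRatio_le ha hc hb hd ξ)).trans ?_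
    exact le_add_of_nonneg_right (by positivity)
  inv_r_le ξ := by
    have := neg_pos.2 ha
    have := neg_pos.2 hc
    rw [← Real.sqrt_inv]
    refine (sqrt_le_one_add (by positivity) (inv_symbolRatio_le ha hc hb hd ξ)).trans ?_
    exact le_add_of_nonneg_left (by positivity)

theorem abs_genericModel_freq_le (ha : a < 0) (hc : c < 0) (hb : 0 < b) (hd : 0 < d) (ξ : ℝ) :
    |(genericModel ha hc hb hd).freq ξ| ≤
      2 * Real.pi * ((1 + -a / b) * (genericModel ha hc hb hd).K) * |ξ| := by
  have h1 := div_symbol_le (neg_pos.2 ha) hb (sq_nonneg (2 * Real.pi * ξ))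
  have h2 := (genericModel ha hc hb hd).inv_r_le ξ
  have h3 := inv_pos.2 ((genericModel ha hc hb hd).r_pos ξ)
  have h4 := one_add_mul_sq_pos (neg_pos.2 ha) ξ
  have h5 := one_add_mul_sq_pos hb ξ
  have h6 : 0 ≤ 1 + -a / b := by have := neg_pos.2 ha; positivity
  have e : (genericModel ha hc hb hd).freq ξ = 2 * Real.pi * ξ *
    ((1 + -a * (2 * Real.pi * ξ) ^ 2) / (1 + b * (2 * Real.pi * ξ) ^ 2) *
      ((genericModel ha hc hb hd).r ξ)⁻¹) := by
    simp only [genericModel]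
    ring
  rw [e, abs_mul, abs_mul, abs_of_pos Real.two_pi_pos,
    abs_of_pos (mul_pos (div_pos h4 h5) h3), mul_right_comm (2 * Real.pi)]
  refine mul_le_mul_of_nonneg_right (mul_le_mul_of_nonneg_left ?_ Real.two_pi_pos.le) (abs_nonneg _)
  exact mul_le_mul h1 h2 h3.le h6

theorem genericModel_represents (ha : a < 0) (hc : c < 0) (hb : 0 < b) (hd : 0 < d) :
    (genericModel ha hc hb hd).Represents a b c d where
  eq_freq_mul ξ := by
    have h1 := (Real.sqrt_pos.2 (symbolRatio_pos ha hc hb hd ξ)).ne'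
    have h2 := (one_add_mul_sq_pos hb ξ).ne'
    simp only [genericModel]
    rw [inv_mul_cancel_right₀ h1, mul_div_cancel₀ _ h2]
    ring
  eq_freq_div ξ := by
    have h2 := (one_add_mul_sq_pos hb ξ).ne'
    have h3 := (one_add_mul_sq_pos hd ξ).ne'
    have h4 := (one_add_mul_sq_pos (neg_pos.2 hc) ξ).ne'
    have h5 := (one_add_mul_sq_pos (neg_pos.2 ha) ξ).ne'
    simp only [genericModel]
    rw [mul_assoc _ (√(symbolRatio a b c d ξ))⁻¹, ← mul_inv,
      Real.mul_self_sqrt (symbolRatio_pos ha hc hb hd ξ).le, symbolRatio, mul_inv, inv_div, inv_div,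
      sub_eq_add_neg, ← neg_mul]
    generalize 1 + b * (2 * Real.pi * ξ) ^ 2 = x at *
    generalize 1 + d * (2 * Real.pi * ξ) ^ 2 = y at *
    generalize 1 + -c * (2 * Real.pi * ξ) ^ 2 = z at *
    generalize 1 + -a * (2 * Real.pi * ξ) ^ 2 = w at *
    field_simp
  eq_b₁ ξ := by
    simp only [genericModel]
    rw [mul_div_cancel₀ _ (one_add_mul_sq_pos hb ξ).ne']
  eq_b₂ ξ := by
    simp only [genericModel]
    rw [mul_div_cancel₀ _ (one_add_mul_sq_pos hd ξ).ne']
  growth := by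
    refine ⟨2 * Real.pi * ((1 + -a / b) * (genericModel ha hc hb hd).K), fun ξ =>
      (abs_genericModel_freq_le ha hc hb hd ξ).trans ?_⟩
    have h1 := (genericModel ha hc hb hd).K_pos
    have h2 : 0 ≤ 1 + -a / b := by have := neg_pos.2 ha; positivity
    have h3 : |ξ| ≤ (1 + |ξ|) ^ 3 := by
      have := le_self_pow₀ (by linarith [abs_nonneg ξ] : 1 ≤ 1 + |ξ|) (by norm_num : 3 ≠ 0)
      linarith
    gcongr

theorem abs_div_one_add_mul_sq_le {q : ℝ} (hq : 0 < q) (x : ℝ) :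
    |x / (1 + q * x ^ 2)| ≤ 1 + 1 / q := by
  have h : 0 < 1 + q * x ^ 2 := by positivity
  rw [abs_div, abs_of_pos h, div_le_iff₀ h, ← sq_abs]
  have e : (1 + 1 / q) * (1 + q * |x| ^ 2) = 1 + |x| ^ 2 + (1 / q + q * |x| ^ 2) := by
    field_simp
    ring
  have : 0 ≤ 1 / q + q * |x| ^ 2 := by positivity
  nlinarith [sq_nonneg (|x| - 1)]

/-- Here `m = 0`: the regularization in both equations makes the nonlinear symbols bounded, and the
frequency grows at most linearly. -/
theorem exists_genericModel_bounds (ha : a < 0) (hc : c < 0) (hb : 0 < b) (hd : 0 < d) :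
    ∃ C, (genericModel ha hc hb hd).Bounds C 0 := by
  have hK := (genericModel ha hc hb hd).K_pos
  obtain ⟨L, hL⟩ : ∃ L, L = 2 * Real.pi * ((1 + -a / b) * (genericModel ha hc hb hd).K) := ⟨_, rfl⟩
  have hL0 : 0 < L := by
    have := neg_pos.2 ha
    rw [hL]
    positivity
  -- The summands bound `b₁`, `b₂`, the frequency on `|ξ| ≤ 2N`, and the denominator of `b₂` on
  -- `[1/2, 1]`.
  obtain ⟨C, hC⟩ : ∃ C, C = (1 + 1 / b) + (1 + 1 / d) + 2 * L + (1 + d * (2 * Real.pi) ^ 2) :=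
    ⟨_, rfl⟩
  have hC0 : 0 < C := by rw [hC]; positivity
  have p1 : 0 < 1 / b := by positivity
  have p2 : 0 < 1 / d := by positivity
  have p3 : 0 < d * (2 * Real.pi) ^ 2 := by positivity
  have hw : ∀ N, 1 ≤ N → ∀ ξ, C ≤ C * N ^ 0 * (1 + |ξ| / N) := fun N hN ξ => by
    have : 0 ≤ |ξ| / N := by positivity
    rw [pow_zero, mul_one]
    exact le_mul_of_one_le_right hC0.le (by linarith)
  refine ⟨C, hC0, fun N hN ξ => ?_, fun N hN ξ => ?_, fun N hN ξ hξ => ?_, fun ξ hξ => ?_⟩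
  · exact ((abs_div_one_add_mul_sq_le hb _).trans (by linarith)).trans (hw N hN ξ)
  · exact ((abs_div_one_add_mul_sq_le hd _).trans (by linarith)).trans (hw N hN ξ)
  · have h1 := abs_genericModel_freq_le ha hc hb hd ξ
    rw [← hL] at h1
    refine h1.trans ?_
    rw [pow_zero, one_pow, mul_one]
    nlinarith
  · have h1 : 1 ≤ 2 * Real.pi * ξ := by nlinarith [hξ.1, Real.two_le_pi]
    have h2 : 1 + d * (2 * Real.pi * ξ) ^ 2 ≤ C := by
      have h3 : ξ ^ 2 ≤ 1 := by nlinarith [hξ.1, hξ.2]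
      have h4 : d * (2 * Real.pi * ξ) ^ 2 ≤ d * (2 * Real.pi) ^ 2 := by
        rw [mul_pow (2 * Real.pi) ξ]
        exact mul_le_mul_of_nonneg_left (mul_le_of_le_one_right (sq_nonneg _) h3) hd.le
      linarith
    exact div_le_div₀ (by linarith) h1 (one_add_mul_sq_pos hd ξ) h2

end generic

end Boussinesq

end

theorem theorem1 :
    (∀ a b c d : ℝ, a < 0 → c < 0 → 0 < b → 0 < d →
      Boussinesq.UniqueSolutions a b c d ∧
      ∀ s : ℝ, s < -1 / 2 → ∀ T : ℝ, 0 < T →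
        ¬ Boussinesq.FlowContinuousAtOrigin a b c d s T) ∧
    (Boussinesq.UniqueSolutions (1 / 6) 0 (1 / 6) 0 ∧
      ∀ s : ℝ, s < -3 / 2 → ∀ T : ℝ, 0 < T →
        ¬ Boussinesq.FlowContinuousAtOrigin (1 / 6) 0 (1 / 6) 0 s T) := by
  refine ⟨fun a b c d ha hc hb hd => ?_, ?_⟩
  · have hu := Boussinesq.uniqueSolutions_generic ha hc hb hd
    obtain ⟨C, hC⟩ := Boussinesq.exists_genericModel_bounds ha hc hb hd
    exact ⟨hu, fun s hs T hT => Boussinesq.not_flowContinuousAtOrigin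
      (Boussinesq.genericModel_represents ha hc hb hd) hC hu (by simpa using hs) hT⟩
  · have hu : Boussinesq.UniqueSolutions (1 / 6) 0 (1 / 6) 0 :=
      Boussinesq.uniqueSolutions_kdv (by norm_num)
    exact ⟨hu, fun s hs T hT => Boussinesq.not_flowContinuousAtOrigin
      Boussinesq.kdvModel_represents Boussinesq.kdvModel_bounds hu
      (by norm_num; linarith) hT⟩
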